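/- \textbf{(Bounded \& Sectored Real Lemma.)} \emph{Phases.} For $M\in\mathbb{C}^{m\times m}$ let $\bar\sigma(M)$ be its largest singular value and $W(M)=\{x^*Mx:\|x\|=1\}$ its numerical range; $M$ is semi-sectorial if $0$ is not an interior point of $W(M)$. A nonzero $M$ has phase sector $[\underline\phi,\bar\phi]$ if there is a generalized sectorial decomposition $M=T^*(0\oplus D\oplus E)T$ with $T$ nonsingular, $D=\mathrm{diag}(e^{j\theta_1},\dots,e^{j\theta_d})$, $E$ a direct sum of $p\ge 0$ copies of $e^{j\theta_0}\begin{bmatrix}1&2\\0&1\end{bmatrix}$, such that $\underline\phi$ and $\bar\phi$ are the smallest and the largest of the phases $\theta_1,\dots,\theta_d$ and (if $p>0$) $\theta_0\pm\frac{\pi}{2}$, with $\bar\phi-\underline\phi\le\pi$ and phase center $\frac{\underline\phi+\bar\phi}{2}\in(-\pi,\pi]$. The zero matrix has no phases (empty phase sector). \emph{Systems.} Let $\omega_c>0$ and let $G$ be an $m\times m$ real rational proper transfer matrix which is semi-stable (no poles in $\mathrm{Re}\,s>0$). Let $j\Omega_p$ be its set of poles on the imaginary axis, and assume $|\omega|<\omega_c$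 for all $\omega\in\Omega_p$. Let $\Omega\subset(-\omega_c,\omega_c)$ be the set of frequencies in this interval of the poles and zeros of $G$ on the imaginary axis (a zero that is not a pole being a point where the rank of $G(s)$ drops below its normal rank). For small $\epsilon>0$ let $CT_\epsilon$ be the segment $j[-\omega_c,\omega_c]$ indented into the right half plane by semicircles of radius $\epsilon$ around the points of $j\Omega$. Assume that $G$ is frequency-wise semi-sectorial over $(-\omega_c,\omega_c)$: $G(j\omega)$ is semi-sectorial for $\omega\in(-\omega_c,\omega_c)\setminus\Omega_p$, and for all sufficiently small $\epsilon>0$, $G(s)$ has constant rank and is semi-sectorial along $CT_\epsilon$. A \emph{phase response} of $G$ is a choice of a phase sector $[\underline\phi(G(s)),\bar\phi(G(s))]$ for all $s\in j([-\omega_c,\omega_c]\setminus\Omega_p)$ and all $s\in CT_\epsilon$, $\epsilon$ small, with $G(s)\neq0$, whose phase center is continuous along $CT_\epsilon$ (where $G(s)=0$, any value of the center is allowed) for all small $\epsilon>0$, and is $0$ at $s=0$ (at $s=\epsilon$ if $0\in\Omega$). Assume that $G$ has a phase response. The statement $\Psi(G(j\omega))\subset[\alpha,\beta]$ on $[0,\omega_c]\setminus\Omega_p$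 means that $G$ has a phase response with $[\underline\phi(G(j\omega)),\bar\phi(G(j\omega))]\subset[\alpha,\beta]$ for all $\omega\in[0,\omega_c]\setminus\Omega_p$ with $G(j\omega)\neq 0$. \emph{Theorem.} Let $(A,B,C,D)$ be a minimal real realization of $G$ (so $G(s)=C(sI-A)^{-1}B+D$ with the least state dimension), let $\gamma\in(0,\infty)$ and $\alpha,\beta\in(-\pi,\pi)$ with $\beta-\alpha\in(0,\pi]$, and put $$\Pi_1=\begin{bmatrix}0&e^{j(\alpha-\frac{\pi}{2})}I\\e^{-j(\alpha-\frac{\pi}{2})}I&0\end{bmatrix},\quad \Pi_2=\begin{bmatrix}0&e^{j(\frac{\pi}{2}+\beta)}I\\e^{-j(\frac{\pi}{2}+\beta)}I&0\end{bmatrix},\quad \Pi_3=\begin{bmatrix}I&0\\0&-\gamma^2I\end{bmatrix}.$$ Then $$\Psi(G(j\omega))\subset[\alpha,\beta]\ \text{ for }\omega\in[0,\omega_c]\setminus\Omega_p\quad\text{and}\quad\bar\sigma(G(j\omega))\le\gamma\ \text{ for }\omega\in[\omega_c,\infty)$$ if and only if there exist complex Hermitian matrices $P_i$ and $Q_i\ge0$,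 $i=1,2,3$, such that $$\begin{bmatrix}A&B\\I&0\end{bmatrix}^*\begin{bmatrix}-2Q_i&P_i+j\omega_cQ_i\\P_i-j\omega_cQ_i&0\end{bmatrix}\begin{bmatrix}A&B\\I&0\end{bmatrix}+\begin{bmatrix}C&D\\0&I\end{bmatrix}^*\Pi_i\begin{bmatrix}C&D\\0&I\end{bmatrix}\le0,\quad i=1,2,$$ $$\begin{bmatrix}A&B\\I&0\end{bmatrix}^*\begin{bmatrix}0&P_3+jQ_3\\P_3-jQ_3&-2\omega_cQ_3\end{bmatrix}\begin{bmatrix}A&B\\I&0\end{bmatrix}+\begin{bmatrix}C&D\\0&I\end{bmatrix}^*\Pi_3\begin{bmatrix}C&D\\0&I\end{bmatrix}\le0.$$ -/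

import Mathlib

open scoped Matrix ComplexOrder

noncomputable section

namespace MixedGP

/-! ### Gains and phases of complex matrices -/

/-- The numerical range `{x* A x : x* x = 1}`. -/
def numRange {n : ℕ} (A : Matrix (Fin n) (Fin n) ℂ) : Set ℂ :=
  {w | ∃ x : Fin n → ℂ, star x ⬝ᵥ x = 1 ∧ w = star x ⬝ᵥ (A *ᵥ x)}

/-- `A` is semi-sectorial: `0` is not an interior point of its numerical range. -/
def IsSemiSectorial {n : ℕ} (A : Matrix (Fin n) (Fin n) ℂ) : Prop :=
  (0 : ℂ) ∉ interior (numRange A)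

/-- The largest singular value, i.e. the operator norm for the Euclidean norm. -/
def maxSingularValue {n : ℕ} (A : Matrix (Fin n) (Fin n) ℂ) : ℝ :=
  ‖Matrix.toEuclideanCLM (n := Fin n) (𝕜 := ℂ) A‖

/-- The middle factor `0_z ⊕ diag(exp(j θ_i)) ⊕ diag(exp(j θ₀) [1 2; 0 1], ...)` of a generalized
sectorial decomposition, with `p` blocks of size two. -/
def sectorialCore (z p : ℕ) {d : ℕ} (θ : Fin d → ℝ) (θ₀ : ℝ) :
    Matrix (Fin z ⊕ (Fin d ⊕ (Fin 2 × Fin p))) (Fin z ⊕ (Fin d ⊕ (Fin 2 × Fin p))) ℂ :=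
  Matrix.fromBlocks 0 0 0
    (Matrix.fromBlocks
      (Matrix.diagonal fun i => Complex.exp (Complex.I * (θ i : ℂ))) 0 0
      (Matrix.blockDiagonal fun _ : Fin p =>
        Complex.exp (Complex.I * (θ₀ : ℂ)) • (!![1, 2; 0, 1] : Matrix (Fin 2) (Fin 2) ℂ)))

/-- The set of phases read off from the middle factor: every `θ_i`, together with `θ₀ - π/2` and
`θ₀ + π/2` if there is at least one block of size two. -/
def corePhases (p : ℕ) {d : ℕ} (θ : Fin d → ℝ) (θ₀ : ℝ) : Set ℝ :=
  Set.range θ ∪ {x | 0 < p ∧ (x = θ₀ - Real.pi / 2 ∨ x = θ₀ + Real.pi / 2)}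

/-- `[lo, hi]` is a phase sector of the (necessarily nonzero) matrix `A`: there is a generalized
sectorial decomposition `A = T* (0 ⊕ D ⊕ E) T`, `T` nonsingular, whose smallest phase is `lo` and
whose largest phase is `hi`, where `hi - lo ≤ π` and the phase center `(lo + hi) / 2` lies in
`(-π, π]`. -/
def IsPhaseSector {n : ℕ} (A : Matrix (Fin n) (Fin n) ℂ) (lo hi : ℝ) : Prop :=
  (∃ (z d p : ℕ) (θ : Fin d → ℝ) (θ₀ : ℝ)
      (e : (Fin z ⊕ (Fin d ⊕ (Fin 2 × Fin p))) ≃ Fin n) (T : Matrix (Fin n) (Fin n) ℂ),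
      IsUnit T ∧
      A = Tᴴ * Matrix.reindex e e (sectorialCore z p θ θ₀) * T ∧
      IsLeast (corePhases p θ θ₀) lo ∧ IsGreatest (corePhases p θ θ₀) hi) ∧
  hi - lo ≤ Real.pi ∧
  (lo + hi) / 2 ∈ Set.Ioc (-Real.pi) Real.pi

/-! ### Real rational systems -/

/-- The value `G(s)` (meaningful when `s` is not a pole). -/
def evalAt {m : ℕ} (G : Matrix (Fin m) (Fin m) (RatFunc ℝ)) (s : ℂ) :
    Matrix (Fin m) (Fin m) ℂ :=
  G.map (RatFunc.eval (algebraMap ℝ ℂ) s)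

/-- `s` is a pole of `G`: a pole of one of its entries. -/
def IsPole {m : ℕ} (G : Matrix (Fin m) (Fin m) (RatFunc ℝ)) (s : ℂ) : Prop :=
  ∃ i j, Polynomial.aeval s (G i j).denom = 0

/-- `s`, not a pole, is a zero of `G`: the rank of `G(s)` is below the normal rank of `G`. -/
def IsZero {m : ℕ} (G : Matrix (Fin m) (Fin m) (RatFunc ℝ)) (s : ℂ) : Prop :=
  ¬ IsPole G s ∧ (evalAt G s).rank < G.rank

/-- The frequencies in `(a, b)` of the poles and zeros of `G` on the imaginary axis. -/
def critFreq {m : ℕ} (G : Matrix (Fin m) (Fin m) (RatFunc ℝ)) (a b : ℝ) : Set ℝ :=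
  {ω | ω ∈ Set.Ioo a b ∧ (IsPole G (ω * Complex.I) ∨ IsZero G (ω * Complex.I))}

/-- No poles in the open right half plane. -/
def IsSemiStable {m : ℕ} (G : Matrix (Fin m) (Fin m) (RatFunc ℝ)) : Prop :=
  ∀ s : ℂ, 0 < s.re → ¬ IsPole G s

/-- The segment `j[a, b]`, indented to the right by semicircles of radius `ε` around `jω₀`,
`ω₀ ∈ Ω`. -/
def contour (a b ε : ℝ) (Ω : Set ℝ) : Set ℂ :=
  {s | ∃ ω ∈ Set.Icc a b, (∀ ω₀ ∈ Ω, ε ≤ |ω - ω₀|) ∧ s = ω * Complex.I} ∪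
  {s | ∃ ω₀ ∈ Ω, ‖s - ω₀ * Complex.I‖ = ε ∧ 0 < s.re}

/-- `G` is frequency-wise semi-sectorial over `(a, b)`. -/
def IsFreqSemiSectorial {m : ℕ} (G : Matrix (Fin m) (Fin m) (RatFunc ℝ)) (a b : ℝ) : Prop :=
  (∀ ω ∈ Set.Ioo a b, ¬ IsPole G (ω * Complex.I) →
    IsSemiSectorial (evalAt G (ω * Complex.I))) ∧
  ∃ ε' > (0 : ℝ), ∀ ε ∈ Set.Ioc 0 ε',
    (∃ r : ℕ, ∀ s ∈ contour a b ε (critFreq G a b), (evalAt G s).rank = r) ∧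
    ∀ s ∈ contour a b ε (critFreq G a b), IsSemiSectorial (evalAt G s)

/-- `s ↦ [lo s, hi s]` is a phase response of `G` over `[-ωc, ωc]`: it is a phase sector of `G(s)`
for `s` on the imaginary axis (away from the poles) and on the contours indented around poles and
zeros; the phase center is continuous along these contours; and it is `0` at their
point on the positive real half-line, which is `0`, or `ε` if the contour is indented at `0`.
The zero matrix has no phases, so nothing is required of it. -/
def IsPhaseResponse {m : ℕ} (G : Matrix (Fin m) (Fin m) (RatFunc ℝ)) (ωc : ℝ)
    (lo hi : ℂ → ℝ) : Prop :=
  (∀ ω ∈ Set.Icc (-ωc) ωc, ¬ IsPole G (ω * Complex.I) → evalAt G (ω * Complex.I) ≠ 0 →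
    IsPhaseSector (evalAt G (ω * Complex.I)) (lo (ω * Complex.I)) (hi (ω * Complex.I))) ∧
  ∃ ε' > (0 : ℝ), ∀ ε ∈ Set.Ioc 0 ε',
    (∀ s ∈ contour (-ωc) ωc ε (critFreq G (-ωc) ωc), evalAt G s ≠ 0 →
      IsPhaseSector (evalAt G s) (lo s) (hi s)) ∧
    ContinuousOn (fun s => (lo s + hi s) / 2) (contour (-ωc) ωc ε (critFreq G (-ωc) ωc)) ∧
    ((0 : ℝ) ∉ critFreq G (-ωc) ωc → (lo 0 + hi 0) / 2 = 0) ∧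
    ((0 : ℝ) ∈ critFreq G (-ωc) ωc → (lo (ε : ℂ) + hi (ε : ℂ)) / 2 = 0)

/-- `Ψ(G(jω)) ⊆ [α, β]` for all `ω ∈ [0, ωc]` that are not frequencies of poles, `Ψ(G(jω))` being
given by a phase response of `G` (and empty where `G(jω) = 0`). -/
def PhasesWithin {m : ℕ} (G : Matrix (Fin m) (Fin m) (RatFunc ℝ)) (ωc α β : ℝ) : Prop :=
  ∃ lo hi : ℂ → ℝ, IsPhaseResponse G ωc lo hi ∧
    ∀ ω ∈ Set.Icc 0 ωc, ¬ IsPole G (ω * Complex.I) → evalAt G (ω * Complex.I) ≠ 0 →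
      Set.Icc (lo (ω * Complex.I)) (hi (ω * Complex.I)) ⊆ Set.Icc α β

/-! ### State-space realizations and the matrix inequalities -/

/-- `G(s) = C (s I - A)⁻¹ B + D` as rational matrices. -/
def IsRealization {m k : ℕ} (G : Matrix (Fin m) (Fin m) (RatFunc ℝ))
    (A : Matrix (Fin k) (Fin k) ℝ) (B : Matrix (Fin k) (Fin m) ℝ)
    (C : Matrix (Fin m) (Fin k) ℝ) (D : Matrix (Fin m) (Fin m) ℝ) : Prop :=
  G = C.map RatFunc.C * (Matrix.scalar (Fin k) RatFunc.X - A.map RatFunc.C)⁻¹ * B.map RatFunc.C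
    + D.map RatFunc.C

/-- A realization of least state dimension. -/
def IsMinimalRealization {m k : ℕ} (G : Matrix (Fin m) (Fin m) (RatFunc ℝ))
    (A : Matrix (Fin k) (Fin k) ℝ) (B : Matrix (Fin k) (Fin m) ℝ)
    (C : Matrix (Fin m) (Fin k) ℝ) (D : Matrix (Fin m) (Fin m) ℝ) : Prop :=
  IsRealization G A B C D ∧
  ∀ (k' : ℕ) (A' : Matrix (Fin k') (Fin k') ℝ) (B' : Matrix (Fin k') (Fin m) ℝ)
    (C' : Matrix (Fin m) (Fin k') ℝ) (D' : Matrix (Fin m) (Fin m) ℝ),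
    IsRealization G A' B' C' D' → k ≤ k'

/-- `[A B; I 0]`. -/
def stateBlock {m k : ℕ} (A : Matrix (Fin k) (Fin k) ℝ) (B : Matrix (Fin k) (Fin m) ℝ) :
    Matrix (Fin k ⊕ Fin k) (Fin k ⊕ Fin m) ℂ :=
  Matrix.fromBlocks (A.map Complex.ofReal) (B.map Complex.ofReal) 1 0

/-- `[C D; 0 I]`. -/
def outputBlock {m k : ℕ} (C : Matrix (Fin m) (Fin k) ℝ) (D : Matrix (Fin m) (Fin m) ℝ) :
    Matrix (Fin m ⊕ Fin m) (Fin k ⊕ Fin m) ℂ :=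
  Matrix.fromBlocks (C.map Complex.ofReal) (D.map Complex.ofReal) 0 1

/-- `[A B; I 0]* X [A B; I 0] + [C D; 0 I]* M [C D; 0 I]`. -/
def lmiForm {m k : ℕ} (A : Matrix (Fin k) (Fin k) ℝ) (B : Matrix (Fin k) (Fin m) ℝ)
    (C : Matrix (Fin m) (Fin k) ℝ) (D : Matrix (Fin m) (Fin m) ℝ)
    (X : Matrix (Fin k ⊕ Fin k) (Fin k ⊕ Fin k) ℂ)
    (M : Matrix (Fin m ⊕ Fin m) (Fin m ⊕ Fin m) ℂ) :
    Matrix (Fin k ⊕ Fin m) (Fin k ⊕ Fin m) ℂ :=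
  (stateBlock A B)ᴴ * X * stateBlock A B + (outputBlock C D)ᴴ * M * outputBlock C D

/-- `[-2Q, P + jωc Q; P - jωc Q, 0]`. -/
def lowFreqBlock {k : ℕ} (ωc : ℝ) (P Q : Matrix (Fin k) (Fin k) ℂ) :
    Matrix (Fin k ⊕ Fin k) (Fin k ⊕ Fin k) ℂ :=
  Matrix.fromBlocks (-(2 : ℂ) • Q) (P + (Complex.I * (ωc : ℂ)) • Q)
    (P - (Complex.I * (ωc : ℂ)) • Q) 0

/-- `[0, P + jQ; P - jQ, -2ωc Q]`. -/
def highFreqBlock {k : ℕ} (ωc : ℝ) (P Q : Matrix (Fin k) (Fin k) ℂ) :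
    Matrix (Fin k ⊕ Fin k) (Fin k ⊕ Fin k) ℂ :=
  Matrix.fromBlocks 0 (P + Complex.I • Q) (P - Complex.I • Q) (-(2 * (ωc : ℂ)) • Q)

/-- `[0, exp(jη) I; exp(-jη) I, 0]`. -/
def phaseMultiplier (m : ℕ) (η : ℝ) : Matrix (Fin m ⊕ Fin m) (Fin m ⊕ Fin m) ℂ :=
  Matrix.fromBlocks 0 (Complex.exp (Complex.I * (η : ℂ)) • 1)
    (Complex.exp (-(Complex.I * (η : ℂ))) • 1) 0

/-- `[I, 0; 0, -γ² I]`. -/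
def gainMultiplier (m : ℕ) (γ : ℝ) : Matrix (Fin m ⊕ Fin m) (Fin m ⊕ Fin m) ℂ :=
  Matrix.fromBlocks 1 0 0 (-((γ : ℂ) ^ 2) • 1)

/-- `X ≤ 0` for a Hermitian matrix `X`. -/
def NegSemidef {ι : Type} [Fintype ι] (X : Matrix ι ι ℂ) : Prop := (-X).PosSemidef

end MixedGP

end

namespace MixedGP

open Matrix

/-! Both sides of the equivalence reduce to pointwise quadratic inequalities on the imaginary axis,
of the form `multiplierForm M (evalAt G (jω)) u ≤ 0`. The passage between such inequalities and the
matrix inequalities is a generalized KYP lemma; the passage between them and the phase response is a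
separate argument about branches of the phase.

KYP lemma (`exists_multipliers_of_frequency_inequality`). A bounded interval of frequencies is
encoded by a pencil `L ζ = ν R ζ` with `0 ≤ ν ≤ ρ`. The range `[0, ωc]` uses `ν = ω`; the range
`[ωc, ∞)` uses `ν = 1/ω`, so that infinity becomes the endpoint `ν = 0`. Multipliers imply the
frequency inequality by evaluating the form on a solution of the pencil. Conversely, the matrices
`freqForm L R ρ P Q + S`, with `P` Hermitian and `Q, S ≥ 0`, form a convex cone. Controllability
makes this cone closed, and this is what allows the non-strict inequality. If `-Θ` lay outside it, a
separating functional would give `H ≥ 0` with `tr(HΘ) > 0`. Its nonnegativity on the cone lets `H`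
be written as a sum of rank-one terms `ζ ζ*`, each `ζ` solving the pencil at some `ν` in `[0, ρ]`
(`exists_unitary_diagonal_factor`), and the frequency inequality then gives `tr(HΘ) ≤ 0`. Poles and
other exceptional frequencies are reached by continuity, since the Hautus test keeps the pencil of
full row rank.

Phases (`phasesWithin_iff`). The first two multipliers say that the numerical range of `G(jω)` lies
in the half-planes centred at `α + π/2` and `β - π/2`. A phase sector inside `[α, β]` clearly gives
this. Conversely, a normalized sector of such a matrix lies in `[α, β]`, except when `β = α + π` and
the sector is a half-plane displaced by `π` (`sector_subset_or`). Away from the poles and zeros,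
continuity of the phase center spreads this exception to nearby frequencies. Numerical ranges on a
fixed line over infinitely many frequencies force `α = -π/2` for a real rational `G ≠ 0`. The center
would then be `π` or `-π`, and since it is odd under conjugation (`IsPhaseResponse.center_star`),
one of the two conjugate centers would be `-π`, which the normalization excludes. At a zero, which
no indented contour meets, the sector may simply be replaced by the opposite one. -/

/-! ### Matrix factorizations behind the rank-one decomposition -/

/-- Two matrices with the same Gram matrix of rows differ by a unitary factor. -/
theorem exists_unitary_of_mul_conjTranspose_eq {p n : Type*} [Fintype p] [DecidableEq p] [Fintype n]
    [DecidableEq n] (M N : Matrix p n ℂ) (h : M * Mᴴ = N * Nᴴ) :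
    ∃ U : Matrix n n ℂ, U * Uᴴ = 1 ∧ M = N * U := by
  set f := toEuclideanLin Nᴴ with hf
  set g := toEuclideanLin Mᴴ with hg
  have hnorm : ∀ v, ‖g v‖ = ‖f v‖ := by
    intro v
    have key : ∀ X : Matrix p n ℂ, inner ℂ (toEuclideanLin Xᴴ v) (toEuclideanLin Xᴴ v)
        = inner ℂ v (toEuclideanLin (X * Xᴴ) v) := by
      intro X
      have h1 : toEuclideanLin (X * Xᴴ) v = toEuclideanLin X (toEuclideanLin Xᴴ v) := by
        ext i; simp [Matrix.toEuclideanLin, Matrix.toLpLin_apply]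
      rw [h1, toEuclideanLin_conjTranspose_eq_adjoint, LinearMap.adjoint_inner_left]
    have h2 : inner ℂ (g v) (g v) = inner ℂ (f v) (f v) := by
      rw [hf, hg, key, key, h]
    rw [inner_self_eq_norm_sq_to_K, inner_self_eq_norm_sq_to_K] at h2
    have h3 : ‖g v‖ ^ 2 = ‖f v‖ ^ 2 := by exact_mod_cast h2
    exact (sq_eq_sq₀ (norm_nonneg _) (norm_nonneg _)).1 h3
  -- Equal norms make `N* v ↦ M* v` a well-defined isometry on the range of `N*`: a section `σ`
  -- computes it, and the choice is irrelevant because `f` and `g` have the same kernel. In finite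
  -- dimension it extends to an isometry of the whole space.
  obtain ⟨σ, hσ⟩ := LinearMap.exists_rightInverse_of_surjective f.rangeRestrict
    (LinearMap.range_rangeRestrict f)
  have hσ' : ∀ y : LinearMap.range f, f (σ y) = y := fun y =>
    congrArg Subtype.val (LinearMap.congr_fun hσ y)
  let L : LinearMap.range f →ₗᵢ[ℂ] EuclideanSpace ℂ n :=
    { toLinearMap := g ∘ₗ σ
      norm_map' := fun y => by
        change ‖g (σ y)‖ = ‖y‖
        rw [hnorm, hσ']; rfl }
  have hL : ∀ v, L.extend (f v) = g v := by
    intro v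
    have h1 : L.extend (f v) = L ⟨f v, LinearMap.mem_range_self f v⟩ :=
      L.extend_apply ⟨f v, LinearMap.mem_range_self f v⟩
    rw [h1]
    change g (σ ⟨f v, _⟩) = g v
    rw [← sub_eq_zero, ← map_sub, ← norm_eq_zero, hnorm, map_sub, hσ', sub_self, norm_zero]
  set W := toEuclideanLin.symm L.extend.toLinearMap with hW
  have hWapp : toEuclideanLin W = L.extend.toLinearMap := by simp [hW]
  have h1 : W * Nᴴ = Mᴴ := by
    apply toEuclideanLin.injective
    ext1 v
    have h2 : toEuclideanLin (W * Nᴴ) v = toEuclideanLin W (toEuclideanLin Nᴴ v) := by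
      ext i; simp [Matrix.toEuclideanLin, Matrix.toLpLin_apply]
    rw [h2, hWapp]
    exact hL v
  have h2 : Wᴴ * W = 1 := by
    apply toEuclideanLin.injective
    ext1 v
    have h2 : toEuclideanLin (Wᴴ * W) v = toEuclideanLin Wᴴ (toEuclideanLin W v) := by
      ext i; simp [Matrix.toEuclideanLin, Matrix.toLpLin_apply]
    have h3 : toEuclideanLin (1 : Matrix n n ℂ) v = v := by
      ext i; simp [Matrix.toEuclideanLin]
    rw [h2, h3, hWapp, toEuclideanLin_conjTranspose_eq_adjoint, hWapp]
    refine ext_inner_left ℂ fun w => ?_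
    rw [LinearMap.adjoint_inner_right]
    exact L.extend.inner_map_map w v
  refine ⟨Wᴴ, by rw [conjTranspose_conjTranspose, h2], ?_⟩
  rw [← conjTranspose_conjTranspose M, ← h1, conjTranspose_mul, conjTranspose_conjTranspose]

theorem _root_.Matrix.PosSemidef.exists_eq_mul_conjTranspose {n : Type*} [Fintype n]
    {A : Matrix n n ℂ}
    (hA : A.PosSemidef) : ∃ V : Matrix n n ℂ, A = V * Vᴴ := by
  classical
  open scoped MatrixOrder in
  obtain ⟨B, hB⟩ := CStarAlgebra.nonneg_iff_eq_star_mul_self.mp hA.nonneg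
  exact ⟨Bᴴ, by rw [hB, conjTranspose_conjTranspose]; rfl⟩

/-- If `Z X* = X Z*` and `Z Z* ≤ ρ Z X*`, then `Z = X K` with `0 ≤ K ≤ ρ`. -/
theorem exists_posSemidef_factor {k n : Type*} [Fintype k] [DecidableEq k] [Fintype n]
    [DecidableEq n] (X Z : Matrix k n ℂ) (ρ : ℝ) (hρ : 0 ≤ ρ) (hsymm : Z * Xᴴ = X * Zᴴ)
    (hle : ((ρ : ℂ) • (Z * Xᴴ) - Z * Zᴴ).PosSemidef) :
    ∃ K : Matrix n n ℂ, K.PosSemidef ∧ ((ρ : ℂ) • 1 - K).PosSemidef ∧ Z = X * K := by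
  -- Centering the interval `[0, ρ]` at `r = ρ/2` turns the claim into the existence of a
  -- self-adjoint `K'` with `W = X K'` and `-r ≤ K' ≤ r`. The hypothesis becomes `W W* ≤ r² X X*`,
  -- and the slack `V` makes it an equality.
  set r : ℂ := ((ρ / 2 : ℝ) : ℂ) with hr
  have hρr : (ρ : ℂ) = 2 * r := by rw [hr]; push_cast; ring
  have hrs : star r = r := by rw [hr]; exact Complex.conj_ofReal _
  have hr0 : 0 ≤ r := by rw [hr]; exact_mod_cast (by positivity : 0 ≤ ρ / 2)
  set W := Z - r • X with hW
  obtain ⟨V, hV⟩ := hle.exists_eq_mul_conjTranspose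
  have hWV : W * Wᴴ + V * Vᴴ = (r * r) • (X * Xᴴ) := by
    rw [← hV, hW, conjTranspose_sub, conjTranspose_smul, hrs, hρr]
    simp only [Matrix.sub_mul, Matrix.mul_sub, Matrix.smul_mul, Matrix.mul_smul, hsymm]
    module
  have hWX : W * Xᴴ = X * Wᴴ := by
    rw [hW, conjTranspose_sub, conjTranspose_smul, hrs]
    simp only [Matrix.sub_mul, Matrix.mul_sub, Matrix.smul_mul, Matrix.mul_smul, hsymm]
  set a := fromCols X (0 : Matrix k k ℂ) with ha
  set b := fromCols W V with hb
  have haa : a * aᴴ = X * Xᴴ := by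
    rw [ha, conjTranspose_fromCols_eq_fromRows_conjTranspose, fromCols_mul_fromRows]; simp
  have hab : a * bᴴ = X * Wᴴ := by
    rw [ha, hb, conjTranspose_fromCols_eq_fromRows_conjTranspose, fromCols_mul_fromRows]; simp
  have hba : b * aᴴ = W * Xᴴ := by
    rw [ha, hb, conjTranspose_fromCols_eq_fromRows_conjTranspose, fromCols_mul_fromRows]; simp
  have hbb : b * bᴴ = (r * r) • (X * Xᴴ) := by
    rw [hb, conjTranspose_fromCols_eq_fromRows_conjTranspose, fromCols_mul_fromRows, hWV]
  -- Stacking `r a` and `b` in both orders gives equal Gram matrices because `b b* = r² a a*` and `a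
  -- b* = b a*`. One unitary therefore exchanges them, and the symmetry in the two blocks is what
  -- yields a self-adjoint factor: `b = r a U` and `b = r a U*` average to `(r/2) a (U + U*)`.
  obtain ⟨U, hU, hMN⟩ := exists_unitary_of_mul_conjTranspose_eq
    (fromRows (r • a) b) (fromRows b (r • a)) (by
      rw [conjTranspose_fromRows_eq_fromCols_conjTranspose,
        conjTranspose_fromRows_eq_fromCols_conjTranspose, fromRows_mul_fromCols,
        fromRows_mul_fromCols]
      simp only [conjTranspose_smul, hrs, smul_mul, Matrix.mul_smul, smul_smul, haa, hab, hba,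
        hbb, hWX])
  have hU' : Uᴴ * U = 1 := mul_eq_one_comm.1 hU
  rw [fromRows_mul, fromRows_inj.eq_iff] at hMN
  obtain ⟨h1, h2⟩ := hMN
  have h3 : b = r • a * Uᴴ := by
    rw [h1, Matrix.mul_assoc, hU, Matrix.mul_one]
  have h4 : W = X * ((r / 2) • (U + Uᴴ).toBlocks₁₁) := by
    have h5 : b = a * ((r / 2) • (U + Uᴴ)) := by
      have : b + b = r • (a * (U + Uᴴ)) := by
        nth_rw 1 [h2]
        rw [h3, Matrix.mul_add, smul_add, smul_mul, smul_mul]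
      rw [Matrix.mul_smul, div_eq_inv_mul, mul_smul, ← this]
      module
    have h6 : b.toCols₁ = W := by rw [hb, toCols₁_fromCols]
    rw [← h6, h5, ha, ← fromBlocks_toBlocks ((r / 2) • (U + Uᴴ)), fromCols_mul_fromBlocks,
      toCols₁_fromCols]
    simp only [Matrix.zero_mul, add_zero]
    rfl
  -- The bounds come from `2 ± (U + U*) = (1 ± U)(1 ± U)*`, and compression to a diagonal block
  -- preserves them.
  have hpos1 : ((2 : ℂ) • (1 : Matrix n n ℂ) + (U + Uᴴ).toBlocks₁₁).PosSemidef := by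
    have h5 := (posSemidef_self_mul_conjTranspose (1 + U)).submatrix (Sum.inl : n → n ⊕ k)
    convert h5 using 1
    have : (1 + U) * (1 + U)ᴴ = (2 : ℂ) • 1 + (U + Uᴴ) := by
      rw [conjTranspose_add, conjTranspose_one, Matrix.add_mul, Matrix.mul_add, Matrix.mul_add, hU]
      simp only [Matrix.one_mul, Matrix.mul_one]; module
    rw [this]
    ext i j
    simp [toBlocks₁₁, Matrix.one_apply]
  have hpos2 : ((2 : ℂ) • (1 : Matrix n n ℂ) - (U + Uᴴ).toBlocks₁₁).PosSemidef := by
    have h5 := (posSemidef_self_mul_conjTranspose (1 - U)).submatrix (Sum.inl : n → n ⊕ k)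
    convert h5 using 1
    have : (1 - U) * (1 - U)ᴴ = (2 : ℂ) • 1 - (U + Uᴴ) := by
      rw [conjTranspose_sub, conjTranspose_one, Matrix.sub_mul, Matrix.mul_sub, Matrix.mul_sub, hU]
      simp only [Matrix.one_mul, Matrix.mul_one]; module
    rw [this]
    ext i j
    simp [toBlocks₁₁, Matrix.one_apply]
  have hr2 : 0 ≤ r / 2 := by
    rw [hr]; exact_mod_cast (by positivity : 0 ≤ ρ / 2 / 2)
  refine ⟨(r / 2) • ((2 : ℂ) • (1 : Matrix n n ℂ) + (U + Uᴴ).toBlocks₁₁), hpos1.smul hr2, ?_, ?_⟩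
  · convert hpos2.smul hr2 using 1
    rw [hρr]; module
  · have h7 : Z = W + r • X := by rw [hW]; abel
    rw [h7, h4, smul_add, Matrix.mul_add, smul_smul]
    simp only [Matrix.mul_smul, Matrix.mul_one]
    module

/-- If `Z X* = X Z*` and `Z Z* ≤ ρ Z X*`, then after a unitary change of columns each column of `Z`
is the multiple of the same column of `X` by a number in `[0, ρ]`. -/
theorem exists_unitary_diagonal_factor {k n : Type*} [Fintype k] [DecidableEq k] [Fintype n]
    [DecidableEq n] (X Z : Matrix k n ℂ) (ρ : ℝ) (hρ : 0 ≤ ρ) (hsymm : Z * Xᴴ = X * Zᴴ)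
    (hle : ((ρ : ℂ) • (Z * Xᴴ) - Z * Zᴴ).PosSemidef) :
    ∃ (U : Matrix n n ℂ) (l : n → ℝ), U * Uᴴ = 1 ∧ (∀ i, l i ∈ Set.Icc 0 ρ) ∧
      Z * U = X * U * diagonal fun i => (l i : ℂ) := by
  obtain ⟨K, hK, hK', hZ⟩ := exists_posSemidef_factor X Z ρ hρ hsymm hle
  set U : Matrix n n ℂ := (hK.1.eigenvectorUnitary : Matrix n n ℂ) with hU
  have hUU : U * Uᴴ = 1 := Unitary.coe_mul_star_self hK.1.eigenvectorUnitary
  have hUU' : Uᴴ * U = 1 := mul_eq_one_comm.1 hUU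
  have hKU : K * U = U * diagonal fun i => (hK.1.eigenvalues i : ℂ) := by
    have h1 : K = U * (diagonal fun i => (hK.1.eigenvalues i : ℂ)) * Uᴴ := by
      conv_lhs => rw [hK.1.spectral_theorem, Unitary.conjStarAlgAut_apply]
      rfl
    conv_lhs => rw [h1, Matrix.mul_assoc, hUU', Matrix.mul_one]
  refine ⟨U, hK.1.eigenvalues, hUU, fun i => ⟨hK.eigenvalues_nonneg i, ?_⟩, ?_⟩
  · have h1 := hK'.conjTranspose_mul_mul_same U
    have h2 : Uᴴ * ((ρ : ℂ) • 1 - K) * U =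
        diagonal fun i => (ρ : ℂ) - (hK.1.eigenvalues i : ℂ) := by
      rw [Matrix.mul_assoc, Matrix.sub_mul, hKU, Matrix.mul_sub, ← Matrix.mul_assoc Uᴴ U, hUU',
        Matrix.smul_mul, Matrix.one_mul, Matrix.mul_smul, hUU', Matrix.one_mul, ← diagonal_sub,
        smul_one_eq_diagonal]
    rw [h2] at h1
    have h3 := posSemidef_diagonal_iff.1 h1 i
    have h4 : ((hK.1.eigenvalues i : ℝ) : ℂ) ≤ (ρ : ℂ) := sub_nonneg.1 h3
    exact_mod_cast h4
  · rw [hZ, Matrix.mul_assoc, hKU, Matrix.mul_assoc]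

/-! ### Closed cones and linear functionals on matrices -/

/-- A linear map from a finite-dimensional space that is injective at `0` on a closed cone maps the
cone to a closed set. -/
theorem isClosed_image_of_cone {E F : Type*} [NormedAddCommGroup E] [NormedSpace ℝ E]
    [FiniteDimensional ℝ E] [NormedAddCommGroup F] [NormedSpace ℝ F] (f : E →ₗ[ℝ] F) (C : Set E)
    (hC : IsClosed C) (hcone : ∀ c : ℝ, 0 ≤ c → ∀ x ∈ C, c • x ∈ C)
    (hker : ∀ x ∈ C, f x = 0 → x = 0) : IsClosed (f '' C) := by
  have hf : Continuous f := f.continuous_of_finiteDimensional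
  have : ProperSpace E := FiniteDimensional.proper ℝ E
  -- Compactness of the unit sphere of the cone bounds `‖f x‖` below by a multiple of `‖x‖`.
  -- Preimages of a convergent sequence are thus bounded and have a convergent subsequence.
  obtain ⟨m, hm, hbound⟩ : ∃ m > 0, ∀ x ∈ C, m * ‖x‖ ≤ ‖f x‖ := by
    have hK : IsCompact (Metric.sphere (0 : E) 1 ∩ C) := (isCompact_sphere 0 1).inter_right hC
    rcases (Metric.sphere (0 : E) 1 ∩ C).eq_empty_or_nonempty with he | hne
    · refine ⟨1, one_pos, fun x hx => ?_⟩
      have : x = 0 := by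
        by_contra hx0
        have : ‖x‖⁻¹ • x ∈ Metric.sphere (0 : E) 1 ∩ C :=
          ⟨by simp [norm_smul, hx0], hcone _ (by positivity) x hx⟩
        rw [he] at this; exact this
      simp [this]
    · obtain ⟨x₀, hx₀, hmin⟩ := hK.exists_isMinOn hne hf.norm.continuousOn
      have hx₀n : ‖x₀‖ = 1 := by simpa using hx₀.1
      refine ⟨‖f x₀‖, norm_pos_iff.2 fun h => ?_, fun x hx => ?_⟩
      · rw [hker x₀ hx₀.2 h, norm_zero] at hx₀n; exact zero_ne_one hx₀n
      · rcases eq_or_ne x 0 with rfl | hx0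
        · simp
        have h1 : ‖x‖⁻¹ • x ∈ Metric.sphere (0 : E) 1 ∩ C :=
          ⟨by simp [norm_smul, hx0], hcone _ (by positivity) x hx⟩
        have h2 : ‖f x₀‖ ≤ ‖f (‖x‖⁻¹ • x)‖ := hmin h1
        rw [map_smul, norm_smul, norm_inv, norm_norm] at h2
        have h3 : 0 < ‖x‖ := norm_pos_iff.2 hx0
        calc ‖f x₀‖ * ‖x‖ ≤ (‖x‖⁻¹ * ‖f x‖) * ‖x‖ := by gcongr
          _ = ‖f x‖ := by field_simp
  refine IsSeqClosed.isClosed fun y y₀ hy hlim => ?_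
  choose x hxC hxy using hy
  obtain ⟨b, hb⟩ := hlim.norm.bddAbove_range
  have hxb : ∀ i, x i ∈ Metric.closedBall (0 : E) (b / m) := fun i => by
    rw [mem_closedBall_zero_iff, le_div_iff₀ hm, mul_comm]
    refine (hbound _ (hxC i)).trans ?_
    rw [hxy]
    exact hb ⟨i, rfl⟩
  obtain ⟨a, -, φ, hφ, ha⟩ := tendsto_subseq_of_bounded Metric.isBounded_closedBall hxb
  refine ⟨a, hC.mem_of_tendsto ha (Filter.Eventually.of_forall fun i => hxC _), ?_⟩
  refine tendsto_nhds_unique ((hf.tendsto a).comp ha) ?_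
  have : (⇑f ∘ (x ∘ φ)) = y ∘ φ := by ext i; simp [hxy]
  rw [this]
  exact hlim.comp hφ.tendsto_atTop

theorem isClosed_posSemidef {n : Type*} [Fintype n] :
    IsClosed {S : Matrix n n ℂ | S.PosSemidef} := by
  have : {S : Matrix n n ℂ | S.PosSemidef} =
      {S | Sᴴ = S} ∩ ⋂ x : n → ℂ, {S | 0 ≤ star x ⬝ᵥ S *ᵥ x} := by
    ext S
    simp only [Set.mem_ofPred_eq, Set.mem_inter_iff, Set.mem_iInter,
      posSemidef_iff_dotProduct_mulVec]
    rfl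
  rw [this]
  refine (isClosed_eq (by fun_prop) continuous_id).inter (isClosed_iInter fun x => ?_)
  exact isClosed_le continuous_const (by fun_prop)

/-- The entries of `H₀` are read off from the values of `g` on `E_ij` and `i E_ij`, so that `g M =
Re tr(H₀ M)` for all `M`. A Hermitian `M` sees only the Hermitian part of `H₀`. -/
theorem exists_trace_repr {n : Type*} [Fintype n] [DecidableEq n] (g : Matrix n n ℂ →ₗ[ℝ] ℝ) :
    ∃ H : Matrix n n ℂ, H.IsHermitian ∧ ∀ M : Matrix n n ℂ, M.IsHermitian →
      g M = (trace (H * M)).re := by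
  set H₀ : Matrix n n ℂ := fun j i =>
    (g (single i j 1) : ℂ) - Complex.I * (g (single i j Complex.I) : ℂ)
    with hH₀
  have h0 : ∀ M, g M = (trace (H₀ * M)).re := by
    intro M
    conv_lhs => rw [matrix_eq_sum_single M]
    rw [map_sum, trace, Complex.re_sum]
    simp only [map_sum, diag_apply, mul_apply, Complex.re_sum]
    rw [Finset.sum_comm]
    refine Finset.sum_congr rfl fun j _ => Finset.sum_congr rfl fun i _ => ?_
    have h1 : single i j (M i j) =
        (M i j).re • single i j (1 : ℂ) + (M i j).im • single i j Complex.I := by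
      rw [smul_single, smul_single, ← single_add]
      congr 1
      simp [Complex.re_add_im]
    rw [h1, map_add, map_smul, map_smul, hH₀]
    simp
    ring
  refine ⟨(1 / 2 : ℝ) • (H₀ + H₀ᴴ), ?_, fun M hM => ?_⟩
  · rw [IsHermitian, conjTranspose_smul, conjTranspose_add, conjTranspose_conjTranspose, add_comm]
    simp
  · have h1 : (trace (H₀ᴴ * M)).re = (trace (H₀ * M)).re := by
      have : H₀ᴴ * M = (M * H₀)ᴴ := by rw [conjTranspose_mul, hM.eq]
      rw [this, trace_conjTranspose, trace_mul_comm]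
      simp
    rw [Matrix.smul_mul, trace_smul, add_mul, trace_add, Complex.smul_re, Complex.add_re, h1, ← h0]
    simp; ring

/-! ### The generalized KYP lemma for a pencil -/

/-- The matrix of the multiplier terms in the generalized KYP inequality for the frequencies
`{ν : L ζ = ν R ζ, 0 ≤ ν ≤ ρ}`. -/
def freqForm {k n : Type*} [Fintype k] (L R : Matrix k n ℂ) (ρ : ℝ) (P Q : Matrix k k ℂ) :
    Matrix n n ℂ :=
  Complex.I • (Lᴴ * P * R - Rᴴ * P * L) +
    ((ρ : ℂ) • (Lᴴ * Q * R + Rᴴ * Q * L) - (2 : ℂ) • (Lᴴ * Q * L))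

theorem star_dotProduct_conjTranspose_mul_mul_mulVec {n a b : Type*} [Fintype n] [Fintype a]
    [Fintype b] (X : Matrix a n ℂ) (M : Matrix a b ℂ) (Y : Matrix b n ℂ) (x y : n → ℂ) :
    star x ⬝ᵥ ((Xᴴ * M * Y) *ᵥ y) = star (X *ᵥ x) ⬝ᵥ (M *ᵥ (Y *ᵥ y)) := by
  rw [star_mulVec, ← dotProduct_mulVec, mulVec_mulVec, mulVec_mulVec, Matrix.mul_assoc]

/-- The weights are the point of `freqForm`. At equal frequencies the `P`-term disappears and the
`Q`-term has weight `2ν(ρ - ν)`, nonnegative exactly on `[0, ρ]`. At distinct frequencies the factor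
`μ - ν` still detects `P`. -/
theorem star_dotProduct_freqForm_mulVec {k n : Type*} [Fintype k] [Fintype n]
    (L R : Matrix k n ℂ) (ρ : ℝ) (P Q : Matrix k k ℂ)
    {μ ν : ℝ} {x y : n → ℂ} (hx : L *ᵥ x = (μ : ℂ) • R *ᵥ x) (hy : L *ᵥ y = (ν : ℂ) • R *ᵥ y) :
    star x ⬝ᵥ (freqForm L R ρ P Q *ᵥ y) =
      Complex.I * (μ - ν) * (star (R *ᵥ x) ⬝ᵥ (P *ᵥ (R *ᵥ y))) +
      (ρ * (μ + ν) - 2 * μ * ν) * (star (R *ᵥ x) ⬝ᵥ (Q *ᵥ (R *ᵥ y))) := by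
  simp only [freqForm, add_mulVec, sub_mulVec, smul_mulVec, dotProduct_add, dotProduct_sub,
    dotProduct_smul, star_dotProduct_conjTranspose_mul_mul_mulVec, hx, hy, star_smul,
    mulVec_smul, smul_dotProduct, smul_eq_mul]
  have : star (μ : ℂ) = μ := Complex.conj_ofReal _
  rw [this]
  ring

theorem freqForm_isHermitian {k n : Type*} [Fintype k] (L R : Matrix k n ℂ) (ρ : ℝ)
    {P Q : Matrix k k ℂ}
    (hP : P.IsHermitian) (hQ : Q.IsHermitian) : (freqForm L R ρ P Q).IsHermitian := by
  rw [IsHermitian, freqForm]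
  simp only [conjTranspose_add, conjTranspose_sub, conjTranspose_smul, conjTranspose_mul,
    conjTranspose_conjTranspose, hP.eq, hQ.eq]
  simp only [Complex.star_def, Complex.conj_I, Complex.conj_ofReal, map_ofNat, Matrix.mul_assoc]
  module

theorem eq_zero_of_forall_mulVec_eq_zero {k n : Type*} [Fintype n] {p : (n → ℂ) → Prop}
    (hspan : ∀ w : n → ℂ, (∀ ζ, p ζ → star w ⬝ᵥ ζ = 0) → w = 0) (M : Matrix k n ℂ)
    (h : ∀ ζ, p ζ → M *ᵥ ζ = 0) : M = 0 := by
  ext i j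
  have h1 : star (M i) = 0 := hspan (star (M i)) fun ζ hζ => by
    rw [star_star]; exact congrFun (h ζ hζ) i
  have h2 := congrFun h1 j
  simpa using h2

theorem eq_zero_of_mul_eq_zero_of_mul_eq_zero {j k n : Type*} [Fintype k]
    {L R : Matrix k n ℂ} (hLR : ∀ v : k → ℂ, v ᵥ* L = 0 → v ᵥ* R = 0 → v = 0)
    (M : Matrix j k ℂ) (h1 : M * L = 0) (h2 : M * R = 0) : M = 0 := by
  ext i l
  have h3 := hLR (M i) (funext fun l => congrFun (congrFun h1 i) l)
    (funext fun l => congrFun (congrFun h2 i) l)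
  rw [h3]; rfl

/-- The multiplier terms of the generalized KYP inequality and a positive semidefinite matrix only
add up to zero trivially. -/
theorem eq_zero_of_freqForm_add_eq_zero {k n : Type*} [Fintype k] [Fintype n]
    (L R : Matrix k n ℂ) (ρ : ℝ)
    (hspan : ∀ (ν₀ : ℝ) (w : n → ℂ), (∀ ζ, (∃ ν ∈ Set.Ioo 0 ρ, ν ≠ ν₀ ∧
      L *ᵥ ζ = (ν : ℂ) • R *ᵥ ζ) → star w ⬝ᵥ ζ = 0) → w = 0)
    (hLR : ∀ v : k → ℂ, v ᵥ* L = 0 → v ᵥ* R = 0 → v = 0)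
    {P Q : Matrix k k ℂ} {S : Matrix n n ℂ} (hQ : Q.PosSemidef)
    (hS : S.PosSemidef) (h : freqForm L R ρ P Q + S = 0) : P = 0 ∧ Q = 0 ∧ S = 0 := by
  have hpair : ∀ x y, star x ⬝ᵥ (freqForm L R ρ P Q *ᵥ y) + star x ⬝ᵥ (S *ᵥ y) = 0 := fun x y => by
    rw [← dotProduct_add, ← add_mulVec, h, zero_mulVec, dotProduct_zero]
  -- On the diagonal, a positive multiple of the `Q`-form and the `S`-form add up to zero, so both
  -- vanish. Frequencies strictly inside the interval are needed for the weight to be positive.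
  have hQS : ∀ ζ, (∃ ν ∈ Set.Ioo 0 ρ, ν ≠ (0 : ℝ) ∧ L *ᵥ ζ = (ν : ℂ) • R *ᵥ ζ) →
      Q *ᵥ (R *ᵥ ζ) = 0 ∧ S *ᵥ ζ = 0 := by
    rintro ζ ⟨ν, hν, -, hζ⟩
    have h1 := hpair ζ ζ
    rw [star_dotProduct_freqForm_mulVec L R ρ P Q hζ hζ] at h1
    have hc : (0 : ℂ) < ((2 * ν * (ρ - ν) : ℝ) : ℂ) := by
      have : 0 < 2 * ν * (ρ - ν) := mul_pos (mul_pos two_pos hν.1) (sub_pos.2 hν.2)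
      exact_mod_cast this
    have h2 := hQ.dotProduct_mulVec_nonneg (R *ᵥ ζ)
    have h3 := hS.dotProduct_mulVec_nonneg ζ
    have h4 : ((2 * ν * (ρ - ν) : ℝ) : ℂ) * (star (R *ᵥ ζ) ⬝ᵥ (Q *ᵥ (R *ᵥ ζ)))
        + star ζ ⬝ᵥ (S *ᵥ ζ) = 0 := by
      rw [← h1]; push_cast; ring
    obtain ⟨h5, h6⟩ := (add_eq_zero_iff_of_nonneg (mul_nonneg hc.le h2) h3).1 h4
    exact ⟨(hQ.dotProduct_mulVec_zero_iff _).1 ((mul_eq_zero.1 h5).resolve_left hc.ne'),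
      (hS.dotProduct_mulVec_zero_iff _).1 h6⟩
  have hS0 : S = 0 := eq_zero_of_forall_mulVec_eq_zero (hspan 0) S fun ζ hζ => (hQS ζ hζ).2
  have hQR : Q * R = 0 := eq_zero_of_forall_mulVec_eq_zero (hspan 0) (Q * R) fun ζ hζ => by
    rw [← mulVec_mulVec]; exact (hQS ζ hζ).1
  have hQL : Q * L = 0 := eq_zero_of_forall_mulVec_eq_zero (hspan 0) (Q * L) fun ζ hζ => by
    have h1 := (hQS ζ hζ).1
    obtain ⟨ν, hν, -, hζ⟩ := hζ
    rw [← mulVec_mulVec, hζ, mulVec_smul, h1, smul_zero]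
  have hQ0 : Q = 0 := eq_zero_of_mul_eq_zero_of_mul_eq_zero hLR Q hQL hQR
  have hPR : ∀ ζ, (∃ ν ∈ Set.Ioo 0 ρ, ν ≠ (0 : ℝ) ∧ L *ᵥ ζ = (ν : ℂ) • R *ᵥ ζ) →
      P *ᵥ (R *ᵥ ζ) = 0 := by
    rintro ζ ⟨ν, hν, -, hζ⟩
    -- With `Q = S = 0`, pairing two different frequencies isolates `P`. This is why the spanning
    -- hypothesis has to survive the removal of one frequency `ν₀`.
    have h1 : ∀ x, (∃ μ ∈ Set.Ioo 0 ρ, μ ≠ ν ∧ L *ᵥ x = (μ : ℂ) • R *ᵥ x) →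
        star (R *ᵥ x) ⬝ᵥ (P *ᵥ (R *ᵥ ζ)) = 0 := by
      rintro x ⟨μ, hμ, hne, hx⟩
      have h2 := hpair x ζ
      rw [star_dotProduct_freqForm_mulVec L R ρ P Q hx hζ, hS0, hQ0] at h2
      simp only [zero_mulVec, dotProduct_zero, mul_zero, add_zero, mul_eq_zero, Complex.I_ne_zero,
        false_or, sub_eq_zero, Complex.ofReal_inj, hne] at h2
      exact h2
    have h2 : star (P *ᵥ (R *ᵥ ζ)) = 0 := by
      refine hLR _ ?_ ?_
      · have : star (star (P *ᵥ (R *ᵥ ζ)) ᵥ* L) = 0 := by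
          refine hspan ν _ fun x hx => ?_
          rw [star_star, ← dotProduct_mulVec]
          have h3 := congrArg star (h1 x hx)
          obtain ⟨μ, hμ, hne, hx⟩ := hx
          rw [← star_dotProduct_star, star_star, star_zero] at h3
          rw [hx, dotProduct_smul, h3, smul_zero]
        simpa using this
      · have : star (star (P *ᵥ (R *ᵥ ζ)) ᵥ* R) = 0 := by
          refine hspan ν _ fun x hx => ?_
          rw [star_star, ← dotProduct_mulVec]
          have h3 := congrArg star (h1 x hx)
          rwa [← star_dotProduct_star, star_star, star_zero] at h3
        simpa using this
    simpa using h2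
  have hP0 : P = 0 := by
    refine eq_zero_of_mul_eq_zero_of_mul_eq_zero hLR P ?_ ?_
    · refine eq_zero_of_forall_mulVec_eq_zero (hspan 0) _ fun ζ hζ => ?_
      have h1 := hPR ζ hζ
      obtain ⟨ν, hν, -, hζ⟩ := hζ
      rw [← mulVec_mulVec, hζ, mulVec_smul, h1, smul_zero]
    · refine eq_zero_of_forall_mulVec_eq_zero (hspan 0) _ fun ζ hζ => ?_
      rw [← mulVec_mulVec]; exact hPR ζ hζ
  exact ⟨hP0, hQ0, hS0⟩

open scoped Matrix.Norms.Elementwise in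
/-- The generalized KYP lemma with non-strict inequality: a frequency domain inequality on
`0 ≤ ν ≤ ρ` yields multipliers. -/
theorem exists_multipliers_of_frequency_inequality {k n : Type*} [Fintype k] [DecidableEq k]
    [Fintype n] [DecidableEq n] (L R : Matrix k n ℂ) (ρ : ℝ) (hρ : 0 ≤ ρ)
    (hspan : ∀ (ν₀ : ℝ) (w : n → ℂ), (∀ ζ, (∃ ν ∈ Set.Ioo 0 ρ, ν ≠ ν₀ ∧
      L *ᵥ ζ = (ν : ℂ) • R *ᵥ ζ) → star w ⬝ᵥ ζ = 0) → w = 0)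
    (hLR : ∀ v : k → ℂ, v ᵥ* L = 0 → v ᵥ* R = 0 → v = 0)
    {Θ : Matrix n n ℂ} (hΘ : Θ.IsHermitian)
    (hfdi : ∀ ν ∈ Set.Icc 0 ρ, ∀ ζ, L *ᵥ ζ = (ν : ℂ) • R *ᵥ ζ → (star ζ ⬝ᵥ (Θ *ᵥ ζ)).re ≤ 0) :
    ∃ P Q : Matrix k k ℂ, P.IsHermitian ∧ Q.PosSemidef ∧
      (-(freqForm L R ρ P Q + Θ)).PosSemidef := by
  let f : (Matrix k k ℂ × Matrix k k ℂ × Matrix n n ℂ) →ₗ[ℝ] Matrix n n ℂ :=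
    { toFun := fun x => freqForm L R ρ x.1 x.2.1 + x.2.2
      map_add' := fun x y => by
        simp only [freqForm, Prod.fst_add, Prod.snd_add, Matrix.mul_add, Matrix.add_mul]
        module
      map_smul' := fun c x => by
        simp only [freqForm, Prod.smul_fst, Prod.smul_snd, Matrix.mul_smul, Matrix.smul_mul,
          RingHom.id_apply]
        module }
  let C : Set (Matrix k k ℂ × Matrix k k ℂ × Matrix n n ℂ) :=
    {x | x.1.IsHermitian ∧ x.2.1.PosSemidef ∧ x.2.2.PosSemidef}
  have hCcl : IsClosed C := by
    refine IsClosed.inter ?_ (IsClosed.inter ?_ ?_)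
    · exact isClosed_eq (f := fun x : Matrix k k ℂ × Matrix k k ℂ × Matrix n n ℂ => x.1ᴴ)
        (by fun_prop) continuous_fst
    · exact isClosed_posSemidef.preimage (continuous_fst.comp continuous_snd)
    · exact isClosed_posSemidef.preimage (continuous_snd.comp continuous_snd)
  have hcone : ∀ c : ℝ, 0 ≤ c → ∀ x ∈ C, c • x ∈ C := fun c hc x hx =>
    ⟨by
      change (c • x.1)ᴴ = c • x.1
      rw [conjTranspose_smul, hx.1.eq]; simp, hx.2.1.smul hc, hx.2.2.smul hc⟩
  have hconv : Convex ℝ C := by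
    refine convex_iff_forall_pos.2 fun x hx y hy a b ha hb _ => ?_
    have h1 := hcone a ha.le x hx
    have h2 := hcone b hb.le y hy
    exact ⟨h1.1.add h2.1, h1.2.1.add h2.2.1, h1.2.2.add h2.2.2⟩
  -- Closedness of the image is where the spanning hypothesis is used: it leaves no nonzero element
  -- of the cone that maps to zero.
  have hclosed : IsClosed (f '' C) := by
    refine isClosed_image_of_cone f C hCcl hcone fun x hx h0 => ?_
    obtain ⟨h1, h2, h3⟩ := eq_zero_of_freqForm_add_eq_zero L R ρ hspan hLR hx.2.1 hx.2.2 h0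
    exact Prod.ext h1 (Prod.ext h2 h3)
  by_contra hcon
  have hnot : -Θ ∉ f '' C := by
    rintro ⟨⟨P, Q, S⟩, ⟨hP, hQ, hS⟩, hx⟩
    refine hcon ⟨P, Q, hP, hQ, ?_⟩
    have : freqForm L R ρ P Q + S = -Θ := hx
    have h1 : -(freqForm L R ρ P Q + Θ) = S := by
      rw [neg_add, ← this]; abel
    rw [h1]; exact hS
  have : LocallyConvexSpace ℝ (Matrix n n ℂ) :=
    inferInstanceAs (LocallyConvexSpace ℝ (n → n → ℂ))
  obtain ⟨ℓ, u, hu, hu'⟩ := geometric_hahn_banach_closed_point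
    (hconv.linear_image f) hclosed hnot
  have hC0 : (0 : Matrix k k ℂ × Matrix k k ℂ × Matrix n n ℂ) ∈ C :=
    ⟨isHermitian_zero, .zero, .zero⟩
  have hu0 : 0 < u := by simpa using hu _ ⟨0, hC0, rfl⟩
  have hℓ : ∀ x ∈ C, ℓ (f x) ≤ 0 := by
    intro x hx
    by_contra! hpos
    have h1 := hu _ ⟨(u / ℓ (f x)) • x, hcone _ (by positivity) x hx, rfl⟩
    rw [map_smul, map_smul, smul_eq_mul, div_mul_cancel₀ _ hpos.ne'] at h1
    exact lt_irrefl _ h1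
  -- The separating functional is nonpositive on the cone, so its negative is represented by `H`,
  -- with `tr(H ·) ≥ 0` on the cone and `tr(HΘ) > 0`. Testing with rank-one `S` shows `H ≥ 0`.
  obtain ⟨H, hH, hHtr⟩ := exists_trace_repr (-(ℓ : Matrix n n ℂ →ₗ[ℝ] ℝ))
  have hHC : ∀ P Q S, P.IsHermitian → Q.PosSemidef → S.PosSemidef →
      0 ≤ (trace (H * (freqForm L R ρ P Q + S))).re := by
    intro P Q S hP hQ hS
    rw [← hHtr _ ((freqForm_isHermitian L R ρ hP hQ.1).add hS.1)]
    exact neg_nonneg.2 (hℓ (P, Q, S) ⟨hP, hQ, hS⟩)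
  have hHΘ : 0 < (trace (H * Θ)).re := by
    rw [← hHtr _ hΘ]
    have h1 := hu0.trans hu'
    rw [map_neg] at h1
    simpa using h1
  clear hHtr hu hu' hℓ hcon hnot
  have hHpsd : H.PosSemidef := by
    refine .of_dotProduct_mulVec_nonneg hH fun x => ?_
    have h1 := hHC 0 0 (vecMulVec x (star x)) isHermitian_zero .zero
      (posSemidef_vecMulVec_self_star x)
    have h2 : trace (H * (freqForm L R ρ 0 0 + vecMulVec x (star x))) = star x ⬝ᵥ (H *ᵥ x) := by
      simp [freqForm, mul_vecMulVec, trace_vecMulVec, dotProduct_comm]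
    rw [h2] at h1
    have h3 : (star x ⬝ᵥ (H *ᵥ x)).im = 0 := by
      simpa using hH.im_star_dotProduct_mulVec_self x
    exact Complex.nonneg_iff.2 ⟨h1, h3.symm⟩
  obtain ⟨V, hV⟩ := hHpsd.exists_eq_mul_conjTranspose
  obtain ⟨X, hX⟩ : ∃ X, X = R * V := ⟨_, rfl⟩
  obtain ⟨Z, hZ⟩ : ∃ Z, Z = L * V := ⟨_, rfl⟩
  have hXZ : R * H * Lᴴ = X * Zᴴ := by
    rw [hV, hX, hZ, conjTranspose_mul]; simp only [Matrix.mul_assoc]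
  have hZX : L * H * Rᴴ = Z * Xᴴ := by
    rw [hV, hX, hZ, conjTranspose_mul]; simp only [Matrix.mul_assoc]
  have hZZ : L * H * Lᴴ = Z * Zᴴ := by
    rw [hV, hZ, conjTranspose_mul]; simp only [Matrix.mul_assoc]
  have htr : ∀ (A' B' : Matrix k n ℂ) (P : Matrix k k ℂ),
      trace (H * (A'ᴴ * P * B')) = trace (P * (B' * H * A'ᴴ)) := by
    intro A' B' P
    rw [trace_mul_comm, Matrix.mul_assoc, Matrix.mul_assoc, trace_mul_comm, Matrix.mul_assoc]
  have hform : ∀ P Q, trace (H * (freqForm L R ρ P Q)) =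
      trace (P * (Complex.I • (X * Zᴴ - Z * Xᴴ))) +
      trace (Q * ((ρ : ℂ) • (X * Zᴴ + Z * Xᴴ) - (2 : ℂ) • (Z * Zᴴ))) := by
    intro P Q
    rw [← hXZ, ← hZX, ← hZZ]
    simp only [freqForm, Matrix.mul_add, Matrix.mul_sub, Matrix.mul_smul, trace_add, trace_sub,
      trace_smul, htr]
  have hsymm : Z * Xᴴ = X * Zᴴ := by
    set Y := Complex.I • (X * Zᴴ - Z * Xᴴ) with hY
    have hYH : Y.IsHermitian := by
      rw [IsHermitian, hY, conjTranspose_smul, conjTranspose_sub, conjTranspose_mul,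
        conjTranspose_mul, conjTranspose_conjTranspose, conjTranspose_conjTranspose,
        Complex.star_def, Complex.conj_I]
      module
    -- As `P` ranges over a linear space, its coefficient `Y` must vanish; the choice `P = -Y` gives
    -- `-tr(Y²) ≥ 0`.
    have h1 := hHC (-Y) 0 0 hYH.neg .zero .zero
    rw [add_zero, hform, Matrix.zero_mul, trace_zero, add_zero, Matrix.neg_mul, trace_neg,
      Complex.neg_re] at h1
    have h2 : trace (Yᴴ * Y) = 0 := by
      have h3 := (posSemidef_conjTranspose_mul_self Y).trace_nonneg
      rw [hYH.eq] at h3 ⊢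
      refine le_antisymm ?_ h3
      rw [Complex.nonneg_iff] at h3
      exact Complex.nonpos_iff.2 ⟨by linarith, h3.2.symm⟩
    rw [trace_conjTranspose_mul_self_eq_zero_iff, hY, smul_eq_zero, sub_eq_zero] at h2
    exact (h2.resolve_left Complex.I_ne_zero).symm
  have hle : ((ρ : ℂ) • (Z * Xᴴ) - Z * Zᴴ).PosSemidef := by
    have hherm : ((ρ : ℂ) • (Z * Xᴴ) - Z * Zᴴ).IsHermitian := by
      rw [IsHermitian, conjTranspose_sub, conjTranspose_smul, conjTranspose_mul,
        conjTranspose_mul, conjTranspose_conjTranspose, conjTranspose_conjTranspose, hsymm,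
        Complex.star_def, Complex.conj_ofReal]
    refine .of_dotProduct_mulVec_nonneg hherm fun x => ?_
    have h1 := hHC 0 (vecMulVec x (star x)) 0 isHermitian_zero
      (posSemidef_vecMulVec_self_star x) .zero
    have h2 : (ρ : ℂ) • (X * Zᴴ + Z * Xᴴ) - (2 : ℂ) • (Z * Zᴴ) =
        (2 : ℂ) • ((ρ : ℂ) • (Z * Xᴴ) - Z * Zᴴ) := by
      rw [hsymm]; module
    rw [add_zero, hform, Matrix.zero_mul, trace_zero, zero_add, h2, trace_mul_comm, Matrix.smul_mul,
      trace_smul, mul_vecMulVec, trace_vecMulVec, dotProduct_comm] at h1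
    have h3 : (star x ⬝ᵥ (((ρ : ℂ) • (Z * Xᴴ) - Z * Zᴴ) *ᵥ x)).im = 0 := by
      simpa using hherm.im_star_dotProduct_mulVec_self x
    refine Complex.nonneg_iff.2 ⟨?_, h3.symm⟩
    simpa using h1
  obtain ⟨U, l, hU, hl, hZU⟩ := exists_unitary_diagonal_factor X Z ρ hρ hsymm hle
  -- The columns of `T` are solutions of the pencil at frequencies `l i` in `[0, ρ]`, and `H = T T*`
  -- is the sum of the corresponding rank-one matrices. The frequency inequality then applies column
  -- by column.
  set T := V * U with hT
  have hHT : H = T * Tᴴ := by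
    rw [hT, conjTranspose_mul, Matrix.mul_assoc, ← Matrix.mul_assoc U, hU, Matrix.one_mul, hV]
  have hcol : ∀ i, L *ᵥ (fun j => T j i) = (l i : ℂ) • R *ᵥ (fun j => T j i) := by
    intro i
    ext a
    have h1 := congrFun (congrFun hZU a) i
    rw [mul_diagonal, hZ, hX, Matrix.mul_assoc, Matrix.mul_assoc, ← hT] at h1
    rw [Pi.smul_apply, smul_eq_mul, mul_comm]
    exact h1
  have h1 : trace (H * Θ) = ∑ i, star (fun j => T j i) ⬝ᵥ (Θ *ᵥ fun j => T j i) := by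
    rw [hHT, Matrix.mul_assoc, trace_mul_comm, trace]
    refine Finset.sum_congr rfl fun i _ => ?_
    rw [diag_apply, Matrix.mul_assoc]
    rfl
  rw [h1, Complex.re_sum] at hHΘ
  exact absurd (Finset.sum_nonpos fun i _ => hfdi (l i) (hl i) _ (hcol i)) (not_le.2 hHΘ)

theorem continuous_star_dotProduct_mulVec {n : Type*} [Fintype n] (Θ : Matrix n n ℂ)
    {f : ℝ → n → ℂ} (hf : Continuous f) : Continuous fun ν => (star (f ν) ⬝ᵥ (Θ *ᵥ f ν)).re := by
  refine Complex.continuous_re.comp ?_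
  exact Continuous.dotProduct (continuous_star.comp hf) (continuous_const.matrix_mulVec hf)

/-- A frequency domain inequality extends from a cofinite set of frequencies to every frequency at
which the pencil has full row rank. -/
theorem frequency_inequality_of_cofinite {k n : Type*} [Fintype k] [DecidableEq k] [Fintype n]
    (L R : Matrix k n ℂ) (ρ : ℝ) (hρ : 0 < ρ) (Θ : Matrix n n ℂ) (F : Set ℝ) (hF : F.Finite)
    (hfdi : ∀ ν ∈ Set.Ioo 0 ρ, ν ∉ F → ∀ ζ, L *ᵥ ζ = (ν : ℂ) • R *ᵥ ζ →
      (star ζ ⬝ᵥ (Θ *ᵥ ζ)).re ≤ 0)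
    {ν₀ : ℝ} (hν₀ : ν₀ ∈ Set.Icc 0 ρ) (hrank : ∀ v, v ᵥ* (L - (ν₀ : ℂ) • R) = 0 → v = 0)
    {ζ : n → ℂ} (hζ : L *ᵥ ζ = (ν₀ : ℂ) • R *ᵥ ζ) : (star ζ ⬝ᵥ (Θ *ᵥ ζ)).re ≤ 0 := by
  set M : ℝ → Matrix k n ℂ := fun ν => L - (ν : ℂ) • R with hM
  -- This is the orthogonal projection of `ζ` to the kernel of `M ν`, multiplied by `det (M M*)` to
  -- avoid a division. It is continuous in `ν`, always solves the pencil, and equals a nonzero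
  -- multiple of `ζ` at `ν₀`.
  set z : ℝ → n → ℂ := fun ν => (M ν * (M ν)ᴴ).det • ζ -
    ((M ν)ᴴ * (M ν * (M ν)ᴴ).adjugate) *ᵥ (M ν *ᵥ ζ) with hz
  have hMc : Continuous M := by
    refine continuous_const.sub (Continuous.smul Complex.continuous_ofReal continuous_const)
  have hMM : Continuous fun ν => M ν * (M ν)ᴴ := hMc.matrix_mul hMc.matrix_conjTranspose
  have hzc : Continuous z :=
    (hMM.matrix_det.smul continuous_const).sub
      ((hMc.matrix_conjTranspose.matrix_mul hMM.matrix_adjugate).matrix_mulVec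
        (hMc.matrix_mulVec continuous_const))
  have hLz : ∀ ν, L *ᵥ z ν = (ν : ℂ) • R *ᵥ z ν := by
    intro ν
    rw [← sub_eq_zero, ← smul_mulVec, ← sub_mulVec]
    change M ν *ᵥ z ν = 0
    rw [hz]
    simp only
    rw [mulVec_sub, mulVec_smul, mulVec_mulVec, ← Matrix.mul_assoc, mul_adjugate, smul_mulVec,
      one_mulVec, sub_self]
  have hcl : ν₀ ∈ closure (Set.Ioo 0 ρ ∩ Fᶜ) := by
    have hd : Dense Fᶜ := hF.countable.dense_compl ℝ
    rw [← closure_Ioo hρ.ne] at hν₀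
    exact closure_minimal (hd.open_subset_closure_inter isOpen_Ioo) isClosed_closure hν₀
  have hle : (star (z ν₀) ⬝ᵥ (Θ *ᵥ z ν₀)).re ≤ 0 :=
    (isClosed_le (continuous_star_dotProduct_mulVec Θ hzc) continuous_const).closure_subset_iff.2
      (fun ν hν => hfdi ν hν.1 hν.2 _ (hLz ν)) hcl
  have hMζ : M ν₀ *ᵥ ζ = 0 := by
    rw [hM]; simp only; rw [sub_mulVec, smul_mulVec, hζ, sub_self]
  have hz₀ : z ν₀ = (M ν₀ * (M ν₀)ᴴ).det • ζ := by
    rw [hz]; simp only; rw [hMζ, mulVec_zero, sub_zero]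
  have hdet : (M ν₀ * (M ν₀)ᴴ).det ≠ 0 := by
    intro h0
    obtain ⟨v, hv, hv0⟩ := exists_vecMul_eq_zero_iff.2 h0
    refine hv (hrank v ?_)
    have h1 : star (v ᵥ* M ν₀) ⬝ᵥ (v ᵥ* M ν₀) = 0 := by
      rw [dotProduct_comm, star_vecMul, ← dotProduct_mulVec, mulVec_mulVec, dotProduct_mulVec,
          hv0, zero_dotProduct]
    exact dotProduct_star_self_eq_zero.1 h1
  set d := (M ν₀ * (M ν₀)ᴴ).det
  rw [hz₀, mulVec_smul, dotProduct_smul, star_smul, smul_dotProduct, smul_smul, smul_eq_mul] at hle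
  have h1 : d * star d = ((Complex.normSq d : ℝ) : ℂ) := Complex.mul_conj d
  rw [h1, Complex.re_ofReal_mul] at hle
  exact nonpos_of_mul_nonpos_right hle (Complex.normSq_pos.2 hdet)

/-! ### Controllability and the input-state pencil -/

open scoped Matrix.Norms.L2Operator in
theorem tendsto_resolvent_cobounded {k : Type*} [Fintype k] [DecidableEq k] (A : Matrix k k ℂ) :
    Filter.Tendsto (resolvent A) (Bornology.cobounded ℂ) (nhds 0) :=
  spectrum.resolvent_tendsto_cobounded A

/-- The right side is `a (s - A)⁻¹ B + b` with the denominator cleared. Being polynomial in `s`, it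
vanishes identically as soon as it has infinitely many zeros. -/
theorem exists_polynomial_eval_eq_adjugate {k m : Type*} [Fintype k] [DecidableEq k]
    (A : Matrix k k ℂ) (B : Matrix k m ℂ) (a : k → ℂ) (b : m → ℂ) (j : m) :
    ∃ p : Polynomial ℂ, ∀ s : ℂ, p.eval s =
      (a ᵥ* ((algebraMap ℂ (Matrix k k ℂ) s - A).adjugate * B)) j +
        (algebraMap ℂ (Matrix k k ℂ) s - A).det * b j := by
  refine ⟨((fun i => Polynomial.C (a i)) ᵥ* ((charmatrix A).adjugate * B.map Polynomial.C)) j +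
    (charmatrix A).det * Polynomial.C (b j), fun s => ?_⟩
  have h1 : (Polynomial.evalRingHom s).mapMatrix (charmatrix A) =
      algebraMap ℂ (Matrix k k ℂ) s - A := by
    ext i l
    by_cases h : i = l
    · subst h; simp [algebraMap_matrix_apply]
    · simp [algebraMap_matrix_apply, h, charmatrix_apply_ne]
  rw [Polynomial.eval_add, Polynomial.eval_mul, Polynomial.eval_C, ← h1, ← RingHom.map_adjugate,
    ← RingHom.map_det]
  simp [vecMul, dotProduct, Polynomial.eval_finsetSum, mul_apply]

/-- For a controllable pair the graphs of the input-state relation at infinitely many frequencies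
span the whole space. -/
theorem eq_zero_of_forall_pencil {k m : Type*} [Fintype k] [DecidableEq k] [Fintype m]
    [DecidableEq m] (A : Matrix k k ℂ) (B : Matrix k m ℂ)
    (hctrl : ∀ a : k → ℂ, (∀ i : ℕ, (a ᵥ* A ^ i) ᵥ* B = 0) → a = 0) {W : Set ℂ} (hW : W.Infinite)
    (a : k → ℂ) (b : m → ℂ)
    (h : ∀ s ∈ W, ∀ x u, s • x = A *ᵥ x + B *ᵥ u → a ⬝ᵥ x + b ⬝ᵥ u = 0) : a = 0 ∧ b = 0 := by
  set N : ℂ → Matrix k k ℂ := fun s => algebraMap ℂ (Matrix k k ℂ) s - A with hN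
  have hNmul : ∀ s x, N s *ᵥ x = s • x - A *ᵥ x := by
    intro s x
    rw [hN]; simp only; rw [sub_mulVec, Algebra.algebraMap_eq_smul_one, smul_mulVec, one_mulVec]
  have hpoly : ∀ s j, (a ᵥ* ((N s).adjugate * B)) j + (N s).det * b j = 0 := by
    intro s j
    obtain ⟨p, hp⟩ := exists_polynomial_eval_eq_adjugate A B a b j
    have hp0 : p = 0 := by
      refine Polynomial.eq_zero_of_infinite_isRoot p (hW.mono fun s hs => ?_)
      rw [Set.mem_ofPred_eq, Polynomial.IsRoot.def, hp]
      -- The input `det(s - A) e_j` with the state `adj(s - A) B e_j` satisfies the state equation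
      -- even when `s` is an eigenvalue of `A`.
      have h1 := h s hs ((N s).adjugate *ᵥ (B *ᵥ Pi.single j 1)) ((N s).det • Pi.single j 1) (by
        rw [← sub_eq_iff_eq_add', ← hNmul, mulVec_mulVec, mul_adjugate, smul_mulVec, one_mulVec,
          mulVec_smul])
      rw [← h1, dotProduct_mulVec, dotProduct_mulVec, vecMul_vecMul, dotProduct_smul,
        dotProduct_single, dotProduct_single, mul_one, mul_one, smul_eq_mul]
    rw [← hp s, hp0, Polynomial.eval_zero]
  have hgood : ∀ᶠ s in Bornology.cobounded ℂ, (N s).det ≠ 0 := by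
    have hfin : {s : ℂ | A.charpoly.IsRoot s}.Finite :=
      Polynomial.finite_setOfPred_isRoot A.charpoly_monic.ne_zero
    filter_upwards [Bornology.isBounded_def.1 hfin.isBounded] with s hs h0
    exact hs (by rw [Set.mem_ofPred_eq, Polynomial.IsRoot.def, eval_charpoly]; exact h0)
  have hconst : ∀ (Y : Matrix k m ℂ) (c : m → ℂ),
      (∀ s, (N s).det ≠ 0 → (a ᵥ* (N s)⁻¹) ᵥ* Y = c) → c = 0 := by
    intro Y c hc
    have h1 : Filter.Tendsto (fun s => (a ᵥ* resolvent A s) ᵥ* Y) (Bornology.cobounded ℂ)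
        (nhds ((a ᵥ* (0 : Matrix k k ℂ)) ᵥ* Y)) := by
      have : Continuous fun M : Matrix k k ℂ => (a ᵥ* M) ᵥ* Y := by fun_prop
      exact (this.tendsto 0).comp (tendsto_resolvent_cobounded A)
    rw [vecMul_zero, zero_vecMul] at h1
    refine tendsto_nhds_unique (tendsto_const_nhds.congr' ?_) h1
    filter_upwards [hgood] with s hs
    rw [← hc s hs, resolvent, nonsing_inv_eq_ringInverse]
  have hb : ∀ s, (N s).det ≠ 0 → (a ᵥ* (N s)⁻¹) ᵥ* B = -b := by
    intro s hs
    ext j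
    have h1 := hpoly s j
    rw [inv_def, vecMul_smul, smul_vecMul, vecMul_vecMul, Pi.smul_apply, smul_eq_mul,
      eq_neg_of_add_eq_zero_left h1, Ring.inverse_eq_inv', Pi.neg_apply]
    field_simp
  have hb0 : b = 0 := neg_eq_zero.1 (hconst B _ hb)
  -- Expansion at infinity, one coefficient at a time: if `a (s - A)⁻¹ A^i B` vanishes, then `a (s -
  -- A)⁻¹ A^(i+1) B` is the constant `-a A^i B`, and the resolvent tends to zero, so this constant
  -- is zero.
  have hstep : ∀ i : ℕ, (∀ s, (N s).det ≠ 0 → (a ᵥ* (N s)⁻¹) ᵥ* (A ^ i * B) = 0) ∧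
      (a ᵥ* A ^ i) ᵥ* B = 0 := by
    have hnext : ∀ i : ℕ, (∀ s, (N s).det ≠ 0 → (a ᵥ* (N s)⁻¹) ᵥ* (A ^ i * B) = 0) →
        ∀ s, (N s).det ≠ 0 →
          (a ᵥ* (N s)⁻¹) ᵥ* (A ^ (i + 1) * B) = -((a ᵥ* A ^ i) ᵥ* B) := by
      intro i hi s hs
      have h1 : (a ᵥ* (N s)⁻¹) ᵥ* A = s • (a ᵥ* (N s)⁻¹) - a := by
        have h2 : (a ᵥ* (N s)⁻¹) ᵥ* N s = a := by
          rw [vecMul_vecMul, nonsing_inv_mul _ (isUnit_iff_ne_zero.2 hs), vecMul_one]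
        have h3 : (a ᵥ* (N s)⁻¹) ᵥ* N s = s • (a ᵥ* (N s)⁻¹) - (a ᵥ* (N s)⁻¹) ᵥ* A := by
          rw [hN]; simp only
          rw [vecMul_sub, Algebra.algebraMap_eq_smul_one, vecMul_smul, vecMul_one]
        rw [h2] at h3
        rw [eq_sub_iff_add_eq, add_comm, ← eq_sub_iff_add_eq]
        exact h3
      rw [pow_succ', Matrix.mul_assoc, ← vecMul_vecMul, h1, sub_vecMul, smul_vecMul, hi s hs,
        smul_zero, zero_sub, vecMul_vecMul]
    intro i
    induction i with
    | zero =>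
      have h0 : ∀ s, (N s).det ≠ 0 → (a ᵥ* (N s)⁻¹) ᵥ* (A ^ 0 * B) = 0 := fun s hs => by
        rw [pow_zero, Matrix.one_mul, hb s hs, hb0, neg_zero]
      exact ⟨h0, neg_eq_zero.1 (hconst _ _ (hnext 0 h0))⟩
    | succ i ih =>
      have h0 : ∀ s, (N s).det ≠ 0 → (a ᵥ* (N s)⁻¹) ᵥ* (A ^ (i + 1) * B) = 0 := fun s hs => by
        rw [hnext i ih.1 s hs, ih.2, neg_zero]
      exact ⟨h0, neg_eq_zero.1 (hconst _ _ (hnext (i + 1) h0))⟩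
  exact ⟨hctrl a fun i => (hstep i).2, hb0⟩

/-- The Hautus test. -/
theorem eq_zero_of_vecMul_eq_smul {k m : Type*} [Fintype k] [DecidableEq k]
    (A : Matrix k k ℂ) (B : Matrix k m ℂ)
    (hctrl : ∀ a : k → ℂ, (∀ i : ℕ, (a ᵥ* A ^ i) ᵥ* B = 0) → a = 0) {a : k → ℂ} {s : ℂ}
    (hA : a ᵥ* A = s • a) (hB : a ᵥ* B = 0) : a = 0 := by
  refine hctrl a fun i => ?_
  have : a ᵥ* A ^ i = s ^ i • a := by
    induction i with
    | zero => simp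
    | succ i ih => rw [pow_succ, ← vecMul_vecMul, ih, smul_vecMul, hA, smul_smul, pow_succ]
  rw [this, smul_vecMul, hB, smul_zero]

/-! ### Evaluation of rational matrices -/

/-- `s` is not a pole of the rational function `f`. -/
def RegularAt (s : ℂ) (f : RatFunc ℝ) : Prop := Polynomial.aeval s f.denom ≠ 0

/-- `RatFunc.eval` divides by the reduced denominator and takes the value `0` at a pole, so it
respects sums and products only under regularity. The denominator of a sum or product divides the
product of the denominators, hence this form. -/
theorem RegularAt.of_dvd {s : ℂ} {f : RatFunc ℝ} {p : Polynomial ℝ} (h : f.denom ∣ p)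
    (hp : Polynomial.aeval s p ≠ 0) : RegularAt s f := by
  obtain ⟨q, rfl⟩ := h
  rw [map_mul] at hp
  exact left_ne_zero_of_mul hp

theorem RegularAt.add {s : ℂ} {f g : RatFunc ℝ} (hf : RegularAt s f) (hg : RegularAt s g) :
    RegularAt s (f + g) :=
  .of_dvd (RatFunc.denom_add_dvd f g) (by rw [map_mul]; exact mul_ne_zero hf hg)

theorem RegularAt.mul {s : ℂ} {f g : RatFunc ℝ} (hf : RegularAt s f) (hg : RegularAt s g) :
    RegularAt s (f * g) :=
  .of_dvd (RatFunc.denom_mul_dvd f g) (by rw [map_mul]; exact mul_ne_zero hf hg)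

theorem regularAt_zero (s : ℂ) : RegularAt s 0 := by simp [RegularAt]

/-- Evaluation of a rational matrix, entry by entry. -/
noncomputable def evalMatrix {a b : Type*} (M : Matrix a b (RatFunc ℝ)) (s : ℂ) : Matrix a b ℂ :=
  M.map (RatFunc.eval (algebraMap ℝ ℂ) s)

theorem evalMatrix_add {a b : Type*} {M N : Matrix a b (RatFunc ℝ)} {s : ℂ}
    (hM : ∀ i j, RegularAt s (M i j)) (hN : ∀ i j, RegularAt s (N i j)) :
    evalMatrix (M + N) s = evalMatrix M s + evalMatrix N s := by
  ext i j
  exact RatFunc.eval_add _ _ (hM i j) (hN i j)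

theorem regularAt_sum {ι : Type*} (t : Finset ι) (f : ι → RatFunc ℝ) {s : ℂ}
    (hf : ∀ i, RegularAt s (f i)) : RegularAt s (∑ i ∈ t, f i) ∧
      RatFunc.eval (algebraMap ℝ ℂ) s (∑ i ∈ t, f i) =
        ∑ i ∈ t, RatFunc.eval (algebraMap ℝ ℂ) s (f i) := by
  classical
  induction t using Finset.induction_on with
  | empty => simp [regularAt_zero]
  | insert i t hi ih =>
    rw [Finset.sum_insert hi, Finset.sum_insert hi, ← ih.2]
    exact ⟨(hf i).add ih.1, RatFunc.eval_add _ _ (hf i) ih.1⟩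

theorem regularAt_mul_apply {a b c : Type*} [Fintype b] {M : Matrix a b (RatFunc ℝ)}
    {N : Matrix b c (RatFunc ℝ)} {s : ℂ} (hM : ∀ i j, RegularAt s (M i j))
    (hN : ∀ i j, RegularAt s (N i j)) (i : a) (j : c) : RegularAt s ((M * N) i j) :=
  (regularAt_sum _ _ fun l => (hM i l).mul (hN l j)).1

theorem evalMatrix_mul {a b c : Type*} [Fintype b] {M : Matrix a b (RatFunc ℝ)}
    {N : Matrix b c (RatFunc ℝ)} {s : ℂ} (hM : ∀ i j, RegularAt s (M i j))
    (hN : ∀ i j, RegularAt s (N i j)) :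
    evalMatrix (M * N) s = evalMatrix M s * evalMatrix N s := by
  ext i j
  refine (regularAt_sum _ _ fun l => (hM i l).mul (hN l j)).2.trans ?_
  exact Finset.sum_congr rfl fun l _ => RatFunc.eval_mul _ _ (hM i l) (hN l j)

theorem finite_not_regularAt (f : RatFunc ℝ) : {s : ℂ | ¬ RegularAt s f}.Finite := by
  have h := f.denom.rootSet_finite ℂ
  refine h.subset fun s hs => ?_
  rw [Polynomial.mem_rootSet]
  exact ⟨f.denom_ne_zero, not_not.1 hs⟩

theorem finite_not_regularAt_matrix {a b : Type*} [Finite a] [Finite b]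
    (M : Matrix a b (RatFunc ℝ)) : {s : ℂ | ¬ ∀ i j, RegularAt s (M i j)}.Finite := by
  refine (Set.finite_iUnion fun i => Set.finite_iUnion fun j => finite_not_regularAt (M i j)).subset
    fun s hs => ?_
  simp only [Set.mem_ofPred_eq, not_forall] at hs
  simpa using hs

theorem not_isPole_iff {m : ℕ} {G : Matrix (Fin m) (Fin m) (RatFunc ℝ)} {s : ℂ} :
    ¬ IsPole G s ↔ ∀ i j, RegularAt s (G i j) := by
  simp [IsPole, RegularAt]

theorem evalMatrix_map_C {a b : Type*} (M : Matrix a b ℝ) (s : ℂ) :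
    evalMatrix (M.map RatFunc.C) s = M.map Complex.ofReal := by
  ext i j
  simp [evalMatrix]

theorem regularAt_C (s : ℂ) (c : ℝ) : RegularAt s (RatFunc.C c) := by simp [RegularAt]

theorem evalMatrix_one {a : Type*} [DecidableEq a] (s : ℂ) :
    evalMatrix (1 : Matrix a a (RatFunc ℝ)) s = 1 := by
  ext i j
  by_cases h : i = j
  · subst h; simp [evalMatrix]
  · simp [evalMatrix, h]

theorem continuousAt_eval {f : RatFunc ℝ} {s : ℂ} (hf : RegularAt s f) :
    ContinuousAt (fun s => RatFunc.eval (algebraMap ℝ ℂ) s f) s := by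
  have h1 : ∀ p : Polynomial ℝ, Continuous fun s : ℂ => p.eval₂ (algebraMap ℝ ℂ) s := fun p =>
    p.continuous_eval₂ _
  exact ((h1 _).continuousAt).div ((h1 _).continuousAt) hf

theorem continuousAt_evalAt {m : ℕ} {G : Matrix (Fin m) (Fin m) (RatFunc ℝ)} {s : ℂ}
    (hs : ¬ IsPole G s) : ContinuousAt (evalAt G) s := by
  rw [not_isPole_iff] at hs
  exact continuousAt_pi.2 fun i => continuousAt_pi.2 fun j => continuousAt_eval (hs i j)

/-! ### Realizations -/

theorem charmatrix_map_algebraMap {k : ℕ} (A : Matrix (Fin k) (Fin k) ℝ) :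
    (algebraMap (Polynomial ℝ) (RatFunc ℝ)).mapMatrix (charmatrix A) =
      Matrix.scalar (Fin k) RatFunc.X - A.map RatFunc.C := by
  ext i j
  by_cases h : i = j
  · subst h; simp
  · simp [h, charmatrix_apply_ne]

theorem isUnit_det_scalar_sub {k : ℕ} (A : Matrix (Fin k) (Fin k) ℝ) :
    IsUnit (Matrix.scalar (Fin k) (RatFunc.X : RatFunc ℝ) - A.map RatFunc.C).det := by
  rw [← charmatrix_map_algebraMap, ← RingHom.map_det, isUnit_iff_ne_zero]
  exact (map_ne_zero_iff _ (RatFunc.algebraMap_injective ℝ)).2 A.charpoly_monic.ne_zero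

/-- The identity `(X - A)(X - A)⁻¹ = 1` and the realization formula hold over the field of rational
functions and may be evaluated wherever all the entries involved are regular. The finite exceptional
set is removed later by continuity. -/
theorem exists_finite_evalAt_eq {m k : ℕ} {G : Matrix (Fin m) (Fin m) (RatFunc ℝ)}
    {A : Matrix (Fin k) (Fin k) ℝ} {B : Matrix (Fin k) (Fin m) ℝ}
    {C : Matrix (Fin m) (Fin k) ℝ} {D : Matrix (Fin m) (Fin m) ℝ}
    (h : IsRealization G A B C D) :
    ∃ F : Set ℂ, F.Finite ∧ ∀ s ∉ F, ¬ IsPole G s ∧ ∃ N : Matrix (Fin k) (Fin k) ℂ,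
      (s • 1 - A.map Complex.ofReal) * N = 1 ∧
      evalAt G s = C.map Complex.ofReal * N * B.map Complex.ofReal + D.map Complex.ofReal := by
  set Y := Matrix.scalar (Fin k) (RatFunc.X : RatFunc ℝ) - A.map RatFunc.C with hY
  have hYN : Y * Y⁻¹ = 1 := mul_nonsing_inv _ (isUnit_det_scalar_sub A)
  refine ⟨_, ((finite_not_regularAt_matrix G).union (finite_not_regularAt_matrix Y)).union
    (finite_not_regularAt_matrix Y⁻¹), fun s hs => ?_⟩
  simp only [Set.mem_union, Set.mem_ofPred_eq, not_or, not_not] at hs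
  obtain ⟨⟨hG, hYr⟩, hNr⟩ := hs
  have hY1 : evalMatrix Y s = s • 1 - A.map Complex.ofReal := by
    have h1 : Y = Matrix.scalar (Fin k) (RatFunc.X : RatFunc ℝ) + (-A).map RatFunc.C := by
      rw [hY, sub_eq_add_neg]; congr 1; ext i j; simp
    have hX : ∀ i j, RegularAt s (Matrix.scalar (Fin k) (RatFunc.X : RatFunc ℝ) i j) := by
      intro i j
      by_cases h : i = j
      · subst h; simp [RegularAt]
      · simp [RegularAt, h]
    have hA : ∀ i j, RegularAt s (((-A).map RatFunc.C) i j) := fun i j => regularAt_C s _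
    rw [h1, evalMatrix_add hX hA, evalMatrix_map_C]
    ext i j
    by_cases h : i = j
    · subst h; simp [evalMatrix, sub_eq_add_neg]
    · simp [evalMatrix, h]
  refine ⟨not_isPole_iff.2 hG, evalMatrix Y⁻¹ s, ?_, ?_⟩
  · rw [← hY1, ← evalMatrix_mul hYr hNr, hYN, evalMatrix_one]
  · have hC : ∀ i j, RegularAt s ((C.map RatFunc.C) i j) := fun i j => regularAt_C s _
    have hB : ∀ i j, RegularAt s ((B.map RatFunc.C) i j) := fun i j => regularAt_C s _
    have hD : ∀ i j, RegularAt s ((D.map RatFunc.C) i j) := fun i j => regularAt_C s _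
    have h1 := regularAt_mul_apply hC hNr
    change evalMatrix G s = _
    rw [h, evalMatrix_add (regularAt_mul_apply h1 hB) hD, evalMatrix_mul h1 hB,
      evalMatrix_mul hC hNr, evalMatrix_map_C, evalMatrix_map_C, evalMatrix_map_C]

/-- Kalman reduction: a nonzero `a` killing every `A^i B` makes the reachable subspace `S` proper.
It is invariant under `A` and contains the image of `B`, so restricting the state to `S` realizes
`G` in smaller dimension. -/
theorem IsMinimalRealization.controllable_real {m k : ℕ} {G : Matrix (Fin m) (Fin m) (RatFunc ℝ)}
    {A : Matrix (Fin k) (Fin k) ℝ} {B : Matrix (Fin k) (Fin m) ℝ}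
    {C : Matrix (Fin m) (Fin k) ℝ} {D : Matrix (Fin m) (Fin m) ℝ}
    (h : IsMinimalRealization G A B C D) (a : Fin k → ℝ)
    (ha : ∀ i : ℕ, (a ᵥ* A ^ i) ᵥ* B = 0) : a = 0 := by
  by_contra ha0
  set S : Submodule ℝ (Fin k → ℝ) :=
    Submodule.span ℝ {v | ∃ (i : ℕ) (u : Fin m → ℝ), v = (A ^ i) *ᵥ (B *ᵥ u)} with hS
  have hSa : ∀ v ∈ S, a ⬝ᵥ v = 0 := by
    intro v hv
    induction hv using Submodule.span_induction with
    | mem v hv =>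
      obtain ⟨i, u, rfl⟩ := hv
      rw [dotProduct_mulVec, dotProduct_mulVec, ha, zero_dotProduct]
    | zero => simp
    | add v w _ _ hv hw => rw [dotProduct_add, hv, hw, add_zero]
    | smul c v _ hv => rw [dotProduct_smul, hv, smul_zero]
  have hSA : ∀ v ∈ S, A *ᵥ v ∈ S := by
    intro v hv
    induction hv using Submodule.span_induction with
    | mem v hv =>
      obtain ⟨i, u, rfl⟩ := hv
      refine Submodule.subset_span ⟨i + 1, u, ?_⟩
      rw [pow_succ', ← mulVec_mulVec]
    | zero => rw [mulVec_zero]; exact S.zero_mem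
    | add v w _ _ hv hw => rw [mulVec_add]; exact S.add_mem hv hw
    | smul c v _ hv => rw [mulVec_smul]; exact S.smul_mem c hv
  have hSB : ∀ u, B *ᵥ u ∈ S := fun u => Submodule.subset_span ⟨0, u, by simp⟩
  have hlt : Module.finrank ℝ S < k := by
    have h1 : S < ⊤ := by
      refine lt_top_iff_ne_top.2 fun htop => ha0 ?_
      exact dotProduct_self_eq_zero.1 (hSa a (htop ▸ Submodule.mem_top))
    simpa using Submodule.finrank_lt_finrank_of_lt h1
  set b := Module.finBasis ℝ S
  set k' := Module.finrank ℝ S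
  set T : Matrix (Fin k) (Fin k') ℝ := of fun i j => (b j : Fin k → ℝ) i with hT
  have hrepr : ∀ v ∈ S, ∃ c, T *ᵥ c = v := by
    intro v hv
    refine ⟨b.repr ⟨v, hv⟩, ?_⟩
    have h1 := congrArg Subtype.val (b.sum_repr ⟨v, hv⟩)
    simp only [Submodule.coe_sum, Submodule.coe_smul] at h1
    refine Eq.trans ?_ h1
    ext i
    simp [hT, mulVec, dotProduct, mul_comm]
  have hTS : ∀ c, T *ᵥ c ∈ S := by
    intro c
    have h1 : T *ᵥ c = ∑ j, c j • (b j : Fin k → ℝ) := by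
      ext i
      simp [hT, mulVec, dotProduct, mul_comm]
    rw [h1]
    exact S.sum_mem fun j _ => S.smul_mem _ (b j).2
  choose fA hfA using fun j : Fin k' => hrepr _ (hSA _ (hTS (Pi.single j 1)))
  choose fB hfB using fun j : Fin m => hrepr _ (hSB (Pi.single j 1))
  set A' : Matrix (Fin k') (Fin k') ℝ := of fun i j => fA j i with hA'
  set B' : Matrix (Fin k') (Fin m) ℝ := of fun i j => fB j i with hB'
  have hAT : A * T = T * A' := by
    ext i j
    have h1 := congrFun (hfA j) i
    rw [mulVec_mulVec, mulVec_single_one] at h1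
    exact h1.symm
  have hBT : B = T * B' := by
    ext i j
    have h1 := congrFun (hfB j) i
    rw [mulVec_single_one] at h1
    exact h1.symm
  refine absurd (h.2 k' A' B' (C * T) D ?_) (not_le.2 hlt)
  -- The relation `A T = T A'` passes to `X - A` and hence to the inverses, which makes the two
  -- transfer matrices equal.
  have h1 : (Matrix.scalar (Fin k) (RatFunc.X : RatFunc ℝ) - A.map RatFunc.C) * T.map RatFunc.C =
      T.map RatFunc.C * (Matrix.scalar (Fin k') (RatFunc.X : RatFunc ℝ) - A'.map RatFunc.C) := by
    have h2 : A.map RatFunc.C * T.map RatFunc.C = T.map RatFunc.C * A'.map RatFunc.C := by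
      rw [← Matrix.map_mul, hAT, Matrix.map_mul]
    rw [Matrix.sub_mul, Matrix.mul_sub, h2]
    congr 1
    ext i j
    simp [mul_comm]
  have h2 : (Matrix.scalar (Fin k) (RatFunc.X : RatFunc ℝ) - A.map RatFunc.C)⁻¹ * T.map RatFunc.C =
      T.map RatFunc.C * (Matrix.scalar (Fin k') (RatFunc.X : RatFunc ℝ) - A'.map RatFunc.C)⁻¹ := by
    have h3 := isUnit_det_scalar_sub A
    have h4 := isUnit_det_scalar_sub A'
    calc _ = (Matrix.scalar (Fin k) (RatFunc.X : RatFunc ℝ) - A.map RatFunc.C)⁻¹ *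
          (T.map RatFunc.C * ((Matrix.scalar (Fin k') (RatFunc.X : RatFunc ℝ) - A'.map RatFunc.C) *
            (Matrix.scalar (Fin k') (RatFunc.X : RatFunc ℝ) - A'.map RatFunc.C)⁻¹)) := by
          rw [mul_nonsing_inv _ h4, Matrix.mul_one]
      _ = _ := by
          rw [← Matrix.mul_assoc (T.map RatFunc.C), ← h1, Matrix.mul_assoc, ← Matrix.mul_assoc,
            nonsing_inv_mul _ h3, Matrix.one_mul]
  rw [IsRealization, h.1, Matrix.map_mul, hBT, Matrix.map_mul, Matrix.mul_assoc, Matrix.mul_assoc,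
    ← Matrix.mul_assoc _ (T.map RatFunc.C), h2, Matrix.mul_assoc, Matrix.mul_assoc]

/-- Minimal realizations are controllable. -/
theorem IsMinimalRealization.controllable {m k : ℕ} {G : Matrix (Fin m) (Fin m) (RatFunc ℝ)}
    {A : Matrix (Fin k) (Fin k) ℝ} {B : Matrix (Fin k) (Fin m) ℝ}
    {C : Matrix (Fin m) (Fin k) ℝ} {D : Matrix (Fin m) (Fin m) ℝ}
    (h : IsMinimalRealization G A B C D) (a : Fin k → ℂ)
    (ha : ∀ i : ℕ, (a ᵥ* (A.map Complex.ofReal) ^ i) ᵥ* (B.map Complex.ofReal) = 0) : a = 0 := by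
  have h1 : ∀ i : ℕ, a ᵥ* (A ^ i * B).map Complex.ofReal = 0 := by
    intro i
    have h2 : (A ^ i * B).map Complex.ofReal =
        (A.map Complex.ofReal) ^ i * B.map Complex.ofReal := by
      have h3 := (Complex.ofRealHom.mapMatrix).map_pow A i
      have h4 : (A ^ i).map Complex.ofReal = (A.map Complex.ofReal) ^ i := h3
      rw [← h4]
      exact Matrix.map_mul (f := Complex.ofRealHom)
    rw [h2, ← vecMul_vecMul, ha]
  have hre : (fun i => (a i).re) = 0 := by
    refine h.controllable_real _ fun i => ?_
    ext j
    have h2 := congrArg Complex.re (congrFun (h1 i) j)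
    rw [vecMul_vecMul]
    simpa [vecMul, dotProduct, Complex.re_sum] using h2
  have him : (fun i => (a i).im) = 0 := by
    refine h.controllable_real _ fun i => ?_
    ext j
    have h2 := congrArg Complex.im (congrFun (h1 i) j)
    rw [vecMul_vecMul]
    simpa [vecMul, dotProduct, Complex.im_sum] using h2
  ext i
  exact Complex.ext (congrFun hre i) (congrFun him i)

/-! ### Matrix inequalities and frequency domain inequalities -/

/-- The quadratic form of the multiplier `M` at the vector `(g u, u)`. -/
noncomputable def multiplierForm {m : ℕ} (M : Matrix (Fin m ⊕ Fin m) (Fin m ⊕ Fin m) ℂ)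
    (g : Matrix (Fin m) (Fin m) ℂ) (u : Fin m → ℂ) : ℝ :=
  (star (Sum.elim (g *ᵥ u) u) ⬝ᵥ (M *ᵥ Sum.elim (g *ᵥ u) u)).re

theorem continuous_multiplierForm {m : ℕ} (M : Matrix (Fin m ⊕ Fin m) (Fin m ⊕ Fin m) ℂ)
    (u : Fin m → ℂ) : Continuous fun g => multiplierForm M g u := by
  have h1 : Continuous fun g : Matrix (Fin m) (Fin m) ℂ => Sum.elim (g *ᵥ u) u := by
    refine continuous_pi fun i => ?_
    cases i with
    | inl i => exact (continuous_apply i).comp (continuous_id.matrix_mulVec continuous_const)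
    | inr i => exact continuous_const
  exact Complex.continuous_re.comp
    (Continuous.dotProduct (continuous_star.comp h1) (continuous_const.matrix_mulVec h1))

section pencil

variable {m k : ℕ} (A : Matrix (Fin k) (Fin k) ℝ) (B : Matrix (Fin k) (Fin m) ℝ)
  (C : Matrix (Fin m) (Fin k) ℝ) (D : Matrix (Fin m) (Fin m) ℝ)

/-- `-j [A B]`. -/
noncomputable def derivPencil : Matrix (Fin k) (Fin k ⊕ Fin m) ℂ :=
  (-Complex.I) • fromCols (A.map Complex.ofReal) (B.map Complex.ofReal)

/-- `[I 0]`. -/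
def statePencil (k m : ℕ) : Matrix (Fin k) (Fin k ⊕ Fin m) ℂ := fromCols 1 0

theorem derivPencil_mulVec (x : Fin k → ℂ) (u : Fin m → ℂ) :
    derivPencil A B *ᵥ Sum.elim x u =
      (-Complex.I) • (A.map Complex.ofReal *ᵥ x + B.map Complex.ofReal *ᵥ u) := by
  rw [derivPencil, smul_mulVec, fromCols_mulVec_sumElim]

theorem statePencil_mulVec (x : Fin k → ℂ) (u : Fin m → ℂ) :
    statePencil k m *ᵥ Sum.elim x u = x := by
  rw [statePencil, fromCols_mulVec_sumElim, one_mulVec, zero_mulVec, add_zero]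

theorem stateBlock_eq : stateBlock A B =
    fromRows (Complex.I • derivPencil A B) (statePencil k m) := by
  rw [stateBlock, derivPencil, statePencil, smul_smul, mul_neg, Complex.I_mul_I, neg_neg, one_smul,
    fromRows_fromCols_eq_fromBlocks]

/-- Substituting `[A B] = j L` absorbs the imaginary units of the `Q`-blocks and makes the frequency
parameter real, `ν = ω`. The sign of `P` is harmless, since `P` is an arbitrary Hermitian matrix. -/
theorem lmiForm_lowFreqBlock (ωc : ℝ) (P Q : Matrix (Fin k) (Fin k) ℂ)
    (M : Matrix (Fin m ⊕ Fin m) (Fin m ⊕ Fin m) ℂ) :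
    lmiForm A B C D (lowFreqBlock ωc P Q) M =
      freqForm (derivPencil A B) (statePencil k m) ωc (-P) Q +
        (outputBlock C D)ᴴ * M * outputBlock C D := by
  rw [lmiForm, stateBlock_eq, lowFreqBlock, freqForm]
  congr 1
  rw [conjTranspose_fromRows_eq_fromCols_conjTranspose, fromCols_mul_fromBlocks,
    fromCols_mul_fromRows, conjTranspose_smul, Complex.star_def, Complex.conj_I]
  simp only [Matrix.mul_add, Matrix.add_mul, Matrix.mul_sub, Matrix.sub_mul, Matrix.mul_smul,
    Matrix.smul_mul, Matrix.mul_neg, Matrix.neg_mul, smul_add, smul_sub, smul_neg, smul_smul,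
    Matrix.mul_zero, add_zero, neg_smul, neg_neg]
  have h1 : Complex.I * (Complex.I * (ωc : ℂ)) = -ωc := by
    rw [← mul_assoc, Complex.I_mul_I]; ring
  have h3 : Complex.I * (2 * Complex.I) = -2 := by
    rw [mul_comm 2, ← mul_assoc, Complex.I_mul_I]; ring
  match_scalars <;> (simp [h1, h3]; try (ring_nf; simp))

/-- Exchanging the two halves of the pencil replaces `ω` by `ν = 1/ω`, and `[ωc, ∞)` by `(0, 1/ωc]`.
The rescaling of `Q` by `ωc > 0` in the applications preserves positivity. -/
theorem lmiForm_highFreqBlock {ωc : ℝ} (hωc : ωc ≠ 0) (P Q : Matrix (Fin k) (Fin k) ℂ)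
    (M : Matrix (Fin m ⊕ Fin m) (Fin m ⊕ Fin m) ℂ) :
    lmiForm A B C D (highFreqBlock ωc P Q) M =
      freqForm (statePencil k m) (derivPencil A B) ωc⁻¹ P ((ωc : ℂ) • Q) +
        (outputBlock C D)ᴴ * M * outputBlock C D := by
  rw [lmiForm, stateBlock_eq, highFreqBlock, freqForm]
  congr 1
  rw [conjTranspose_fromRows_eq_fromCols_conjTranspose, fromCols_mul_fromBlocks,
    fromCols_mul_fromRows, conjTranspose_smul, Complex.star_def, Complex.conj_I]
  simp only [Matrix.mul_add, Matrix.add_mul, Matrix.mul_sub, Matrix.sub_mul, Matrix.mul_smul,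
    Matrix.smul_mul, Matrix.mul_neg, Matrix.neg_mul, smul_add, smul_sub, smul_neg, smul_smul,
    Matrix.mul_zero, zero_add, neg_smul]
  have h1 : ((ωc⁻¹ : ℝ) : ℂ) * (ωc : ℂ) = 1 := by
    rw [← Complex.ofReal_mul, inv_mul_cancel₀ hωc, Complex.ofReal_one]
  rw [h1]
  match_scalars <;> ring_nf <;> simp

variable {A B C D}

theorem outputBlock_form {G : Matrix (Fin m) (Fin m) (RatFunc ℝ)} {s : ℂ}
    {N : Matrix (Fin k) (Fin k) ℂ} (hN : (s • 1 - A.map Complex.ofReal) * N = 1)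
    (hG : evalAt G s = C.map Complex.ofReal * N * B.map Complex.ofReal + D.map Complex.ofReal)
    (M : Matrix (Fin m ⊕ Fin m) (Fin m ⊕ Fin m) ℂ) {x : Fin k → ℂ} {u : Fin m → ℂ}
    (hx : s • x = A.map Complex.ofReal *ᵥ x + B.map Complex.ofReal *ᵥ u) :
    (star (Sum.elim x u) ⬝ᵥ (((outputBlock C D)ᴴ * M * outputBlock C D) *ᵥ Sum.elim x u)).re =
      multiplierForm M (evalAt G s) u := by
  have h1 : x = N *ᵥ (B.map Complex.ofReal *ᵥ u) := by
    have h2 : (s • 1 - A.map Complex.ofReal) *ᵥ x = B.map Complex.ofReal *ᵥ u := by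
      rw [sub_mulVec, smul_mulVec, one_mulVec, hx, add_sub_cancel_left]
    rw [← h2, mulVec_mulVec, mul_eq_one_comm.1 hN, one_mulVec]
  have h3 : outputBlock C D *ᵥ Sum.elim x u = Sum.elim (evalAt G s *ᵥ u) u := by
    rw [outputBlock, fromBlocks_mulVec]
    simp only [Sum.elim_comp_inl, Sum.elim_comp_inr, zero_mulVec, one_mulVec, zero_add]
    rw [hG, add_mulVec, ← mulVec_mulVec, ← mulVec_mulVec, ← h1]
  rw [star_dotProduct_conjTranspose_mul_mul_mulVec, h3, multiplierForm]

theorem exists_state {s : ℂ} {N : Matrix (Fin k) (Fin k) ℂ}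
    (hN : (s • 1 - A.map Complex.ofReal) * N = 1) (u : Fin m → ℂ) :
    ∃ x, s • x = A.map Complex.ofReal *ᵥ x + B.map Complex.ofReal *ᵥ u := by
  refine ⟨N *ᵥ (B.map Complex.ofReal *ᵥ u), ?_⟩
  have h2 : (s • 1 - A.map Complex.ofReal) *ᵥ (N *ᵥ (B.map Complex.ofReal *ᵥ u)) =
      B.map Complex.ofReal *ᵥ u := by rw [mulVec_mulVec, hN, one_mulVec]
  rw [sub_mulVec, smul_mulVec, one_mulVec, sub_eq_iff_eq_add'] at h2
  exact h2

theorem finite_frequencies {F : Set ℂ} (hF : F.Finite) :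
    {ν : ℝ | (ν : ℂ) * Complex.I ∈ F}.Finite :=
  hF.preimage fun x _ y _ h => by simpa using h

theorem frequency_inequality_of_multipliers {k n : Type*} [Fintype k] [Fintype n]
    {L R : Matrix k n ℂ} {ρ : ℝ} {P Q : Matrix k k ℂ} {Θ : Matrix n n ℂ} (hQ : Q.PosSemidef)
    (h : (-(freqForm L R ρ P Q + Θ)).PosSemidef) {ν : ℝ} (hν : ν ∈ Set.Icc 0 ρ) {ζ : n → ℂ}
    (hζ : L *ᵥ ζ = (ν : ℂ) • R *ᵥ ζ) : (star ζ ⬝ᵥ (Θ *ᵥ ζ)).re ≤ 0 := by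
  have h1 := h.re_dotProduct_nonneg ζ
  rw [neg_mulVec, add_mulVec, dotProduct_neg, dotProduct_add,
    star_dotProduct_freqForm_mulVec L R ρ P Q hζ hζ, sub_self, mul_zero, zero_mul, zero_add] at h1
  have h2 := hQ.re_dotProduct_nonneg (R *ᵥ ζ)
  have h3 : ((ρ : ℂ) * (ν + ν) - 2 * ν * ν) = ((2 * ν * (ρ - ν) : ℝ) : ℂ) := by push_cast; ring
  rw [h3, RCLike.re_to_complex, Complex.neg_re, Complex.add_re, Complex.re_ofReal_mul] at h1
  have h4 : 0 ≤ 2 * ν * (ρ - ν) := mul_nonneg (mul_nonneg two_pos.le hν.1) (sub_nonneg.2 hν.2)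
  have h5 := mul_nonneg h4 h2
  rw [RCLike.re_to_complex] at h5
  linarith

theorem outputBlock_isHermitian {M : Matrix (Fin m ⊕ Fin m) (Fin m ⊕ Fin m) ℂ}
    (hM : M.IsHermitian) : ((outputBlock C D)ᴴ * M * outputBlock C D).IsHermitian :=
  isHermitian_conjTranspose_mul_mul _ hM

theorem low_pencil_iff {ν : ℝ} {x : Fin k → ℂ} {u : Fin m → ℂ} :
    derivPencil A B *ᵥ Sum.elim x u = (ν : ℂ) • statePencil k m *ᵥ Sum.elim x u ↔
      ((ν : ℂ) * Complex.I) • x = A.map Complex.ofReal *ᵥ x + B.map Complex.ofReal *ᵥ u := by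
  rw [derivPencil_mulVec, statePencil_mulVec, neg_smul, neg_eq_iff_eq_neg]
  constructor
  · intro h
    rw [mul_comm, mul_smul, ← neg_inj, ← smul_neg, ← h, smul_smul, Complex.I_mul_I, neg_smul,
      one_smul]
  · intro h
    rw [← h, smul_smul, ← neg_smul]
    congr 1
    linear_combination (ν : ℂ) * Complex.I_mul_I

theorem high_pencil_iff {ν : ℝ} (hν : ν ≠ 0) {x : Fin k → ℂ} {u : Fin m → ℂ} :
    statePencil k m *ᵥ Sum.elim x u = (ν : ℂ) • derivPencil A B *ᵥ Sum.elim x u ↔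
      (((ν⁻¹ : ℝ) : ℂ) * Complex.I) • x =
        A.map Complex.ofReal *ᵥ x + B.map Complex.ofReal *ᵥ u := by
  have hν' : (ν : ℂ) ≠ 0 := by exact_mod_cast hν
  have h1 : (((ν⁻¹ : ℝ) : ℂ) * Complex.I) * ((ν : ℂ) * -Complex.I) = 1 := by
    push_cast
    field_simp
    rw [Complex.I_sq, neg_neg]
  rw [derivPencil_mulVec, statePencil_mulVec, smul_smul]
  constructor
  · intro h
    conv_lhs => rw [h, smul_smul, h1, one_smul]
  · intro h
    rw [← h, smul_smul, mul_comm, h1, one_smul]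

theorem pencil_span_aux
    (hctrl : ∀ a : Fin k → ℂ,
      (∀ i : ℕ, (a ᵥ* (A.map Complex.ofReal) ^ i) ᵥ* (B.map Complex.ofReal) = 0) → a = 0)
    {W : Set ℂ} (hW : W.Infinite) (w : Fin k ⊕ Fin m → ℂ)
    (h : ∀ s ∈ W, ∀ x u, s • x = A.map Complex.ofReal *ᵥ x + B.map Complex.ofReal *ᵥ u →
      star w ⬝ᵥ Sum.elim x u = 0) : w = 0 := by
  obtain ⟨h1, h2⟩ := eq_zero_of_forall_pencil _ _ hctrl hW (star w ∘ Sum.inl) (star w ∘ Sum.inr)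
    fun s hs x u hx => by
      rw [← h s hs x u hx]
      simp [dotProduct]
  ext i
  cases i with
  | inl i => simpa using congrFun h1 i
  | inr i => simpa using congrFun h2 i

theorem sum_elim_surj {p : (Fin k ⊕ Fin m → ℂ) → Prop} (h : ∀ x u, p (Sum.elim x u)) (ζ) : p ζ := by
  rw [← Sum.elim_comp_inl_inr ζ]; exact h _ _

theorem eq_zero_of_vecMul_statePencil {v : Fin k → ℂ} (h : v ᵥ* statePencil k m = 0) : v = 0 := by
  rw [statePencil, vecMul_fromCols, vecMul_one] at h
  ext i
  simpa using congrFun h (Sum.inl i)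

theorem mem_closure_diff_finite {U F : Set ℝ} (hU : IsOpen U) (hF : F.Finite) {x : ℝ}
    (hx : x ∈ closure U) : x ∈ closure (U ∩ Fᶜ) :=
  closure_minimal ((hF.countable.dense_compl ℝ).open_subset_closure_inter hU) isClosed_closure hx

theorem multiplierForm_nonpos_of_closure {G : Matrix (Fin m) (Fin m) (RatFunc ℝ)}
    {M : Matrix (Fin m ⊕ Fin m) (Fin m ⊕ Fin m) ℂ} {S : Set ℝ} {u : Fin m → ℂ}
    (h : ∀ ν ∈ S, multiplierForm M (evalAt G (ν * Complex.I)) u ≤ 0) {ω : ℝ} (hω : ω ∈ closure S)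
    (hp : ¬ IsPole G (ω * Complex.I)) : multiplierForm M (evalAt G (ω * Complex.I)) u ≤ 0 := by
  have h1 : ContinuousAt (fun ν : ℝ => multiplierForm M (evalAt G (ν * Complex.I)) u) ω :=
    (continuous_multiplierForm M u).continuousAt.comp
      (ContinuousAt.comp (f := fun ν : ℝ => (ν : ℂ) * Complex.I) (continuousAt_evalAt hp)
        (by fun_prop))
  exact ContinuousWithinAt.closure_le hω h1.continuousWithinAt continuousWithinAt_const h

/-- The generalized KYP lemma for the frequency range `[0, ωc]`. -/
theorem low_frequency_kyp {G : Matrix (Fin m) (Fin m) (RatFunc ℝ)} (hG : IsRealization G A B C D)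
    (hctrl : ∀ a : Fin k → ℂ,
      (∀ i : ℕ, (a ᵥ* (A.map Complex.ofReal) ^ i) ᵥ* (B.map Complex.ofReal) = 0) → a = 0)
    {ωc : ℝ} (hωc : 0 < ωc) {M : Matrix (Fin m ⊕ Fin m) (Fin m ⊕ Fin m) ℂ} (hM : M.IsHermitian) :
    (∃ P Q : Matrix (Fin k) (Fin k) ℂ, P.IsHermitian ∧ Q.PosSemidef ∧
      NegSemidef (lmiForm A B C D (lowFreqBlock ωc P Q) M)) ↔
    ∀ ω ∈ Set.Icc 0 ωc, ¬ IsPole G (ω * Complex.I) →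
      ∀ u, multiplierForm M (evalAt G (ω * Complex.I)) u ≤ 0 := by
  obtain ⟨F, hF, hFG⟩ := exists_finite_evalAt_eq hG
  have hF' := finite_frequencies hF
  constructor
  · rintro ⟨P, Q, -, hQ, h⟩ ω hω hp u
    refine multiplierForm_nonpos_of_closure (S := Set.Ioo 0 ωc ∩ {ν : ℝ | (ν : ℂ) * Complex.I ∈ F}ᶜ)
      (fun ν hν => ?_) (mem_closure_diff_finite isOpen_Ioo hF' (by rwa [closure_Ioo hωc.ne])) hp
    obtain ⟨-, N, hN, hN'⟩ := hFG _ hν.2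
    obtain ⟨x, hx⟩ := exists_state (B := B) hN u
    rw [NegSemidef, lmiForm_lowFreqBlock] at h
    rw [← outputBlock_form hN hN' M hx]
    exact frequency_inequality_of_multipliers hQ h (Set.Ioo_subset_Icc_self hν.1)
      (low_pencil_iff.2 hx)
  · intro h
    suffices hmult : ∃ P Q : Matrix (Fin k) (Fin k) ℂ, P.IsHermitian ∧ Q.PosSemidef ∧
        (-(freqForm (derivPencil A B) (statePencil k m) ωc P Q +
          (outputBlock C D)ᴴ * M * outputBlock C D)).PosSemidef by
      obtain ⟨P, Q, hP, hQ, hPQ⟩ := hmult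
      refine ⟨-P, Q, hP.neg, hQ, ?_⟩
      rw [NegSemidef, lmiForm_lowFreqBlock, neg_neg]
      exact hPQ
    refine exists_multipliers_of_frequency_inequality
      (derivPencil A B) (statePencil k m) ωc hωc.le (fun ν₀ w hw => ?_)
      (fun v _ hv => eq_zero_of_vecMul_statePencil hv)
      (outputBlock_isHermitian hM) (fun ν hν ζ hζ => ?_)
    · refine pencil_span_aux hctrl
        (W := (fun ν : ℝ => (ν : ℂ) * Complex.I) '' (Set.Ioo 0 ωc \ {ν₀})) ?_ w ?_
      · refine Set.Infinite.image (fun x _ y _ h => by simpa using h) ?_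
        exact (Set.Ioo_infinite hωc).sdiff (Set.finite_singleton _)
      · rintro _ ⟨ν, hν, rfl⟩ x u hx
        exact hw _ ⟨ν, hν.1, hν.2, low_pencil_iff.2 hx⟩
    -- At a pole the values of `G` say nothing about the solutions of the pencil, so the inequality
    -- is carried there from nearby regular frequencies. The required full row rank is the Hautus
    -- test at `jν`.
    · refine frequency_inequality_of_cofinite _ _ ωc hωc _ _ hF' (fun ν hν hνF => ?_) hν
        (fun v hv => ?_) hζ
      · refine sum_elim_surj fun x u hx => ?_
        obtain ⟨hp, N, hN, hN'⟩ := hFG _ hνF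
        rw [outputBlock_form hN hN' M (low_pencil_iff.1 hx)]
        exact h ν (Set.Ioo_subset_Icc_self hν) hp u
      · rw [vecMul_sub, derivPencil, statePencil, vecMul_smul, vecMul_smul, vecMul_fromCols,
          vecMul_fromCols, vecMul_one, vecMul_zero] at hv
        refine eq_zero_of_vecMul_eq_smul _ _ hctrl (s := ν * Complex.I) ?_ ?_
        · ext i
          have h1 := congrFun hv (Sum.inl i)
          simp only [Pi.sub_apply, Pi.smul_apply, Sum.elim_inl, smul_eq_mul, Pi.zero_apply] at h1 ⊢
          linear_combination Complex.I * h1 + (v ᵥ* A.map Complex.ofReal) i * Complex.I_mul_I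
        · ext i
          have h1 := congrFun hv (Sum.inr i)
          simpa using h1

/-- The generalized KYP lemma for the frequency range `[ωc, ∞)`. -/
theorem high_frequency_kyp {G : Matrix (Fin m) (Fin m) (RatFunc ℝ)} (hG : IsRealization G A B C D)
    (hctrl : ∀ a : Fin k → ℂ,
      (∀ i : ℕ, (a ᵥ* (A.map Complex.ofReal) ^ i) ᵥ* (B.map Complex.ofReal) = 0) → a = 0)
    {ωc : ℝ} (hωc : 0 < ωc) {M : Matrix (Fin m ⊕ Fin m) (Fin m ⊕ Fin m) ℂ} (hM : M.IsHermitian) :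
    (∃ P Q : Matrix (Fin k) (Fin k) ℂ, P.IsHermitian ∧ Q.PosSemidef ∧
      NegSemidef (lmiForm A B C D (highFreqBlock ωc P Q) M)) ↔
    ∀ ω : ℝ, ωc ≤ ω → ¬ IsPole G (ω * Complex.I) →
      ∀ u, multiplierForm M (evalAt G (ω * Complex.I)) u ≤ 0 := by
  obtain ⟨F, hF, hFG⟩ := exists_finite_evalAt_eq hG
  have hF' := finite_frequencies hF
  have hωc' : 0 < ωc⁻¹ := inv_pos.2 hωc
  constructor
  · rintro ⟨P, Q, -, hQ, h⟩ ω hω hp u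
    refine multiplierForm_nonpos_of_closure (S := Set.Ioi ωc ∩ {ν : ℝ | (ν : ℂ) * Complex.I ∈ F}ᶜ)
      (fun ν hν => ?_) (mem_closure_diff_finite isOpen_Ioi hF' (by rwa [closure_Ioi])) hp
    obtain ⟨-, N, hN, hN'⟩ := hFG _ hν.2
    obtain ⟨x, hx⟩ := exists_state (B := B) hN u
    rw [NegSemidef, lmiForm_highFreqBlock A B C D hωc.ne'] at h
    rw [← outputBlock_form hN hN' M hx]
    have hν0 : 0 < ν := hωc.trans hν.1
    refine frequency_inequality_of_multipliers (ν := ν⁻¹) (hQ.smul (by exact_mod_cast hωc.le)) h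
      ⟨by positivity, inv_anti₀ hωc (le_of_lt hν.1)⟩ ((high_pencil_iff (by positivity)).2 ?_)
    rw [inv_inv]
    exact hx
  · intro h
    suffices hmult : ∃ P Q : Matrix (Fin k) (Fin k) ℂ, P.IsHermitian ∧ Q.PosSemidef ∧
        (-(freqForm (statePencil k m) (derivPencil A B) ωc⁻¹ P Q +
          (outputBlock C D)ᴴ * M * outputBlock C D)).PosSemidef by
      obtain ⟨P, Q, hP, hQ, hPQ⟩ := hmult
      refine ⟨P, ((ωc⁻¹ : ℝ) : ℂ) • Q, hP, hQ.smul (by exact_mod_cast hωc'.le), ?_⟩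
      rw [NegSemidef, lmiForm_highFreqBlock A B C D hωc.ne', smul_smul, ← Complex.ofReal_mul,
        mul_inv_cancel₀ hωc.ne', Complex.ofReal_one, one_smul]
      exact hPQ
    refine exists_multipliers_of_frequency_inequality
      (statePencil k m) (derivPencil A B) ωc⁻¹ hωc'.le (fun ν₀ w hw => ?_)
      (fun v hv _ => eq_zero_of_vecMul_statePencil hv)
      (outputBlock_isHermitian hM) (fun ν hν ζ hζ => ?_)
    · refine pencil_span_aux hctrl
        (W := (fun ν : ℝ => ((ν⁻¹ : ℝ) : ℂ) * Complex.I) '' (Set.Ioo 0 ωc⁻¹ \ {ν₀})) ?_ w ?_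
      · refine Set.Infinite.image (fun x _ y _ h => by simpa using h) ?_
        exact (Set.Ioo_infinite hωc').sdiff (Set.finite_singleton _)
      · rintro _ ⟨ν, hν, rfl⟩ x u hx
        exact hw _ ⟨ν, hν.1, hν.2, (high_pencil_iff hν.1.1.ne').2 hx⟩
    · have hF'' : {ν : ℝ | ((ν⁻¹ : ℝ) : ℂ) * Complex.I ∈ F}.Finite :=
        hF.preimage fun x _ y _ h => by simpa using h
      refine frequency_inequality_of_cofinite _ _ ωc⁻¹ hωc' _ _ hF'' (fun ν hν hνF => ?_) hν
        (fun v hv => ?_) hζ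
      · refine sum_elim_surj fun x u hx => ?_
        obtain ⟨hp, N, hN, hN'⟩ := hFG _ hνF
        rw [outputBlock_form hN hN' M ((high_pencil_iff hν.1.ne').1 hx)]
        exact h _ ((le_inv_comm₀ hωc hν.1).2 hν.2.le) hp u
      · rw [vecMul_sub, derivPencil, statePencil, vecMul_smul, vecMul_smul, vecMul_fromCols,
          vecMul_fromCols, vecMul_one, vecMul_zero] at hv
        have hl : ∀ i, v i + ν * Complex.I * (v ᵥ* A.map Complex.ofReal) i = 0 := fun i => by
          have h1 := congrFun hv (Sum.inl i)
          simp only [Pi.sub_apply, Pi.smul_apply, Sum.elim_inl, smul_eq_mul, Pi.zero_apply] at h1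
          linear_combination h1
        -- `ν = 0` is the frequency infinity, where the pencil is `[I 0]` and has full row rank
        -- outright. Otherwise the Hautus test applies at `j/ν`.
        rcases eq_or_ne ν 0 with rfl | hν0
        · ext i
          simpa using hl i
        have hν' : (ν : ℂ) ≠ 0 := by exact_mod_cast hν0
        refine eq_zero_of_vecMul_eq_smul _ _ hctrl (s := (ν : ℂ)⁻¹ * Complex.I) ?_ ?_
        · ext i
          have h1 := hl i
          simp only [Pi.smul_apply, smul_eq_mul]
          field_simp
          linear_combination -Complex.I * h1 + ν * (v ᵥ* A.map Complex.ofReal) i * Complex.I_mul_I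
        · ext i
          have h1 := congrFun hv (Sum.inr i)
          simpa [hν'] using h1

end pencil

/-! ### Half-planes containing the numerical range, and phase sectors -/

/-- The numerical range of `A` lies in the closed half-plane centred at direction `η`. -/
def InHalfPlane {n : ℕ} (A : Matrix (Fin n) (Fin n) ℂ) (η : ℝ) : Prop :=
  ∀ x : Fin n → ℂ, 0 ≤ (Complex.exp (-(Complex.I * η)) * (star x ⬝ᵥ (A *ᵥ x))).re

theorem exp_neg_mul_exp_re (θ η : ℝ) :
    (Complex.exp (-(Complex.I * η)) * Complex.exp (Complex.I * θ)).re = Real.cos (θ - η) := by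
  rw [← Complex.exp_add, ← Complex.exp_ofReal_mul_I_re]
  congr 2
  push_cast
  ring

theorem exp_neg_mul_exp_im (θ η : ℝ) :
    (Complex.exp (-(Complex.I * η)) * Complex.exp (Complex.I * θ)).im = Real.sin (θ - η) := by
  rw [← Complex.exp_add, ← Complex.exp_ofReal_mul_I_im]
  congr 2
  push_cast
  ring

theorem star_dotProduct_sectorialCore_mulVec {z d p : ℕ} (θ : Fin d → ℝ) (θ₀ : ℝ)
    (y : Fin z ⊕ (Fin d ⊕ (Fin 2 × Fin p)) → ℂ) :
    star y ⬝ᵥ (sectorialCore z p θ θ₀ *ᵥ y) =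
      ∑ i, Complex.exp (Complex.I * θ i) * Complex.normSq (y (.inr (.inl i))) +
      ∑ l, Complex.exp (Complex.I * θ₀) *
        (star (y (.inr (.inr (0, l)))) * (y (.inr (.inr (0, l))) + 2 * y (.inr (.inr (1, l)))) +
          star (y (.inr (.inr (1, l)))) * y (.inr (.inr (1, l)))) := by
  have hsplit : ∀ w : Fin z ⊕ (Fin d ⊕ (Fin 2 × Fin p)) → ℂ, star y ⬝ᵥ w =
      (star (y ∘ Sum.inl)) ⬝ᵥ (w ∘ Sum.inl) +
      ((star (y ∘ Sum.inr ∘ Sum.inl)) ⬝ᵥ (w ∘ Sum.inr ∘ Sum.inl) +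
       (star (y ∘ Sum.inr ∘ Sum.inr)) ⬝ᵥ (w ∘ Sum.inr ∘ Sum.inr)) := by
    intro w
    simp [dotProduct]
  rw [hsplit, sectorialCore, fromBlocks_mulVec]
  simp only [zero_mulVec, add_zero, zero_add, fromBlocks_mulVec]
  have h2 : star (y ∘ Sum.inl) ⬝ᵥ (Sum.elim (0 : Fin z → ℂ) (Sum.elim
      ((diagonal fun i => Complex.exp (Complex.I * (θ i : ℂ))) *ᵥ ((y ∘ Sum.inr) ∘ Sum.inl))
      ((blockDiagonal fun _ : Fin p => Complex.exp (Complex.I * (θ₀ : ℂ)) •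
        (!![1, 2; 0, 1] : Matrix (Fin 2) (Fin 2) ℂ)) *ᵥ
        ((y ∘ Sum.inr) ∘ Sum.inr))) ∘ Sum.inl) = 0 := by
    simp [Sum.elim_comp_inl]
  rw [h2, zero_add]
  congr 1
  · simp only [dotProduct, Function.comp_apply, Sum.elim_inr, Sum.elim_inl, mulVec_diagonal,
      Pi.star_apply]
    refine Finset.sum_congr rfl fun i _ => ?_
    rw [mul_left_comm, Complex.star_def, ← Complex.normSq_eq_conj_mul_self]
  · simp only [dotProduct, Function.comp_apply, Sum.elim_inr, mulVec, Pi.star_apply,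
      Fintype.sum_prod_type, Fin.sum_univ_two, blockDiagonal_apply]
    rw [← Finset.sum_add_distrib]
    refine Finset.sum_congr rfl fun l _ => ?_
    simp
    ring

theorem star_dotProduct_conj_reindex_mulVec {n : ℕ} {ι : Type*} [Fintype ι] [DecidableEq ι]
    {K : Matrix ι ι ℂ}
    (e : ι ≃ Fin n) {T : Matrix (Fin n) (Fin n) ℂ} (x : Fin n → ℂ) :
    star x ⬝ᵥ ((Tᴴ * reindex e e K * T) *ᵥ x) =
      star ((T *ᵥ x) ∘ e) ⬝ᵥ (K *ᵥ ((T *ᵥ x) ∘ e)) := by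
  rw [star_dotProduct_conjTranspose_mul_mul_mulVec]
  have h1 : reindex e e K *ᵥ (T *ᵥ x) = (K *ᵥ ((T *ᵥ x) ∘ e)) ∘ e.symm := by
    ext i
    simp only [mulVec, dotProduct, reindex_apply, submatrix_apply, Function.comp_apply]
    exact (Equiv.sum_comp e (fun j => K (e.symm i) (e.symm j) * _)).symm.trans (by simp)
  rw [h1, dotProduct, dotProduct, ← Equiv.sum_comp e]
  simp

/-- Congruence by `T` only renames the vectors, so the core matrix decides. A diagonal phase
contributes `cos(θ_i - η)`. A block of size two has forms filling the open half-plane around `θ₀`,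
so it fits into the closed half-plane around `θ₀` alone. -/
theorem inHalfPlane_iff {n z d p : ℕ} {θ : Fin d → ℝ} {θ₀ : ℝ}
    {e : (Fin z ⊕ (Fin d ⊕ (Fin 2 × Fin p))) ≃ Fin n} {T A : Matrix (Fin n) (Fin n) ℂ}
    (hT : IsUnit T) (hA : A = Tᴴ * Matrix.reindex e e (sectorialCore z p θ θ₀) * T) (η : ℝ) :
    InHalfPlane A η ↔ (∀ i, 0 ≤ Real.cos (θ i - η)) ∧
      (0 < p → Real.sin (θ₀ - η) = 0 ∧ 0 ≤ Real.cos (θ₀ - η)) := by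
  have hform : InHalfPlane A η ↔ ∀ y, 0 ≤ (Complex.exp (-(Complex.I * η)) *
      (star y ⬝ᵥ (sectorialCore z p θ θ₀ *ᵥ y))).re := by
    constructor
    · intro h y
      have hsurj : ∃ x, (T *ᵥ x) ∘ e = y := by
        refine ⟨T⁻¹ *ᵥ (y ∘ e.symm), ?_⟩
        rw [mulVec_mulVec, mul_nonsing_inv _ ((isUnit_iff_isUnit_det T).1 hT), one_mulVec]
        ext i; simp
      obtain ⟨x, rfl⟩ := hsurj
      have h1 := h x
      rwa [hA, star_dotProduct_conj_reindex_mulVec] at h1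
    · intro h x
      rw [hA, star_dotProduct_conj_reindex_mulVec]
      exact h _
  rw [hform]
  have hre : ∀ y, (Complex.exp (-(Complex.I * η)) *
      (star y ⬝ᵥ (sectorialCore z p θ θ₀ *ᵥ y))).re =
      ∑ i, Real.cos (θ i - η) * Complex.normSq (y (.inr (.inl i))) +
      ∑ l, (Real.cos (θ₀ - η) *
          Complex.normSq (y (.inr (.inr (0, l))) + y (.inr (.inr (1, l)))) -
        Real.sin (θ₀ - η) *
          (2 * (star (y (.inr (.inr (0, l)))) * y (.inr (.inr (1, l)))).im)) := by
    intro y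
    rw [star_dotProduct_sectorialCore_mulVec, mul_add, Complex.add_re, Finset.mul_sum,
      Finset.mul_sum, Complex.re_sum, Complex.re_sum]
    congr 1
    · refine Finset.sum_congr rfl fun i _ => ?_
      rw [← mul_assoc, Complex.re_mul_ofReal, exp_neg_mul_exp_re]
    · refine Finset.sum_congr rfl fun l _ => ?_
      rw [← mul_assoc, Complex.mul_re, exp_neg_mul_exp_re, exp_neg_mul_exp_im]
      simp only [Complex.normSq_apply, Complex.star_def, Complex.add_re, Complex.add_im,
        Complex.mul_re, Complex.mul_im, Complex.conj_re, Complex.conj_im, Complex.re_ofNat,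
        Complex.im_ofNat]
      ring
  simp only [hre]
  constructor
  · intro h
    refine ⟨fun i => ?_, fun hp => ?_⟩
    · have h1 := h (Pi.single (.inr (.inl i)) 1)
      rw [Finset.sum_eq_single i (fun j _ hj => by simp [hj]) (by simp)] at h1
      simpa using h1
    · have h1 : ∀ t : ℝ, 0 ≤ Real.cos (θ₀ - η) * t ^ 2 - Real.sin (θ₀ - η) * (2 * t) := by
        intro t
        -- On the vector `(1, -1 + jt)` the form of a block is `cos · t² - 2 sin · t`. Nonnegativity
        -- for all real `t` forces the linear coefficient to vanish, as the minimizer `t = sin /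
        -- cos` shows.
        have h2 := h (Pi.single (.inr (.inr (0, ⟨0, hp⟩))) 1 +
          Pi.single (.inr (.inr (1, ⟨0, hp⟩))) (-1 + t * Complex.I))
        rw [Finset.sum_eq_zero (fun j _ => by simp), Finset.sum_eq_single ⟨0, hp⟩
          (fun j _ hj => by simp [hj]) (by simp)] at h2
        simpa [Complex.normSq_apply, pow_two] using h2
      have h2 := h1 1
      have h3 := h1 (-1)
      have hsin : Real.sin (θ₀ - η) = 0 := by
        by_contra hne
        rcases eq_or_ne (Real.cos (θ₀ - η)) 0 with h0 | h0
        · rw [h0] at h2 h3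
          exact hne (by linarith)
        · have h4 := h1 (Real.sin (θ₀ - η) / Real.cos (θ₀ - η))
          have hc : 0 < Real.cos (θ₀ - η) := lt_of_le_of_ne (by linarith) (Ne.symm h0)
          have h5 : Real.cos (θ₀ - η) * (Real.sin (θ₀ - η) / Real.cos (θ₀ - η)) ^ 2 -
              Real.sin (θ₀ - η) * (2 * (Real.sin (θ₀ - η) / Real.cos (θ₀ - η))) =
              -(Real.sin (θ₀ - η) ^ 2 / Real.cos (θ₀ - η)) := by
            field_simp; ring
          rw [h5] at h4
          have h6 : 0 < Real.sin (θ₀ - η) ^ 2 / Real.cos (θ₀ - η) := by positivity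
          linarith
      exact ⟨hsin, by linarith⟩
  · rintro ⟨h1, h2⟩ y
    refine add_nonneg (Finset.sum_nonneg fun i _ => mul_nonneg (h1 i) (Complex.normSq_nonneg _))
      (Finset.sum_nonneg fun l _ => ?_)
    obtain ⟨h3, h4⟩ := h2 (Fin.pos l)
    rw [h3, zero_mul, sub_zero]
    exact mul_nonneg h4 (Complex.normSq_nonneg _)

theorem IsPhaseSector.lo_le_hi {n : ℕ} {A : Matrix (Fin n) (Fin n) ℂ} {lo hi : ℝ}
    (h : IsPhaseSector A lo hi) : lo ≤ hi := by
  obtain ⟨⟨z, d, p, θ, θ₀, e, T, -, -, hlo, hhi⟩, -⟩ := h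
  exact hlo.2 hhi.1

/-- The condition on `η` says that `[lo, hi]` lies in `[η - π/2, η + π/2]`. A block of size two
already fills an arc of length `π`, which leaves only `η = θ₀`. -/
theorem IsPhaseSector.inHalfPlane {n : ℕ} {A : Matrix (Fin n) (Fin n) ℂ} {lo hi : ℝ}
    (h : IsPhaseSector A lo hi) {η : ℝ} (h1 : hi - Real.pi / 2 ≤ η) (h2 : η ≤ lo + Real.pi / 2) :
    InHalfPlane A η := by
  obtain ⟨⟨z, d, p, θ, θ₀, e, T, hT, hA, hlo, hhi⟩, -⟩ := h
  rw [inHalfPlane_iff hT hA]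
  refine ⟨fun i => ?_, fun hp => ?_⟩
  · have h3 := hlo.2 (Or.inl ⟨i, rfl⟩)
    have h4 := hhi.2 (Or.inl ⟨i, rfl⟩)
    exact Real.cos_nonneg_of_mem_Icc ⟨by linarith, by linarith⟩
  · have h3 := hlo.2 (Or.inr ⟨hp, Or.inl rfl⟩)
    have h4 := hhi.2 (Or.inr ⟨hp, Or.inr rfl⟩)
    have h5 : θ₀ - η = 0 := by linarith
    simp [h5]

/-- The extreme phases are directions of the closed cone spanned by the numerical range. For a block
they lie on the boundary of its half-plane, where the cosine is zero. -/
theorem IsPhaseSector.cos_nonneg {n : ℕ} {A : Matrix (Fin n) (Fin n) ℂ} {lo hi : ℝ}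
    (h : IsPhaseSector A lo hi) {η : ℝ} (hη : InHalfPlane A η) :
    0 ≤ Real.cos (lo - η) ∧ 0 ≤ Real.cos (hi - η) := by
  obtain ⟨⟨z, d, p, θ, θ₀, e, T, hT, hA, hlo, hhi⟩, -⟩ := h
  rw [inHalfPlane_iff hT hA] at hη
  have key : ∀ φ ∈ corePhases p θ θ₀, 0 ≤ Real.cos (φ - η) := by
    rintro φ (⟨i, rfl⟩ | ⟨hp, rfl | rfl⟩)
    · exact hη.1 i
    · rw [show θ₀ - Real.pi / 2 - η = (θ₀ - η) - Real.pi / 2 by ring, Real.cos_sub_pi_div_two,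
        (hη.2 hp).1]
    · rw [show θ₀ + Real.pi / 2 - η = (θ₀ - η) + Real.pi / 2 by ring, Real.cos_add_pi_div_two,
        (hη.2 hp).1, neg_zero]
  exact ⟨key _ hlo.1, key _ hhi.1⟩

theorem sin_pos_of_mem_Ioo_neg {x : ℝ} (h1 : -(2 * Real.pi) < x) (h2 : x < -Real.pi) :
    0 < Real.sin x := by
  rw [← Real.sin_add_two_pi]
  exact Real.sin_pos_of_pos_of_lt_pi (by linarith) (by linarith)

theorem sin_neg_of_mem_Ioo {x : ℝ} (h1 : Real.pi < x) (h2 : x < 2 * Real.pi) : Real.sin x < 0 := by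
  rw [← Real.sin_sub_two_pi]
  exact Real.sin_neg_of_neg_of_neg_pi_lt (by linarith) (by linarith)

/-- The sines place the direction of `θ` in the arc from `α` to `β`; the ranges of the three angles
exclude another turn. -/
theorem mem_Icc_of_sin {θ α β : ℝ} (hθ : θ ∈ Set.Ioc (-Real.pi) Real.pi)
    (hα : α ∈ Set.Ioo (-Real.pi) Real.pi) (hβ : β ∈ Set.Ioo (-Real.pi) Real.pi)
    (hαβ : β - α ∈ Set.Ioc 0 Real.pi) (h1 : 0 ≤ Real.sin (θ - α)) (h2 : Real.sin (θ - β) ≤ 0) :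
    θ ∈ Set.Icc α β := by
  obtain ⟨hθ1, hθ2⟩ := hθ
  obtain ⟨hα1, hα2⟩ := hα
  obtain ⟨hβ1, hβ2⟩ := hβ
  obtain ⟨hd1, hd2⟩ := hαβ
  constructor
  · by_contra! h
    have h3 : θ - α ≤ -Real.pi := by
      by_contra! h4
      exact absurd h1 (not_le.2 (Real.sin_neg_of_neg_of_neg_pi_lt (by linarith) h4))
    exact absurd h2 (not_le.2 (sin_pos_of_mem_Ioo_neg (by linarith) (by linarith)))
  · by_contra! h
    have h3 : Real.pi ≤ θ - β := by
      by_contra! h4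
      exact absurd h2 (not_le.2 (Real.sin_pos_of_pos_of_lt_pi (by linarith) h4))
    exact absurd h1 (not_le.2 (sin_neg_of_mem_Ioo (by linarith) (by linarith)))

/-- A sector `[lo, hi]`, normalized by its center, whose end directions lie in the cone of arguments
`[α, β]`, is contained in `[α, β]`, or else both are half-planes and `lo` is off by `π`. -/
theorem sector_subset_or {lo hi α β : ℝ} (hle : lo ≤ hi) (hpi : hi - lo ≤ Real.pi)
    (hc : (lo + hi) / 2 ∈ Set.Ioc (-Real.pi) Real.pi)
    (hα : α ∈ Set.Ioo (-Real.pi) Real.pi) (hβ : β ∈ Set.Ioo (-Real.pi) Real.pi)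
    (hαβ : β - α ∈ Set.Ioc 0 Real.pi)
    (h1 : 0 ≤ Real.sin (lo - α)) (h2 : 0 ≤ Real.sin (hi - α))
    (h3 : Real.sin (lo - β) ≤ 0) (h4 : Real.sin (hi - β) ≤ 0) :
    (α ≤ lo ∧ hi ≤ β) ∨
      (β = α + Real.pi ∧ hi = lo + Real.pi ∧ (lo = α + Real.pi ∨ lo = α - Real.pi)) := by
  have hπ := Real.pi_pos
  rcases hpi.lt_or_eq with hlt | heq
  · left
    -- For an opening below `π` the two end conditions add up to a positive multiple of the sine at
    -- the center. So the normalized center lies in `[α, β]`, and the ends, less than `π/2` away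
    -- from it, cannot leave.
    have hcos : 0 < Real.cos ((hi - lo) / 2) :=
      Real.cos_pos_of_mem_Ioo ⟨by linarith, by linarith⟩
    have hsum : ∀ x, Real.sin (lo - x) + Real.sin (hi - x) =
        2 * Real.sin ((lo + hi) / 2 - x) * Real.cos ((hi - lo) / 2) := by
      intro x
      have e1 : lo - x = ((lo + hi) / 2 - x) - (hi - lo) / 2 := by ring
      have e2 : hi - x = ((lo + hi) / 2 - x) + (hi - lo) / 2 := by ring
      rw [e1, e2, Real.sin_sub, Real.sin_add]; ring
    have h5 : 0 ≤ Real.sin ((lo + hi) / 2 - α) := by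
      have := hsum α
      by_contra! hneg
      nlinarith [mul_pos (neg_pos.2 hneg) hcos]
    have h6 : Real.sin ((lo + hi) / 2 - β) ≤ 0 := by
      have := hsum β
      by_contra! hneg
      nlinarith [mul_pos hneg hcos]
    obtain ⟨h7, h8⟩ := mem_Icc_of_sin hc hα hβ hαβ h5 h6
    constructor
    · by_contra! h
      exact absurd h1 (not_le.2 (Real.sin_neg_of_neg_of_neg_pi_lt (by linarith) (by linarith)))
    · by_contra! h
      exact absurd h4 (not_le.2 (Real.sin_pos_of_pos_of_lt_pi (by linarith) (by linarith)))
  · have hhi : hi = lo + Real.pi := by linarith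
    have e1 : ∀ x, Real.sin (hi - x) = -Real.sin (lo - x) := fun x => by
      rw [hhi, show lo + Real.pi - x = (lo - x) + Real.pi by ring, Real.sin_add_pi]
    rw [e1] at h2 h4
    -- For opening `π` the sines at the two ends are opposite, hence zero: `lo - α = aπ` and `lo - β
    -- = bπ`. Then `(a - b)π = β - α` gives `a - b = 1`, and the normalization leaves `a` in `{-1,
    -- 0, 1}`.
    obtain ⟨a, ha⟩ := Real.sin_eq_zero_iff.1 (le_antisymm (by linarith) h1)
    obtain ⟨b, hb⟩ := Real.sin_eq_zero_iff.1 (le_antisymm h3 (by linarith))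
    obtain ⟨hd1, hd2⟩ := hαβ
    obtain ⟨hc1, hc2⟩ := hc
    obtain ⟨hα1, hα2⟩ := hα
    obtain ⟨hβ1, hβ2⟩ := hβ
    have hab : a - b = 1 := by
      have h5 : ((a - b : ℤ) : ℝ) * Real.pi = β - α := by push_cast; linarith
      have h6 : (0 : ℝ) < ((a - b : ℤ) : ℝ) := by
        by_contra! h7
        nlinarith
      have h7 : ((a - b : ℤ) : ℝ) ≤ 1 := by
        by_contra! h8
        nlinarith
      have h8 : (0 : ℤ) < a - b := by exact_mod_cast h6
      have h9 : a - b ≤ 1 := by exact_mod_cast h7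
      omega
    have hβα : β = α + Real.pi := by
      have h5 : (a : ℝ) - b = 1 := by exact_mod_cast hab
      have h6 : (a : ℝ) * Real.pi - b * Real.pi = Real.pi := by rw [← sub_mul, h5, one_mul]
      linarith
    have ha1 : a < 2 := by
      by_contra! h
      have h5 : (2 : ℝ) ≤ a := by exact_mod_cast h
      nlinarith
    have ha2 : -2 < a := by
      by_contra! h
      have h5 : (a : ℝ) ≤ -2 := by exact_mod_cast h
      nlinarith
    have ha3 : a = -1 ∨ a = 0 ∨ a = 1 := by omega
    rcases ha3 with rfl | rfl | rfl
    · exact Or.inr ⟨hβα, hhi, Or.inr (by push_cast at ha; linarith)⟩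
    · left
      push_cast at ha
      exact ⟨by linarith, by linarith⟩
    · exact Or.inr ⟨hβα, hhi, Or.inl (by push_cast at ha; linarith)⟩

theorem IsPhaseSector.subset_or {n : ℕ} {A : Matrix (Fin n) (Fin n) ℂ} {lo hi α β : ℝ}
    (h : IsPhaseSector A lo hi)
    (hα : α ∈ Set.Ioo (-Real.pi) Real.pi) (hβ : β ∈ Set.Ioo (-Real.pi) Real.pi)
    (hαβ : β - α ∈ Set.Ioc 0 Real.pi) (h1 : InHalfPlane A (α + Real.pi / 2))
    (h2 : InHalfPlane A (β - Real.pi / 2)) :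
    (α ≤ lo ∧ hi ≤ β) ∨
      (β = α + Real.pi ∧ hi = lo + Real.pi ∧ (lo = α + Real.pi ∨ lo = α - Real.pi)) := by
  have e1 : ∀ x, Real.cos (x - (α + Real.pi / 2)) = Real.sin (x - α) := fun x => by
    rw [← sub_sub, Real.cos_sub_pi_div_two]
  have e2 : ∀ x, Real.cos (x - (β - Real.pi / 2)) = -Real.sin (x - β) := fun x => by
    rw [← sub_add, Real.cos_add_pi_div_two]
  obtain ⟨h3, h4⟩ := h.cos_nonneg h1
  obtain ⟨h5, h6⟩ := h.cos_nonneg h2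
  rw [e1] at h3 h4
  rw [e2] at h5 h6
  exact sector_subset_or h.lo_le_hi h.2.1 h.2.2 hα hβ hαβ h3 h4 (by linarith) (by linarith)

/-- If the half-plane `[lo, lo + π]` is a phase sector of `A`, and the numerical range lies in the
opposite half-plane too, then the latter is also a phase sector. -/
theorem IsPhaseSector.opposite {n : ℕ} {A : Matrix (Fin n) (Fin n) ℂ} {lo α : ℝ}
    (h : IsPhaseSector A lo (lo + Real.pi)) (hlo : lo = α + Real.pi ∨ lo = α - Real.pi)
    (hA : InHalfPlane A (α + Real.pi / 2))
    (hc : α + Real.pi / 2 ∈ Set.Ioc (-Real.pi) Real.pi) : IsPhaseSector A α (α + Real.pi) := by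
  have hπ := Real.pi_pos
  have hA' := h.inHalfPlane (η := lo + Real.pi / 2) (by linarith) le_rfl
  obtain ⟨⟨z, d, p, θ, θ₀, e, T, hT, hdec, hleast, hgreatest⟩, -⟩ := h
  have hcos : ∀ x, Real.cos (x - (lo + Real.pi / 2)) = -Real.cos (x - (α + Real.pi / 2)) := by
    intro x
    rcases hlo with rfl | rfl
    · rw [show x - (α + Real.pi + Real.pi / 2) = (x - (α + Real.pi / 2)) - Real.pi by ring,
        Real.cos_sub_pi]
    · rw [show x - (α - Real.pi + Real.pi / 2) = (x - (α + Real.pi / 2)) + Real.pi by ring,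
        Real.cos_add_pi]
  rw [inHalfPlane_iff hT hdec] at hA hA'
  obtain rfl : p = 0 := by
    by_contra hp
    obtain ⟨h1, h2⟩ := hA.2 (Nat.pos_of_ne_zero hp)
    obtain ⟨-, h4⟩ := hA'.2 (Nat.pos_of_ne_zero hp)
    rw [hcos] at h4
    have h5 := Real.sin_sq_add_cos_sq (θ₀ - (α + Real.pi / 2))
    rw [h1, le_antisymm (by linarith) h2] at h5
    norm_num at h5
  have hph : corePhases 0 θ θ₀ = Set.range θ := by simp [corePhases]
  rw [hph] at hleast hgreatest
  have hdich : ∀ i, θ i = lo ∨ θ i = lo + Real.pi := by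
    intro i
    have h1 := hA.1 i
    have h2 := hA'.1 i
    have h5 : Real.cos (θ i - (lo + Real.pi / 2)) = 0 := by
      have h3 := hcos (θ i)
      linarith
    rw [← sub_sub, Real.cos_sub_pi_div_two] at h5
    have h6 := hleast.2 ⟨i, rfl⟩
    have h7 := hgreatest.2 ⟨i, rfl⟩
    by_contra! h8
    have h9 := Real.sin_pos_of_pos_of_lt_pi (x := θ i - lo)
      (by linarith [lt_of_le_of_ne h6 h8.1.symm]) (by linarith [lt_of_le_of_ne h7 h8.2])
    exact h9.ne' h5
  classical
  set θ' : Fin d → ℝ := fun i => if θ i = lo then α + Real.pi else α with hθ'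
  have hcase : ∀ i, (θ i = lo ∧ θ' i = α + Real.pi) ∨ (θ i = lo + Real.pi ∧ θ' i = α) := by
    intro i
    rcases hdich i with h1 | h1
    · exact Or.inl ⟨h1, if_pos h1⟩
    · exact Or.inr ⟨h1, if_neg (by rw [h1]; linarith)⟩
  have hexp : ∀ i, Complex.exp (Complex.I * (θ i : ℂ)) = Complex.exp (Complex.I * (θ' i : ℂ)) := by
    have hper : ∀ a b : ℝ, (a = b ∨ a = b + 2 * Real.pi ∨ a = b - 2 * Real.pi) →
        Complex.exp (Complex.I * (a : ℂ)) = Complex.exp (Complex.I * (b : ℂ)) := by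
      rintro a b (rfl | rfl | rfl)
      · rfl
      · rw [← Complex.exp_periodic (Complex.I * (b : ℂ))]
        congr 1; push_cast; ring
      · rw [← Complex.exp_periodic.sub_eq (Complex.I * (b : ℂ))]
        congr 1; push_cast; ring
    intro i
    refine hper _ _ ?_
    rcases hcase i with ⟨h1, h2⟩ | ⟨h1, h2⟩ <;> rcases hlo with h3 | h3 <;> rw [h1, h2, h3]
    · exact Or.inl rfl
    · exact Or.inr (Or.inr (by ring))
    · exact Or.inr (Or.inl (by ring))
    · exact Or.inl (by ring)
  have hcore : sectorialCore z 0 θ θ₀ = sectorialCore z 0 θ' θ₀ := by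
    simp only [sectorialCore, hexp]
  obtain ⟨i₁, hi₁⟩ := hleast.1
  obtain ⟨i₂, hi₂⟩ := hgreatest.1
  refine ⟨⟨z, d, 0, θ', θ₀, e, T, hT, by rw [hdec, hcore], ?_, ?_⟩, by linarith, ?_⟩
  · refine ⟨Or.inl ⟨i₂, ?_⟩, ?_⟩
    · rcases hcase i₂ with ⟨h1, -⟩ | ⟨-, h2⟩
      · linarith
      · exact h2
    · rintro φ (⟨i, rfl⟩ | ⟨hp, -⟩)
      · rcases hcase i with ⟨-, h2⟩ | ⟨-, h2⟩ <;> rw [h2]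
        linarith
      · exact absurd hp (lt_irrefl _)
  · refine ⟨Or.inl ⟨i₁, ?_⟩, ?_⟩
    · rcases hcase i₁ with ⟨-, h2⟩ | ⟨h1, -⟩
      · exact h2
      · linarith
    · rintro φ (⟨i, rfl⟩ | ⟨hp, -⟩)
      · rcases hcase i with ⟨-, h2⟩ | ⟨-, h2⟩ <;> rw [h2]
        linarith
      · exact absurd hp (lt_irrefl _)
  · convert hc using 1
    ring

/-! ### Complex conjugation -/

theorem InHalfPlane.of_map_star {n : ℕ} {A : Matrix (Fin n) (Fin n) ℂ} {η : ℝ}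
    (h : InHalfPlane (A.map star) η) : InHalfPlane A (-η) := by
  intro x
  have h1 := h (star x)
  have h2 : star (star x) ⬝ᵥ (A.map star *ᵥ star x) = star (star x ⬝ᵥ (A *ᵥ x)) := by
    simp [dotProduct, mulVec, Finset.mul_sum]
  have h3 : Complex.exp (-(Complex.I * η)) =
      star (Complex.exp (-(Complex.I * ((-η : ℝ) : ℂ)))) := by
    rw [Complex.star_def, ← Complex.exp_conj]
    congr 1
    simp
  rw [h2, h3, ← star_mul', Complex.star_def, Complex.conj_re] at h1
  exact h1

theorem map_star_map_star {n : ℕ} (A : Matrix (Fin n) (Fin n) ℂ) : (A.map star).map star = A := by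
  ext i j; simp

/-- The centers of phase sectors of a matrix and of its complex conjugate are opposite
modulo `π`. -/
theorem IsPhaseSector.center_add_center {n : ℕ} {A : Matrix (Fin n) (Fin n) ℂ} {lo hi lo' hi' : ℝ}
    (h : IsPhaseSector A lo hi) (h' : IsPhaseSector (A.map star) lo' hi') :
    ∃ k : ℤ, (lo + hi) / 2 + (lo' + hi') / 2 = k * Real.pi := by
  have hπ := Real.pi_pos
  have hA : ∀ η', hi' - Real.pi / 2 ≤ η' → η' ≤ lo' + Real.pi / 2 →
      0 ≤ Real.cos (lo + η') ∧ 0 ≤ Real.cos (hi + η') := by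
    intro η' h1 h2
    have h3 := h.cos_nonneg (h'.inHalfPlane h1 h2).of_map_star
    rwa [sub_neg_eq_add, sub_neg_eq_add] at h3
  have hA' : ∀ η, hi - Real.pi / 2 ≤ η → η ≤ lo + Real.pi / 2 →
      0 ≤ Real.cos (lo' + η) ∧ 0 ≤ Real.cos (hi' + η) := by
    intro η h1 h2
    have h3 : InHalfPlane ((A.map star).map star) η := by
      rw [map_star_map_star]; exact h.inHalfPlane h1 h2
    have h4 := h'.cos_nonneg h3.of_map_star
    rwa [sub_neg_eq_add, sub_neg_eq_add] at h4
  have hle := h.lo_le_hi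
  have hle' := h'.lo_le_hi
  have hpi := h.2.1
  have hpi' := h'.2.1
  have ecos : ∀ x y, Real.cos (x + (y - Real.pi / 2)) = Real.sin (x + y) := fun x y => by
    rw [← add_sub_assoc, Real.cos_sub_pi_div_two]
  have ecos' : ∀ x y, Real.cos (x + (y + Real.pi / 2)) = -Real.sin (x + y) := fun x y => by
    rw [← add_assoc, Real.cos_add_pi_div_two]
  have h1 := (hA (hi' - Real.pi / 2) le_rfl (by linarith)).1
  have h2 := (hA (lo' + Real.pi / 2) (by linarith) le_rfl).2
  have h3 := (hA' (hi - Real.pi / 2) le_rfl (by linarith)).1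
  have h4 := (hA' (lo + Real.pi / 2) (by linarith) le_rfl).2
  rw [ecos] at h1 h3
  rw [ecos'] at h2 h4
  rw [add_comm lo' hi] at h3
  rw [add_comm hi' lo] at h4
  obtain ⟨a, ha⟩ := Real.sin_eq_zero_iff.1 (le_antisymm (by linarith) h1)
  obtain ⟨b, hb⟩ := Real.sin_eq_zero_iff.1 (le_antisymm (by linarith) h3)
  have h5 := hA ((lo' + hi') / 2) (by linarith) (by linarith)
  have h6 := hA' ((lo + hi) / 2) (by linarith) (by linarith)
  have hab1 : b - a ≤ 1 := by
    by_contra! h7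
    have h8 : (2 : ℝ) ≤ (b : ℝ) - a := by exact_mod_cast h7
    nlinarith
  have hab2 : -1 ≤ b - a := by
    by_contra! h7
    have h9 : b - a ≤ -2 := by omega
    have h8 : (b : ℝ) - a ≤ -2 := by exact_mod_cast h9
    nlinarith
  have hab : b - a = 0 ∨ b - a = 1 ∨ b - a = -1 := by omega
  rcases hab with h7 | h7 | h7
  · have h8 : b = a := by omega
    rw [h8] at hb
    exact ⟨a, by linarith⟩
  · have h8 : (b : ℝ) = a + 1 := by exact_mod_cast (by omega : b = a + 1)
    rw [h8] at hb
    have h9 : hi = lo + Real.pi := by linarith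
    have h10 : hi' = lo' := by linarith
    have h11 : Real.sin ((lo + hi) / 2 + (lo' + hi') / 2) = 0 := by
      obtain ⟨h12, h13⟩ := h5
      rw [show lo + (lo' + hi') / 2 = ((lo + hi) / 2 + (lo' + hi') / 2) - Real.pi / 2 by linarith,
        Real.cos_sub_pi_div_two] at h12
      rw [show hi + (lo' + hi') / 2 = ((lo + hi) / 2 + (lo' + hi') / 2) + Real.pi / 2 by linarith,
        Real.cos_add_pi_div_two] at h13
      linarith
    obtain ⟨k, hk⟩ := Real.sin_eq_zero_iff.1 h11
    exact ⟨k, hk.symm⟩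
  · have h8 : (b : ℝ) = a - 1 := by exact_mod_cast (by omega : b = a - 1)
    rw [h8] at hb
    have h9 : hi' = lo' + Real.pi := by linarith
    have h10 : hi = lo := by linarith
    have h11 : Real.sin ((lo + hi) / 2 + (lo' + hi') / 2) = 0 := by
      obtain ⟨h12, h13⟩ := h6
      rw [show lo' + (lo + hi) / 2 = ((lo + hi) / 2 + (lo' + hi') / 2) - Real.pi / 2 by linarith,
        Real.cos_sub_pi_div_two] at h12
      rw [show hi' + (lo + hi) / 2 = ((lo + hi) / 2 + (lo' + hi') / 2) + Real.pi / 2 by linarith,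
        Real.cos_add_pi_div_two] at h13
      linarith
    obtain ⟨k, hk⟩ := Real.sin_eq_zero_iff.1 h11
    exact ⟨k, hk.symm⟩

/-! ### Zeros and poles -/

theorem exists_mul_mul_eq_one {K : Type*} [Field K] {a b : Type*} [Fintype a] [Fintype b]
    [DecidableEq a] [DecidableEq b] (G : Matrix a b K) :
    ∃ (V : Matrix (Fin G.rank) a K) (U : Matrix b (Fin G.rank) K), V * G * U = 1 := by
  set β := Module.finBasis K (LinearMap.range G.mulVecLin)
  choose u hu using fun j => (β j).2
  set U : Matrix b (Fin G.rank) K := of fun i j => u j i with hU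
  have hinj : Function.Injective (toLin' (G * U)) := by
    rw [← LinearMap.ker_eq_bot, LinearMap.ker_eq_bot']
    intro c hc
    have h1 : (G * U) *ᵥ c = ∑ j, c j • ((β j : LinearMap.range G.mulVecLin) : a → K) := by
      rw [← mulVec_mulVec]
      have h2 : U *ᵥ c = ∑ j, c j • u j := by
        ext i
        simp [hU, mulVec, dotProduct, mul_comm]
      rw [h2, mulVec_sum]
      refine Finset.sum_congr rfl fun j _ => ?_
      rw [mulVec_smul, ← hu j, mulVecLin_apply]
    rw [toLin'_apply, h1] at hc
    have h3 : ∑ j, c j • β j = 0 := Subtype.ext (by simpa using hc)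
    ext j
    exact Fintype.linearIndependent_iff.1 β.linearIndependent c h3 j
  obtain ⟨f, hf⟩ := LinearMap.exists_leftInverse_of_injective _ (LinearMap.ker_eq_bot.2 hinj)
  refine ⟨LinearMap.toMatrix' f, U, ?_⟩
  rw [Matrix.mul_assoc]
  apply toLin'.injective
  rw [toLin'_mul, toLin'_toMatrix', hf, toLin'_one]

theorem finite_isPole {m : ℕ} (G : Matrix (Fin m) (Fin m) (RatFunc ℝ)) :
    {s | IsPole G s}.Finite := by
  refine (finite_not_regularAt_matrix G).subset fun s hs => ?_
  rw [Set.mem_ofPred_eq, ← not_isPole_iff, not_not]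
  exact hs

theorem finite_isZero {m : ℕ} (G : Matrix (Fin m) (Fin m) (RatFunc ℝ)) :
    {s | IsZero G s}.Finite := by
  obtain ⟨V, U, hVU⟩ := exists_mul_mul_eq_one G
  refine ((finite_not_regularAt_matrix V).union (finite_not_regularAt_matrix U)).subset
    fun s hs => ?_
  by_contra hcon
  simp only [Set.mem_union, Set.mem_ofPred_eq, not_or, not_not] at hcon
  have hG := not_isPole_iff.1 hs.1
  have h1 : evalMatrix V s * evalAt G s * evalMatrix U s = 1 := by
    have h2 := evalMatrix_mul (regularAt_mul_apply hcon.1 hG) hcon.2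
    rw [hVU, evalMatrix_one, evalMatrix_mul hcon.1 hG] at h2
    exact h2.symm
  have h3 := (rank_mul_le_left (evalMatrix V s * evalAt G s) (evalMatrix U s)).trans
    (rank_mul_le_right (evalMatrix V s) (evalAt G s))
  rw [h1, rank_one, Fintype.card_fin] at h3
  exact absurd hs.2 (not_lt.2 h3)

theorem finite_critFreq {m : ℕ} (G : Matrix (Fin m) (Fin m) (RatFunc ℝ)) (a b : ℝ) :
    (critFreq G a b).Finite :=
  (finite_frequencies ((finite_isPole G).union (finite_isZero G))).subset fun _ h => h.2

theorem eval_conj (f : RatFunc ℝ) (s : ℂ) :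
    RatFunc.eval (algebraMap ℝ ℂ) (star s) f = star (RatFunc.eval (algebraMap ℝ ℂ) s f) := by
  have h := fun p : Polynomial ℝ => Polynomial.aeval_conj p s
  simp only [Polynomial.aeval_def] at h
  rw [RatFunc.eval, RatFunc.eval, Complex.star_def, map_div₀]
  congr 1
  · exact h _
  · exact h _

theorem evalAt_star {m : ℕ} (G : Matrix (Fin m) (Fin m) (RatFunc ℝ)) (s : ℂ) :
    evalAt G (star s) = (evalAt G s).map star := by
  ext i j
  exact eval_conj (G i j) s

theorem isPole_star {m : ℕ} {G : Matrix (Fin m) (Fin m) (RatFunc ℝ)} {s : ℂ} :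
    IsPole G (star s) ↔ IsPole G s := by
  have h : ∀ p : Polynomial ℝ, Polynomial.aeval (star s) p = star (Polynomial.aeval s p) :=
    fun p => Polynomial.aeval_conj p s
  simp only [IsPole, h, star_eq_zero]

theorem isZero_star {m : ℕ} {G : Matrix (Fin m) (Fin m) (RatFunc ℝ)} {s : ℂ} :
    IsZero G (star s) ↔ IsZero G s := by
  have h : ((evalAt G s).map star).rank = (evalAt G s).rank := by
    rw [← rank_conjTranspose (evalAt G s), ← rank_transpose ((evalAt G s).map star)]
    rfl
  rw [IsZero, IsZero, isPole_star, evalAt_star, h]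

theorem star_ofReal_mul_I (ω : ℝ) : star ((ω : ℂ) * Complex.I) = ((-ω : ℝ) : ℂ) * Complex.I := by
  simp

theorem neg_mem_critFreq {m : ℕ} {G : Matrix (Fin m) (Fin m) (RatFunc ℝ)} {a ω : ℝ}
    (h : ω ∈ critFreq G (-a) a) : -ω ∈ critFreq G (-a) a := by
  refine ⟨⟨by linarith [h.1.2], by linarith [h.1.1]⟩, ?_⟩
  rw [← star_ofReal_mul_I, isPole_star, isZero_star]
  exact h.2

/-! ### Rational matrices whose values on the imaginary axis are Hermitian up to rotation -/

theorem add_conjTranspose_eq_zero {n : ℕ} {A : Matrix (Fin n) (Fin n) ℂ} {η : ℝ}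
    (h : ∀ x : Fin n → ℂ, (Complex.exp (-(Complex.I * η)) * (star x ⬝ᵥ (A *ᵥ x))).re = 0) :
    Complex.exp (-(Complex.I * η)) • A + Complex.exp (Complex.I * η) • Aᴴ = 0 := by
  set c := Complex.exp (-(Complex.I * η)) with hc
  have hcs : Complex.exp (Complex.I * η) = star c := by
    rw [hc, Complex.star_def, ← Complex.exp_conj]
    congr 1
    simp
  rw [hcs]
  set S := c • A + star c • Aᴴ with hS
  have hSH : S.IsHermitian := by
    rw [IsHermitian, hS, conjTranspose_add, conjTranspose_smul, conjTranspose_smul,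
      conjTranspose_conjTranspose, star_star, add_comm]
  have hq : ∀ x, star x ⬝ᵥ (S *ᵥ x) = 0 := by
    intro x
    have h1 : star x ⬝ᵥ (Aᴴ *ᵥ x) = star (star x ⬝ᵥ (A *ᵥ x)) := by
      rw [star_dotProduct, star_mulVec, conjTranspose_conjTranspose, ← dotProduct_mulVec]
    rw [hS, add_mulVec, smul_mulVec, smul_mulVec, dotProduct_add, dotProduct_smul, dotProduct_smul,
      h1, smul_eq_mul, smul_eq_mul, ← star_mul', Complex.star_def, Complex.add_conj, h x]
    simp
  have hpsd : S.PosSemidef := .of_dotProduct_mulVec_nonneg hSH fun x => (hq x).ge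
  refine ext_of_mulVec_single fun i => ?_
  rw [zero_mulVec]
  exact (hpsd.dotProduct_mulVec_zero_iff _).1 (hq _)

theorem sin_two_mul_eq_zero_of_infinite {m : ℕ} {G : Matrix (Fin m) (Fin m) (RatFunc ℝ)} {η : ℝ}
    {W : Set ℝ} (hW : W.Infinite) (hp : ∀ ω ∈ W, ¬ IsPole G (ω * Complex.I))
    (h : ∀ ω ∈ W, ∀ x : Fin m → ℂ, (Complex.exp (-(Complex.I * η)) *
      (star x ⬝ᵥ (evalAt G (ω * Complex.I) *ᵥ x))).re = 0) (hG : G ≠ 0) :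
    Real.sin (2 * η) = 0 := by
  by_contra hsin
  refine hG ?_
  ext i j
  set p := (G i j).num
  set q := (G i j).denom
  set u := (G j i).num
  set v := (G j i).denom
  set f : Polynomial ℝ →+* Polynomial ℂ := Polynomial.mapRingHom (algebraMap ℝ ℂ)
  have hP : Polynomial.C (Complex.exp (-(Complex.I * η))) * f p * (f v).comp (-Polynomial.X) +
      Polynomial.C (Complex.exp (Complex.I * η)) * (f u).comp (-Polynomial.X) * f q = 0 := by
    refine Polynomial.eq_zero_of_infinite_isRoot _ ?_
    refine (hW.image (f := fun ω : ℝ => (ω : ℂ) * Complex.I)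
      (fun x _ y _ h => by simpa using h)).mono ?_
    rintro _ ⟨ω, hω, rfl⟩
    have h1 := congrFun (congrFun (add_conjTranspose_eq_zero (h ω hω)) i) j
    have h2 : (evalAt G (ω * Complex.I))ᴴ i j =
        RatFunc.eval (algebraMap ℝ ℂ) (-(ω * Complex.I)) (G j i) := by
      rw [conjTranspose_apply, evalAt, map_apply, ← eval_conj]
      congr 1
      simp
    rw [Matrix.add_apply, Matrix.smul_apply, Matrix.smul_apply, h2, evalAt, map_apply, RatFunc.eval,
      RatFunc.eval, Matrix.zero_apply, smul_eq_mul, smul_eq_mul] at h1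
    have hreg := not_isPole_iff.1 (hp ω hω)
    have hq0 : Polynomial.eval₂ (algebraMap ℝ ℂ) (ω * Complex.I) q ≠ 0 := hreg i j
    have hv0 : Polynomial.eval₂ (algebraMap ℝ ℂ) (-(ω * Complex.I)) v ≠ 0 := by
      have h3 : ¬ IsPole G (star ((ω : ℂ) * Complex.I)) := by
        rw [isPole_star]; exact hp ω hω
      have h4 := not_isPole_iff.1 h3 j i
      have h5 : star ((ω : ℂ) * Complex.I) = -(ω * Complex.I) := by simp
      rw [h5] at h4
      exact h4
    rw [Set.mem_ofPred_eq, Polynomial.IsRoot.def]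
    simp only [Polynomial.eval_add, Polynomial.eval_mul, Polynomial.eval_C, Polynomial.eval_comp,
      Polynomial.eval_neg, Polynomial.eval_X, f, Polynomial.coe_mapRingHom, Polynomial.eval_map]
    change Complex.exp (-(Complex.I * η)) * (Polynomial.eval₂ (algebraMap ℝ ℂ) (ω * Complex.I) p /
      Polynomial.eval₂ (algebraMap ℝ ℂ) (ω * Complex.I) q) + Complex.exp (Complex.I * η) *
      (Polynomial.eval₂ (algebraMap ℝ ℂ) (-(ω * Complex.I)) u /
        Polynomial.eval₂ (algebraMap ℝ ℂ) (-(ω * Complex.I)) v) = 0 at h1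
    generalize Polynomial.eval₂ (algebraMap ℝ ℂ) (ω * Complex.I) p = p' at h1 ⊢
    generalize Polynomial.eval₂ (algebraMap ℝ ℂ) (ω * Complex.I) q = q' at h1 hq0 ⊢
    generalize Polynomial.eval₂ (algebraMap ℝ ℂ) (-(ω * Complex.I)) u = u' at h1 ⊢
    generalize Polynomial.eval₂ (algebraMap ℝ ℂ) (-(ω * Complex.I)) v = v' at h1 hv0 ⊢
    generalize Complex.exp (-(Complex.I * η)) = a at h1 ⊢
    generalize Complex.exp (Complex.I * η) = b at h1 ⊢
    field_simp at h1
    linear_combination h1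
  have hreal : ∀ x : ℝ, (p * v.comp (-Polynomial.X)).eval x = 0 := by
    intro x
    have h1 := congrArg (Polynomial.eval (x : ℂ)) hP
    have hev : ∀ (g : Polynomial ℝ) (y : ℝ), Polynomial.eval₂ (algebraMap ℝ ℂ) (y : ℂ) g =
        ((g.eval y : ℝ) : ℂ) := fun g y =>
      Polynomial.eval₂_at_apply (algebraMap ℝ ℂ) y
    simp only [Polynomial.eval_add, Polynomial.eval_mul, Polynomial.eval_C, Polynomial.eval_comp,
      Polynomial.eval_neg, Polynomial.eval_X, f, Polynomial.coe_mapRingHom, Polynomial.eval_map,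
      Polynomial.eval_zero, ← Complex.ofReal_neg, hev] at h1 ⊢
    set a := p.eval x
    set b := v.eval (-x)
    set c := u.eval (-x)
    set d := q.eval x
    have h2 : ((a * b : ℝ) : ℂ) * Complex.exp (((-(2 * η) : ℝ) : ℂ) * Complex.I) +
        ((c * d : ℝ) : ℂ) = 0 := by
      have h3 : Complex.exp (((-(2 * η) : ℝ) : ℂ) * Complex.I) =
          Complex.exp (-(Complex.I * η)) * Complex.exp (-(Complex.I * η)) := by
        rw [← Complex.exp_add]; congr 1; push_cast; ring
      have h4 : Complex.exp (Complex.I * η) * Complex.exp (-(Complex.I * η)) = 1 := by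
        rw [← Complex.exp_add, add_neg_cancel, Complex.exp_zero]
      rw [h3]
      push_cast
      linear_combination Complex.exp (-(Complex.I * η)) * h1 - (c : ℂ) * d * h4
    have h5 := congrArg Complex.im h2
    rw [Complex.add_im, Complex.im_ofReal_mul, Complex.exp_ofReal_mul_I_im, Complex.ofReal_im,
      Real.sin_neg, add_zero, Complex.zero_im, mul_neg, neg_eq_zero] at h5
    exact (mul_eq_zero.1 h5).resolve_right hsin
  have hpv : p * v.comp (-Polynomial.X) = 0 := Polynomial.funext fun x => by
    rw [hreal x, Polynomial.eval_zero]
  have hv : v.comp (-Polynomial.X) ≠ 0 := by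
    intro h0
    have h1 := congrArg (fun g => Polynomial.comp g (-Polynomial.X)) h0
    simp only [Polynomial.comp_assoc, Polynomial.neg_comp, Polynomial.X_comp, neg_neg,
      Polynomial.comp_X, Polynomial.zero_comp] at h1
    exact (G j i).denom_ne_zero h1
  exact RatFunc.num_eq_zero_iff.1 ((mul_eq_zero.1 hpv).resolve_right hv)

/-! ### Indented contours -/

theorem exists_two_mul_le_of_finite {S : Set ℝ} (hS : S.Finite) :
    ∃ δ > (0 : ℝ), ∀ x ∈ S, ∀ y ∈ S, x ≠ y → 2 * δ ≤ |x - y| := by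
  by_cases hnt : S.Nontrivial
  · refine ⟨S.infsep / 2, half_pos (hS.infsep_pos_iff_nontrivial.2 hnt), fun x hx y hy hxy => ?_⟩
    have h := Set.infsep_le_dist_of_mem hx hy hxy
    rw [Real.dist_eq] at h
    linarith
  · exact ⟨1, one_pos, fun x hx y hy hxy => absurd ⟨x, hx, y, hy, hxy⟩ hnt⟩

theorem exists_le_abs_sub_of_finite {S : Set ℝ} (hS : S.Finite) {t : ℝ} (ht : t ∉ S) :
    ∃ δ > (0 : ℝ), ∀ x ∈ S, δ ≤ |t - x| := by
  obtain ⟨δ, hδ, h⟩ := Metric.isOpen_iff.1 hS.isClosed.isOpen_compl t ht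
  refine ⟨δ, hδ, fun x hx => ?_⟩
  by_contra! hlt
  have hx' : x ∈ Metric.ball t δ := by rwa [Metric.mem_ball, Real.dist_eq, abs_sub_comm]
  exact h hx' hx

theorem ofReal_mul_I_notMem_contour {a b ε ω : ℝ} {Ω : Set ℝ} (hε : 0 < ε) (hω : ω ∈ Ω) :
    (ω : ℂ) * Complex.I ∉ contour a b ε Ω := by
  rintro (⟨ω', -, h, he⟩ | ⟨ω₀, -, -, h⟩)
  · obtain rfl : ω = ω' := by simpa using he
    have := h ω hω
    rw [sub_self, abs_zero] at this
    exact absurd hε (not_lt.2 this)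
  · simp at h

theorem star_mem_contour {a ε : ℝ} {Ω : Set ℝ} (hΩ : ∀ ω ∈ Ω, -ω ∈ Ω) {s : ℂ}
    (hs : s ∈ contour (-a) a ε Ω) : star s ∈ contour (-a) a ε Ω := by
  rcases hs with ⟨ω, hω, h, rfl⟩ | ⟨ω₀, hω₀, h, hre⟩
  · refine Or.inl ⟨-ω, ⟨by linarith [hω.2], by linarith [hω.1]⟩, fun ω₀ hω₀ => ?_,
      star_ofReal_mul_I ω⟩
    have h1 := h _ (hΩ ω₀ hω₀)
    rwa [← abs_neg, show -(ω - -ω₀) = -ω - ω₀ by ring] at h1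
  · refine Or.inr ⟨-ω₀, hΩ _ hω₀, ?_, by simpa using hre⟩
    rw [← star_ofReal_mul_I, ← star_sub, norm_star, h]

/-- A parametrization by the imaginary part of the contour indented around the points of `S`. -/
noncomputable def contourPath (ε : ℝ) (S : Finset ℝ) (t : ℝ) : ℂ :=
  ((∑ x ∈ S, √(ε ^ 2 - (t - x) ^ 2) : ℝ) : ℂ) + t * Complex.I

theorem continuous_contourPath (ε : ℝ) (S : Finset ℝ) : Continuous (contourPath ε S) := by
  unfold contourPath
  fun_prop

theorem sqrt_eq_zero_of_le_abs {ε x : ℝ} (hε : 0 < ε) (h : ε ≤ |x|) : √(ε ^ 2 - x ^ 2) = 0 := by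
  refine Real.sqrt_eq_zero_of_nonpos ?_
  have := sq_le_sq' (by linarith) h
  rw [sq_abs] at this
  linarith

theorem contourPath_eq {ε : ℝ} (hε : 0 < ε) {S : Finset ℝ} {t : ℝ} (h : ∀ x ∈ S, ε ≤ |t - x|) :
    contourPath ε S t = t * Complex.I := by
  rw [contourPath, Finset.sum_eq_zero fun x hx => sqrt_eq_zero_of_le_abs hε (h x hx)]
  simp

theorem contourPath_eq_of_mem {ε : ℝ} (hε : 0 < ε) {S : Finset ℝ} {t x : ℝ} (hx : x ∈ S)
    (hxt : |t - x| ≤ ε) (hS : ∀ y ∈ S, y ≠ x → 2 * ε ≤ |y - x|) :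
    contourPath ε S t = (√(ε ^ 2 - (t - x) ^ 2) : ℝ) + t * Complex.I := by
  rw [contourPath, Finset.sum_eq_single x (fun y hy hyx => ?_) fun h => absurd hx h]
  refine sqrt_eq_zero_of_le_abs hε ?_
  have h1 := hS y hy hyx
  have h2 := abs_sub_le y t x
  rw [abs_sub_comm y t] at h2
  linarith

theorem contourPath_mem {a b ε : ℝ} (hε : 0 < ε) {S : Finset ℝ}
    (hS : ∀ x ∈ S, ∀ y ∈ S, x ≠ y → 2 * ε ≤ |x - y|) {t : ℝ} (ht : t ∈ Set.Icc a b) :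
    contourPath ε S t ∈ contour a b ε S := by
  by_cases h : ∀ x ∈ S, ε ≤ |t - x|
  · exact Or.inl ⟨t, ht, h, contourPath_eq hε h⟩
  · push Not at h
    obtain ⟨x, hx, hxt⟩ := h
    have hpos : 0 < ε ^ 2 - (t - x) ^ 2 := by
      have := sq_lt_sq' (by linarith [abs_nonneg (t - x)]) hxt
      rw [sq_abs] at this
      linarith
    refine Or.inr ⟨x, hx, ?_, ?_⟩ <;>
      rw [contourPath_eq_of_mem hε hx hxt.le fun y hy hyx => hS y hy x hx hyx]
    · rw [show ((√(ε ^ 2 - (t - x) ^ 2) : ℝ) : ℂ) + t * Complex.I - x * Complex.I =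
        (√(ε ^ 2 - (t - x) ^ 2) : ℝ) + ((t - x : ℝ) : ℂ) * Complex.I by push_cast; ring,
        Complex.norm_add_mul_I, Real.sq_sqrt hpos.le, sub_add_cancel, Real.sqrt_sq hε.le]
    · simpa using hpos

/-! ### Phase responses -/

theorem eq_zero_of_continuousOn_of_int_mul {X : Type*} [TopologicalSpace X] {S : Set X}
    (hS : IsPreconnected S) {g : X → ℝ} (hg : ContinuousOn g S) {a : ℝ}
    (hk : ∀ x ∈ S, ∃ k : ℤ, g x = k * a) {x₀ x : X} (hx₀ : x₀ ∈ S) (h₀ : g x₀ = 0) (hx : x ∈ S) :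
    g x = 0 := by
  rw [← h₀]
  refine hS.constant_of_mapsTo (T := (AddSubgroup.zmultiples a : Set ℝ))
    (hT := ⟨(inferInstance : DiscreteTopology (AddSubgroup.zmultiples a))⟩)
    hg (fun y hy => ?_) hx hx₀
  obtain ⟨k, hk⟩ := hk y hy
  exact ⟨k, by simp [hk]⟩

theorem exists_small {P Q : ℝ → Prop} (hP : ∃ ε' > (0 : ℝ), ∀ ε ∈ Set.Ioc 0 ε', P ε)
    (hQ : ∃ ε' > (0 : ℝ), ∀ ε ∈ Set.Ioc 0 ε', Q ε) :
    ∃ ε' > (0 : ℝ), ∀ ε ∈ Set.Ioc 0 ε', P ε ∧ Q ε := by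
  obtain ⟨a, ha, hP⟩ := hP
  obtain ⟨b, hb, hQ⟩ := hQ
  exact ⟨min a b, lt_min ha hb, fun ε hε => ⟨hP ε ⟨hε.1, hε.2.trans (min_le_left _ _)⟩,
    hQ ε ⟨hε.1, hε.2.trans (min_le_right _ _)⟩⟩⟩

theorem ne_zero_of_rank_eq {m : ℕ} {A B : Matrix (Fin m) (Fin m) ℂ} (h : A.rank = B.rank)
    (hA : A ≠ 0) : B ≠ 0 := by
  rintro rfl
  rw [rank_zero, Matrix.rank, Submodule.finrank_eq_zero, LinearMap.range_eq_bot] at h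
  refine hA (ext_of_mulVec_single fun i => ?_)
  rw [zero_mulVec, ← mulVecLin_apply, h, LinearMap.zero_apply]

/-- Along the indented contours, the phase center is odd under complex conjugation. -/
theorem IsPhaseResponse.center_star {m : ℕ} {G : Matrix (Fin m) (Fin m) (RatFunc ℝ)} {ωc : ℝ}
    {lo hi : ℂ → ℝ} (hωc : 0 < ωc) (h : IsPhaseResponse G ωc lo hi)
    (hsect : IsFreqSemiSectorial G (-ωc) ωc)
    {ω : ℝ} (hω : ω ∈ Set.Icc (-ωc) ωc) (hω' : ω ∉ critFreq G (-ωc) ωc)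
    (h0 : evalAt G (ω * Complex.I) ≠ 0) :
    (lo (ω * Complex.I) + hi (ω * Complex.I)) / 2 +
      (lo (star (ω * Complex.I)) + hi (star (ω * Complex.I))) / 2 = 0 := by
  have hfin := finite_critFreq G (-ωc) ωc
  obtain ⟨δ₁, hδ₁, hgap⟩ := exists_two_mul_le_of_finite hfin
  obtain ⟨δ₂, hδ₂, hdist⟩ := exists_le_abs_sub_of_finite hfin hω'
  obtain ⟨δ₃, hδ₃, hdist0⟩ := exists_le_abs_sub_of_finite (hfin.sdiff (t := {0})) (t := 0)
    fun h => h.2 rfl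
  obtain ⟨ε', hε', hres⟩ := exists_small h.2 hsect.2
  set ε := min ε' (min δ₁ (min δ₂ δ₃)) with hε
  have hεpos : 0 < ε := lt_min hε' (lt_min hδ₁ (lt_min hδ₂ hδ₃))
  obtain ⟨⟨hsec, hcont, hz, hz'⟩, ⟨r, hr⟩, -⟩ := hres ε ⟨hεpos, min_le_left _ _⟩
  have hle₁ : ε ≤ δ₁ := (min_le_right _ _).trans (min_le_left _ _)
  have hle₂ : ε ≤ δ₂ :=
    (min_le_right _ _).trans ((min_le_right _ _).trans (min_le_left _ _))
  have hle₃ : ε ≤ δ₃ :=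
    (min_le_right _ _).trans ((min_le_right _ _).trans (min_le_right _ _))
  set S := hfin.toFinset
  have hmem : ∀ x, x ∈ S ↔ x ∈ critFreq G (-ωc) ωc := fun x => hfin.mem_toFinset
  have hcoe : (S : Set ℝ) = critFreq G (-ωc) ωc := hfin.coe_toFinset
  have hgapS : ∀ x ∈ S, ∀ y ∈ S, x ≠ y → 2 * ε ≤ |x - y| := fun x hx y hy hxy => by
    have := hgap x ((hmem x).1 hx) y ((hmem y).1 hy) hxy
    linarith
  have hmaps : ∀ t ∈ Set.Icc (-ωc) ωc,
      contourPath ε S t ∈ contour (-ωc) ωc ε (critFreq G (-ωc) ωc) := fun t ht => by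
    rw [← hcoe]
    exact contourPath_mem hεpos hgapS ht
  have hstar : ∀ s ∈ contour (-ωc) ωc ε (critFreq G (-ωc) ωc),
      star s ∈ contour (-ωc) ωc ε (critFreq G (-ωc) ωc) := fun s hs =>
    star_mem_contour (fun _ hx => neg_mem_critFreq hx) hs
  have hωpath : contourPath ε S ω = ω * Complex.I :=
    contourPath_eq hεpos fun x hx => hle₂.trans (hdist x ((hmem x).1 hx))
  have hωmem := hmaps ω hω
  have hne : ∀ s ∈ contour (-ωc) ωc ε (critFreq G (-ωc) ωc), evalAt G s ≠ 0 := fun s hs => by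
    refine ne_zero_of_rank_eq ?_ h0
    rw [← hωpath, hr _ hωmem, hr s hs]
  have h0mem : (0 : ℝ) ∈ Set.Icc (-ωc) ωc := ⟨by linarith, hωc.le⟩
  set c : ℂ → ℝ := fun s => (lo s + hi s) / 2 with hc
  have hkey := eq_zero_of_continuousOn_of_int_mul (a := Real.pi) (isPreconnected_Icc.image _
    (continuous_contourPath ε S).continuousOn) (g := fun s => c s + c (star s))
    (S := contourPath ε S '' Set.Icc (-ωc) ωc) ?_ ?_ (Set.mem_image_of_mem _ h0mem) ?_
    (Set.mem_image_of_mem _ hω)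
  · rwa [hωpath] at hkey
  · have hsub : contourPath ε S '' Set.Icc (-ωc) ωc ⊆
        contour (-ωc) ωc ε (critFreq G (-ωc) ωc) := by
      rintro _ ⟨t, ht, rfl⟩
      exact hmaps t ht
    exact (hcont.mono hsub).add
      (hcont.comp continuous_star.continuousOn fun s hs => hstar s (hsub hs))
  · rintro _ ⟨t, ht, rfl⟩
    have h1 := hmaps t ht
    refine (hsec _ h1 (hne _ h1)).center_add_center ?_
    rw [← evalAt_star]
    exact hsec _ (hstar _ h1) (hne _ (hstar _ h1))
  · by_cases hcrit : (0 : ℝ) ∈ critFreq G (-ωc) ωc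
    · have h1 : contourPath ε S 0 = (ε : ℂ) := by
        rw [contourPath_eq_of_mem hεpos ((hmem 0).2 hcrit) (by simpa using hεpos.le)
          fun y hy hy0 => hgapS y hy 0 ((hmem 0).2 hcrit) hy0]
        simp [Real.sqrt_sq hεpos.le]
      have h2 : star (ε : ℂ) = ε := Complex.conj_ofReal ε
      simp only [h1, h2]
      rw [hc]
      simp only [hz' hcrit, add_zero]
    · have h1 : c 0 = 0 := hz hcrit
      have h2 : contourPath ε S 0 = 0 := by
        rw [contourPath_eq hεpos fun x hx => hle₃.trans (hdist0 x ⟨(hmem x).1 hx, fun hx0 => ?_⟩)]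
        · simp
        · rw [Set.mem_singleton_iff.1 hx0] at hx
          exact hcrit ((hmem 0).1 hx)
      simp only [h2, star_zero, h1, add_zero]

/-- Away from the poles and zeros, a phase response of a system whose numerical ranges lie in the
sector `[α, β]` takes its values in `[α, β]`. -/
theorem IsPhaseResponse.subset_of_notMem_critFreq {m : ℕ} {G : Matrix (Fin m) (Fin m) (RatFunc ℝ)}
    {ωc α β : ℝ} {lo hi : ℂ → ℝ} (hωc : 0 < ωc) (hres : IsPhaseResponse G ωc lo hi)
    (hsect : IsFreqSemiSectorial G (-ωc) ωc)
    (hα : α ∈ Set.Ioo (-Real.pi) Real.pi) (hβ : β ∈ Set.Ioo (-Real.pi) Real.pi)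
    (hαβ : β - α ∈ Set.Ioc 0 Real.pi)
    (hpoles : ∀ ω : ℝ, IsPole G (ω * Complex.I) → |ω| < ωc)
    (h : ∀ ω ∈ Set.Icc 0 ωc, ¬ IsPole G (ω * Complex.I) →
      InHalfPlane (evalAt G (ω * Complex.I)) (α + Real.pi / 2) ∧
      InHalfPlane (evalAt G (ω * Complex.I)) (β - Real.pi / 2))
    {ω : ℝ} (hω : ω ∈ Set.Icc 0 ωc) (hω' : ω ∉ critFreq G (-ωc) ωc)
    (h0 : evalAt G (ω * Complex.I) ≠ 0) :
    α ≤ lo (ω * Complex.I) ∧ hi (ω * Complex.I) ≤ β := by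
  have hπ := Real.pi_pos
  have hnp : ∀ t ∈ Set.Icc 0 ωc, t ∉ critFreq G (-ωc) ωc → ¬ IsPole G (t * Complex.I) :=
    fun t ht htc hp => htc ⟨⟨by linarith [ht.1], (le_abs_self t).trans_lt (hpoles t hp)⟩, .inl hp⟩
  have hIcc : ∀ t ∈ Set.Icc 0 ωc, t ∈ Set.Icc (-ωc) ωc := fun t ht => ⟨by linarith [ht.1], ht.2⟩
  have halt : ∀ t ∈ Set.Icc 0 ωc, t ∉ critFreq G (-ωc) ωc → evalAt G (t * Complex.I) ≠ 0 → _ :=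
    fun t ht htc ht0 => (hres.1 t (hIcc t ht) (hnp t ht htc) ht0).subset_or hα hβ hαβ
      (h t ht (hnp t ht htc)).1 (h t ht (hnp t ht htc)).2
  refine (halt ω hω hω' h0).resolve_right ?_
  rintro ⟨hβα, hhi, hlo⟩
  obtain ⟨δ, hδ, hdist⟩ := exists_le_abs_sub_of_finite (finite_critFreq G (-ωc) ωc) hω'
  obtain ⟨ε', hε', hsmall⟩ := exists_small hres.2 hsect.2
  set ε := min ε' (δ / 2) with hε
  have hεpos : 0 < ε := lt_min hε' (half_pos hδ)
  have hεδ : ε ≤ δ / 2 := min_le_right _ _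
  obtain ⟨⟨-, hcont, -, -⟩, ⟨r, hr⟩, -⟩ := hsmall ε ⟨hεpos, min_le_left _ _⟩
  have hmem : ∀ t ∈ Set.Icc 0 ωc, |t - ω| < ε →
      (t : ℂ) * Complex.I ∈ contour (-ωc) ωc ε (critFreq G (-ωc) ωc) := fun t ht htω =>
    Or.inl ⟨t, hIcc t ht, fun x hx => by
      have h1 := hdist x hx
      have h2 := abs_sub_le ω t x
      rw [abs_sub_comm ω t] at h2
      linarith, rfl⟩
  have hωmem := hmem ω hω (by simpa using hεpos)
  obtain ⟨ρ, hρ, hnear⟩ := Metric.continuousOn_iff.1 hcont _ hωmem (Real.pi / 2) (by positivity)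
  have hbad : ∀ t ∈ Set.Icc 0 ωc, |t - ω| < min ε ρ → ¬ IsPole G (t * Complex.I) ∧
      hi (t * Complex.I) = lo (t * Complex.I) + Real.pi ∧
      (lo (t * Complex.I) = α + Real.pi ∨ lo (t * Complex.I) = α - Real.pi) ∧
      IsPhaseSector (evalAt G (t * Complex.I)) (lo (t * Complex.I)) (hi (t * Complex.I)) := by
    intro t ht htω
    have htmem := hmem t ht (htω.trans_le (min_le_left _ _))
    have htc : t ∉ critFreq G (-ωc) ωc :=
      fun hc => ofReal_mul_I_notMem_contour hεpos hc htmem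
    have ht0 : evalAt G (t * Complex.I) ≠ 0 :=
      ne_zero_of_rank_eq ((hr _ hωmem).trans (hr _ htmem).symm) h0
    have hsec := hres.1 t (hIcc t ht) (hnp t ht htc) ht0
    have hd := hnear _ htmem (by
      rw [Complex.dist_eq, ← sub_mul, norm_mul, Complex.norm_I, mul_one, ← Complex.ofReal_sub,
        Complex.norm_real]
      exact htω.trans_le (min_le_right _ _))
    rw [Real.dist_eq, abs_lt] at hd
    rcases halt t ht htc ht0 with ⟨h1, h2⟩ | ⟨-, h2⟩
    · exfalso
      have h3 := hsec.lo_le_hi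
      rcases hlo with h4 | h4 <;> linarith [hd.1, hd.2]
    · exact ⟨hnp t ht htc, h2.1, h2.2, hsec⟩
  have hG : G ≠ 0 := by
    rintro rfl
    exact h0 (by ext i j; simp [evalAt])
  have hinf : {t : ℝ | t ∈ Set.Icc 0 ωc ∧ |t - ω| < min ε ρ}.Infinite := by
    have hm : 0 < min ε ρ := lt_min hεpos hρ
    rcases hω.2.lt_or_eq with hlt | heq
    · refine (Set.Ioo_infinite (a := ω) (b := min ωc (ω + min ε ρ))
        (lt_min hlt (by linarith))).mono fun t ht => ⟨⟨by linarith [hω.1, ht.1],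
          (ht.2.trans_le (min_le_left _ _)).le⟩, ?_⟩
      have := ht.2.trans_le (min_le_right _ _)
      rw [abs_lt]
      constructor <;> linarith [ht.1]
    · refine (Set.Ioo_infinite (a := max 0 (ω - min ε ρ)) (b := ω)
        (max_lt (by linarith) (by linarith))).mono fun t ht =>
          ⟨⟨((le_max_left _ _).trans_lt ht.1).le, by linarith [ht.2]⟩, ?_⟩
      have := (le_max_right _ _).trans_lt ht.1
      rw [abs_lt]
      constructor <;> linarith [ht.2]
  have hsin := sin_two_mul_eq_zero_of_infinite (η := α + Real.pi / 2) hinf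
    (fun t ht => (hbad t ht.1 ht.2).1) (fun t ht x => ?_) hG
  · rw [show 2 * (α + Real.pi / 2) = 2 * α + Real.pi by ring, Real.sin_add_pi, neg_eq_zero] at hsin
    have hα2 : α = -(Real.pi / 2) := by
      obtain ⟨n, hn⟩ := Real.sin_eq_zero_iff.1 hsin
      have h1 : n = -1 := by
        have h2 : n < 0 := by
          by_contra! h3
          have h4 : (0 : ℝ) ≤ n := by exact_mod_cast h3
          nlinarith [hβ.2]
        have h3 : -2 < n := by
          by_contra! h3
          have h4 : (n : ℝ) ≤ -2 := by exact_mod_cast h3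
          nlinarith [hα.1]
        omega
      rw [h1] at hn
      push_cast at hn
      linarith
    have hpol := hnp ω hω hω'
    have hc := (hres.1 ω (hIcc ω hω) hpol h0).2.2
    have hc' : (lo (star (ω * Complex.I)) + hi (star (ω * Complex.I))) / 2 ∈
        Set.Ioc (-Real.pi) Real.pi := by
      have hev := evalAt_star G (ω * Complex.I)
      rw [← isPole_star] at hpol
      rw [star_ofReal_mul_I] at hpol hev ⊢
      refine (hres.1 (-ω) ⟨by linarith [hω.2], by linarith [hω.1]⟩ hpol ?_).2.2
      rw [hev]
      intro h1
      refine h0 ?_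
      rw [← map_star_map_star (evalAt G (ω * Complex.I)), h1]
      ext i j
      simp
    have hodd := hres.center_star hωc hsect (hIcc ω hω) hω' h0
    rcases hlo with h4 | h4 <;> linarith [hc.1, hc.2, hc'.1, hc'.2]
  · obtain ⟨hp, h1, h2, hsec⟩ := hbad t ht.1 ht.2
    refine le_antisymm ?_ ((h t ht.1 hp).1 x)
    have h3 := hsec.inHalfPlane (η := lo (t * Complex.I) + Real.pi / 2) (by linarith) le_rfl x
    have h4 : Complex.exp (-(Complex.I * ((lo (t * Complex.I) + Real.pi / 2 : ℝ) : ℂ))) =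
        -Complex.exp (-(Complex.I * ((α + Real.pi / 2 : ℝ) : ℂ))) := by
      rcases h2 with h2 | h2 <;> rw [h2]
      · rw [← Complex.exp_sub_pi_mul_I]
        congr 1; push_cast; ring
      · rw [← Complex.exp_add_pi_mul_I]
        congr 1; push_cast; ring
    rw [h4, neg_mul, Complex.neg_re] at h3
    linarith

/-- The system has its phases in `[α, β]` up to the frequency `ωc` if and only if its numerical
ranges lie in two half-planes. -/
theorem phasesWithin_iff {m : ℕ} {G : Matrix (Fin m) (Fin m) (RatFunc ℝ)}
    {ωc α β : ℝ} (hωc : 0 < ωc) (hres : ∃ lo hi : ℂ → ℝ, IsPhaseResponse G ωc lo hi)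
    (hsect : IsFreqSemiSectorial G (-ωc) ωc)
    (hα : α ∈ Set.Ioo (-Real.pi) Real.pi) (hβ : β ∈ Set.Ioo (-Real.pi) Real.pi)
    (hαβ : β - α ∈ Set.Ioc 0 Real.pi)
    (hpoles : ∀ ω : ℝ, IsPole G (ω * Complex.I) → |ω| < ωc) :
    PhasesWithin G ωc α β ↔ ∀ ω ∈ Set.Icc 0 ωc, ¬ IsPole G (ω * Complex.I) →
      InHalfPlane (evalAt G (ω * Complex.I)) (α + Real.pi / 2) ∧
      InHalfPlane (evalAt G (ω * Complex.I)) (β - Real.pi / 2) := by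
  have hπ := Real.pi_pos
  constructor
  · rintro ⟨lo, hi, hres, hin⟩ ω hω hp
    by_cases h0 : evalAt G (ω * Complex.I) = 0
    · constructor <;> intro x <;> simp [h0]
    · have hsec := hres.1 ω ⟨by linarith [hω.1], hω.2⟩ hp h0
      obtain ⟨h1, h2⟩ := (Set.Icc_subset_Icc_iff hsec.lo_le_hi).1 (hin ω hω hp h0)
      have h3 := hsec.lo_le_hi
      have h4 := hαβ.2
      exact ⟨hsec.inHalfPlane (by linarith) (by linarith),
        hsec.inHalfPlane (by linarith) (by linarith)⟩
  · intro h
    obtain ⟨lo, hi, hres⟩ := hres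
    classical
    set E : Set ℂ := {s | ∃ ω : ℝ, s = ω * Complex.I ∧ ω ∈ Set.Icc 0 ωc ∧
      ω ∈ critFreq G (-ωc) ωc ∧ ¬ IsPole G s ∧ evalAt G s ≠ 0 ∧ ¬ (α ≤ lo s ∧ hi s ≤ β)} with hE
    have hEsec : ∀ s ∈ E, β = α + Real.pi ∧ IsPhaseSector (evalAt G s) α (α + Real.pi) := by
      rintro _ ⟨ω, rfl, hω, -, hp, h0, hbad⟩
      have hsec := hres.1 ω ⟨by linarith [hω.1], hω.2⟩ hp h0
      obtain ⟨h1, h2⟩ := h ω hω hp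
      obtain ⟨hβα, hhi, hlo⟩ := (hsec.subset_or hα hβ hαβ h1 h2).resolve_left hbad
      rw [hhi] at hsec
      exact ⟨hβα, hsec.opposite hlo h1 ⟨by linarith [hα.1], by linarith [hβ.2]⟩⟩
    set lo' : ℂ → ℝ := fun s => if s ∈ E then α else lo s with hlo'
    set hi' : ℂ → ℝ := fun s => if s ∈ E then α + Real.pi else hi s with hhi'
    have hout : ∀ s ∉ E, lo' s = lo s ∧ hi' s = hi s := fun s hs => ⟨if_neg hs, if_neg hs⟩
    have hinE : ∀ s ∈ E, lo' s = α ∧ hi' s = α + Real.pi := fun s hs => ⟨if_pos hs, if_pos hs⟩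
    have hcontour : ∀ ε > (0 : ℝ), ∀ s ∈ contour (-ωc) ωc ε (critFreq G (-ωc) ωc), s ∉ E := by
      rintro ε hε s hs ⟨ω, rfl, -, hωc, -⟩
      exact ofReal_mul_I_notMem_contour hε hωc hs
    refine ⟨lo', hi', ⟨fun ω hω hp h0 => ?_, ?_⟩, fun ω hω hp h0 => ?_⟩
    · by_cases hs : (ω : ℂ) * Complex.I ∈ E
      · rw [(hinE _ hs).1, (hinE _ hs).2]
        exact (hEsec _ hs).2
      · rw [(hout _ hs).1, (hout _ hs).2]
        exact hres.1 ω hω hp h0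
    · obtain ⟨ε', hε', hsmall⟩ := hres.2
      refine ⟨ε', hε', fun ε hε => ?_⟩
      obtain ⟨hsec, hcont, hz, hz'⟩ := hsmall ε hε
      refine ⟨fun s hs h0 => ?_, hcont.congr fun s hs => ?_, fun hcrit => ?_, fun hcrit => ?_⟩
      · rw [(hout s (hcontour ε hε.1 s hs)).1, (hout s (hcontour ε hε.1 s hs)).2]
        exact hsec s hs h0
      · simp only [(hout s (hcontour ε hε.1 s hs)).1, (hout s (hcontour ε hε.1 s hs)).2]
      · have hs : (0 : ℂ) ∉ E := by
          rintro ⟨ω, h1, -, h2, -⟩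
          obtain rfl : ω = 0 := by simpa using h1.symm
          exact hcrit h2
        rw [(hout _ hs).1, (hout _ hs).2]
        exact hz hcrit
      · have hs : (ε : ℂ) ∉ E := by
          rintro ⟨ω, h1, -⟩
          have h2 := congrArg Complex.re h1
          simp at h2
          exact hε.1.ne' h2
        rw [(hout _ hs).1, (hout _ hs).2]
        exact hz' hcrit
    · by_cases hs : (ω : ℂ) * Complex.I ∈ E
      · rw [(hinE _ hs).1, (hinE _ hs).2, (hEsec _ hs).1]
      · rw [(hout _ hs).1, (hout _ hs).2]
        have hgood : α ≤ lo (ω * Complex.I) ∧ hi (ω * Complex.I) ≤ β := by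
          by_cases hcrit : ω ∈ critFreq G (-ωc) ωc
          · by_contra hbad
            exact hs ⟨ω, rfl, hω, hcrit, hp, h0, hbad⟩
          · exact hres.subset_of_notMem_critFreq hωc hsect hα hβ hαβ hpoles h hω hcrit h0
        exact Set.Icc_subset_Icc hgood.1 hgood.2

theorem star_sum_elim {a b : Type*} (x : a → ℂ) (y : b → ℂ) :
    star (Sum.elim x y) = Sum.elim (star x) (star y) := by
  ext i
  cases i <;> rfl

theorem phaseMultiplier_isHermitian (m : ℕ) (η : ℝ) : (phaseMultiplier m η).IsHermitian := by
  have h : star (Complex.exp (Complex.I * (η : ℂ))) = Complex.exp (-(Complex.I * (η : ℂ))) := by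
    rw [Complex.star_def, ← Complex.exp_conj]
    congr 1
    simp
  rw [phaseMultiplier, isHermitian_fromBlocks_iff]
  refine ⟨isHermitian_zero, ?_, ?_, isHermitian_zero⟩
  · rw [conjTranspose_smul, conjTranspose_one, h]
  · rw [← h, conjTranspose_smul, conjTranspose_one, star_star]

theorem gainMultiplier_isHermitian (m : ℕ) (γ : ℝ) : (gainMultiplier m γ).IsHermitian := by
  rw [gainMultiplier, isHermitian_fromBlocks_iff]
  refine ⟨isHermitian_one, conjTranspose_zero, conjTranspose_zero, ?_⟩
  rw [IsHermitian, conjTranspose_smul, conjTranspose_one]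
  simp

theorem multiplierForm_phaseMultiplier {m : ℕ} (η : ℝ) (g : Matrix (Fin m) (Fin m) ℂ)
    (u : Fin m → ℂ) : multiplierForm (phaseMultiplier m η) g u =
      2 * (Complex.exp (-(Complex.I * η)) * (star u ⬝ᵥ (g *ᵥ u))).re := by
  have h : Complex.exp (Complex.I * (η : ℂ)) = star (Complex.exp (-(Complex.I * (η : ℂ)))) := by
    rw [Complex.star_def, ← Complex.exp_conj]
    congr 1
    simp
  have h2 : star (g *ᵥ u) ⬝ᵥ u = star (star u ⬝ᵥ (g *ᵥ u)) := by
    rw [star_dotProduct]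
  rw [multiplierForm, phaseMultiplier, fromBlocks_mulVec, Sum.elim_comp_inl, Sum.elim_comp_inr,
    star_sum_elim, sumElim_dotProduct_sumElim]
  simp only [zero_mulVec, zero_add, add_zero, smul_mulVec, one_mulVec, dotProduct_smul, smul_eq_mul]
  rw [h, h2, ← star_mul', Complex.add_re, Complex.star_def, Complex.conj_re]
  ring

theorem multiplierForm_gainMultiplier {m : ℕ} (γ : ℝ) (g : Matrix (Fin m) (Fin m) ℂ)
    (u : Fin m → ℂ) : multiplierForm (gainMultiplier m γ) g u =
      ‖WithLp.toLp 2 (g *ᵥ u)‖ ^ 2 - γ ^ 2 * ‖WithLp.toLp 2 u‖ ^ 2 := by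
  have hn : ∀ v : Fin m → ℂ, star v ⬝ᵥ v = ((‖WithLp.toLp 2 v‖ ^ 2 : ℝ) : ℂ) := by
    intro v
    rw [EuclideanSpace.norm_sq_eq, dotProduct, Complex.ofReal_sum]
    refine Finset.sum_congr rfl fun i _ => ?_
    rw [Pi.star_apply, Complex.star_def, Complex.conj_mul']
    push_cast
    rfl
  rw [multiplierForm, gainMultiplier, fromBlocks_mulVec, Sum.elim_comp_inl, Sum.elim_comp_inr,
    star_sum_elim, sumElim_dotProduct_sumElim]
  simp only [zero_mulVec, zero_add, add_zero, smul_mulVec, one_mulVec, dotProduct_smul, smul_eq_mul,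
    neg_smul, neg_mulVec, dotProduct_neg, hn]
  rw [← Complex.ofReal_pow, ← Complex.ofReal_mul, ← sub_eq_add_neg, ← Complex.ofReal_sub,
    Complex.ofReal_re]

theorem multiplierForm_gainMultiplier_nonpos_iff {m : ℕ} {γ : ℝ} (hγ : 0 ≤ γ)
    (g : Matrix (Fin m) (Fin m) ℂ) :
    (∀ u, multiplierForm (gainMultiplier m γ) g u ≤ 0) ↔ maxSingularValue g ≤ γ := by
  have h1 : ∀ u : Fin m → ℂ, multiplierForm (gainMultiplier m γ) g u ≤ 0 ↔
      ‖toEuclideanCLM (n := Fin m) (𝕜 := ℂ) g (WithLp.toLp 2 u)‖ ≤ γ * ‖WithLp.toLp 2 u‖ := by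
    intro u
    rw [multiplierForm_gainMultiplier, sub_nonpos, ← mul_pow, toEuclideanCLM_toLp,
      pow_le_pow_iff_left₀ (norm_nonneg _) (by positivity) two_ne_zero]
  simp only [h1, maxSingularValue]
  constructor
  · exact fun h => ContinuousLinearMap.opNorm_le_bound _ hγ fun x => h x.ofLp
  · exact fun h u => ContinuousLinearMap.le_of_opNorm_le _ h _

theorem multiplierForm_phaseMultiplier_nonpos_iff {m : ℕ} {η η' : ℝ}
    (hη : η' = η + Real.pi ∨ η' = η - Real.pi) (g : Matrix (Fin m) (Fin m) ℂ) :
    (∀ u, multiplierForm (phaseMultiplier m η) g u ≤ 0) ↔ InHalfPlane g η' := by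
  refine forall_congr' fun u => ?_
  have h4 : Complex.exp (-(Complex.I * (η' : ℂ))) = -Complex.exp (-(Complex.I * (η : ℂ))) := by
    rcases hη with rfl | rfl
    · rw [← Complex.exp_sub_pi_mul_I]
      congr 1; push_cast; ring
    · rw [← Complex.exp_add_pi_mul_I]
      congr 1; push_cast; ring
  rw [multiplierForm_phaseMultiplier, h4, neg_mul, Complex.neg_re]
  constructor <;> intro h <;> linarith

end MixedGP

theorem mainTheorem4 {m k : ℕ} (G : Matrix (Fin m) (Fin m) (RatFunc ℝ)) (ωc γ α β : ℝ)
    (hωc : 0 < ωc) (hγ : 0 < γ)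
    (hα : α ∈ Set.Ioo (-Real.pi) Real.pi) (hβ : β ∈ Set.Ioo (-Real.pi) Real.pi)
    (hαβ : β - α ∈ Set.Ioc 0 Real.pi)
    (hstable : MixedGP.IsSemiStable G)
    (hsect : MixedGP.IsFreqSemiSectorial G (-ωc) ωc)
    (hpoles : ∀ ω : ℝ, MixedGP.IsPole G (ω * Complex.I) → |ω| < ωc)
    (hphase : ∃ lo hi : ℂ → ℝ, MixedGP.IsPhaseResponse G ωc lo hi)
    (A : Matrix (Fin k) (Fin k) ℝ) (B : Matrix (Fin k) (Fin m) ℝ)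
    (C : Matrix (Fin m) (Fin k) ℝ) (D : Matrix (Fin m) (Fin m) ℝ)
    (hreal : MixedGP.IsMinimalRealization G A B C D) :
    (MixedGP.PhasesWithin G ωc α β ∧
      ∀ ω : ℝ, ωc ≤ ω →
        MixedGP.maxSingularValue (MixedGP.evalAt G (ω * Complex.I)) ≤ γ) ↔
    ∃ P₁ P₂ P₃ Q₁ Q₂ Q₃ : Matrix (Fin k) (Fin k) ℂ,
      P₁.IsHermitian ∧ P₂.IsHermitian ∧ P₃.IsHermitian ∧
      Q₁.PosSemidef ∧ Q₂.PosSemidef ∧ Q₃.PosSemidef ∧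
      MixedGP.NegSemidef (MixedGP.lmiForm A B C D (MixedGP.lowFreqBlock ωc P₁ Q₁)
        (MixedGP.phaseMultiplier m (α - Real.pi / 2))) ∧
      MixedGP.NegSemidef (MixedGP.lmiForm A B C D (MixedGP.lowFreqBlock ωc P₂ Q₂)
        (MixedGP.phaseMultiplier m (Real.pi / 2 + β))) ∧
      MixedGP.NegSemidef (MixedGP.lmiForm A B C D (MixedGP.highFreqBlock ωc P₃ Q₃)
        (MixedGP.gainMultiplier m γ)) := by
  have hctrl := fun a => hreal.controllable a
  have h₁ := MixedGP.low_frequency_kyp hreal.1 hctrl hωc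
    (MixedGP.phaseMultiplier_isHermitian m (α - Real.pi / 2))
  have h₂ := MixedGP.low_frequency_kyp hreal.1 hctrl hωc
    (MixedGP.phaseMultiplier_isHermitian m (Real.pi / 2 + β))
  have h₃ := MixedGP.high_frequency_kyp hreal.1 hctrl hωc
    (MixedGP.gainMultiplier_isHermitian m γ)
  simp only [MixedGP.multiplierForm_phaseMultiplier_nonpos_iff (η := α - Real.pi / 2)
    (η' := α + Real.pi / 2) (Or.inl (by ring))] at h₁
  simp only [MixedGP.multiplierForm_phaseMultiplier_nonpos_iff (η := Real.pi / 2 + β)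
    (η' := β - Real.pi / 2) (Or.inr (by ring))] at h₂
  simp only [MixedGP.multiplierForm_gainMultiplier_nonpos_iff hγ.le] at h₃
  rw [MixedGP.phasesWithin_iff hωc hphase hsect hα hβ hαβ hpoles]
  constructor
  · rintro ⟨hphases, hgain⟩
    obtain ⟨P₁, Q₁, hP₁, hQ₁, hX₁⟩ := h₁.2 fun ω hω hp => (hphases ω hω hp).1
    obtain ⟨P₂, Q₂, hP₂, hQ₂, hX₂⟩ := h₂.2 fun ω hω hp => (hphases ω hω hp).2
    obtain ⟨P₃, Q₃, hP₃, hQ₃, hX₃⟩ := h₃.2 fun ω hω _ => hgain ω hω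
    exact ⟨P₁, P₂, P₃, Q₁, Q₂, Q₃, hP₁, hP₂, hP₃, hQ₁, hQ₂, hQ₃, hX₁, hX₂, hX₃⟩
  · rintro ⟨P₁, P₂, P₃, Q₁, Q₂, Q₃, hP₁, hP₂, hP₃, hQ₁, hQ₂, hQ₃, hX₁, hX₂, hX₃⟩
    refine ⟨fun ω hω hp => ⟨h₁.1 ⟨P₁, Q₁, hP₁, hQ₁, hX₁⟩ ω hω hp,
      h₂.1 ⟨P₂, Q₂, hP₂, hQ₂, hX₂⟩ ω hω hp⟩, fun ω hω =>
      h₃.1 ⟨P₃, Q₃, hP₃, hQ₃, hX₃⟩ ω hω fun hp => ?_⟩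
    exact absurd (hpoles ω hp) (not_lt.2 (hω.trans (le_abs_self ω)))
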